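/- Let $\mathcal X$ be a finite set, let $p_X$ be a probability distribution on $\mathcal X$ with $p_X(x)>0$ for all $x$, such that every $p_X(x)$ is a computable real number, and let $d:\mathcal X\times\mathcal X\to[0,\infty)$. Logarithms are in base $2$, $[\tau]=\{1,\dots,\lfloor\tau\rfloor\}$, $\mathbb R_+=(0,\infty)$, $\mathbb N=\{1,2,\dots\}$, and $d$ is extended additively: $d(x_{1:n},y_{1:n})=\frac1n\sum_{t}d(x_t,y_t)$, and the distortion of a batch of pairs of sequences is the average of the distortions of the pairs. **Codes.** An $(n,R,R_c)$ code is a pair of conditional distributions, $F^{(n)}_{M|X_{1:n},J}$ from $\mathcal X^n\times[2^{nR_c}]$ to $[2^{nR}]$ and $G^{(n)}_{Y_{1:n}|M,J}$ from $[2^{nR}]\times[2^{nR_c}]$ to $\mathcal X^n$. It induces the distribution $P^{(n)}=p_X^{\otimes n}\cdot p^{\mathcal U}_{[2^{nR_c}]}\cdot F^{(n)}_{M|X_{1:n},J}\cdot G^{(n)}_{Y_{1:n}|M,J}$ of $(X_{1:n},J,M,Y_{1:n})$, where $p^{\mathcal U}$ denotes the uniform distribution. **Critics.** A $p_X^{\otimes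 *}$-critic is a function $\delta:\bigcup_{n\in\mathbb N}\mathcal X^n\to\mathbb R$ with $\sum_{x\in\mathcal X^n}p_X^{\otimes n}(x)2^{\delta(x)}\le 1$ for every $n\in\mathbb N$. It is lower semi-computable if it is the pointwise limit of $\varphi(\cdot,k)$ as $k\to\infty$, for a computable rational-valued function $\varphi$ that is non-decreasing in $k$. A batch of $b$ sequences of length $n$ is evaluated by $\delta$ as the concatenated sequence of length $nb$. **Achievability.** Let $\{B_n\}_{n\ge1}$ be a sequence of positive integers. * $(R,R_c,\{B_n\},\Delta)$ is asymptotically achievable with *algorithmic realism* if for every $\varepsilon>0$ there is a sequence of codes, the $n$-th being an $(n,R+\varepsilon,R_c)$ code, such that, for batches $(\mathbf X^{(n,B_n)},\mathbf Y^{(n,B_n)})$ of $B_n$ i.i.d. pairs distributed according to $P^{(n)}_{X_{1:n},Y_{1:n}}$, $\limsup_{n\to\infty}\mathbb E[d(\mathbf X^{(n,B_n)},\mathbf Y^{(n,B_n)})]\le\Delta+\varepsilon$, and for every lower semi-computable $p_X^{\otimes *}$-critic $\delta$, $\sup_{n\in\mathbb N}\mathbb E[\delta(\mathbf Y^{(n,B_n)})]<\infty$.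 * $(R,R_c,\Delta)$ is asymptotically achievable with *near-perfect realism* if for every $\varepsilon>0$ there is a sequence of codes, the $n$-th being an $(n,R+\varepsilon,R_c)$ code, such that $\limsup_{n\to\infty}\mathbb E_{P^{(n)}}[d(X_{1:n},Y_{1:n})]\le\Delta+\varepsilon$ and $\|P^{(n)}_{Y_{1:n}}-p_X^{\otimes n}\|_{TV}\to0$, where $\|\cdot\|_{TV}$ denotes total variation distance. * $(R,R_c,\Delta)$ is asymptotically achievable with *perfect realism* if the same holds with the last condition replaced by: there is $N$ such that $P^{(n)}_{Y_{1:n}}=p_X^{\otimes n}$ for all $n\ge N$. **Theorem.** Let $\{B_n\}_{n\ge1}$ be a computable, increasing (not necessarily strictly) sequence of positive integers with $B_n/|\mathcal X|^n\to\infty$. Then for every $R_c\in\mathbb R_{\ge0}$ and $(R,\Delta)\in(\mathbb R_+)^2$, the following are equivalent: $(R,R_c,\{B_n\},\Delta)$ is asymptotically achievable with algorithmic realism; $(R,R_c,\Delta)$ is asymptotically achievable with near-perfect realism; $(R,R_c,\Delta)$ is asymptotically achievable with perfect realism. Moreover, the closure in $\mathbb R^3$ of the set of such achievable triplets $(R,R_c,\Delta)\in\mathbb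 R_+\times\mathbb R_{\ge0}\times\mathbb R_+$ is the set of all $(R,R_c,\Delta)\in\mathbb R^3$ with $R_c\ge0$ for which there exist a finite set $\mathcal V$ and a conditional distribution $p_{Y,V|X}$ from $\mathcal X$ to $\mathcal X\times\mathcal V$ such that, under $p_X\cdot p_{Y,V|X}$, $$p_Y=p_X,\qquad R\ge I(X;V),\qquad R+R_c\ge I(Y;V),\qquad \Delta\ge\mathbb E[d(X,Y)],$$ and $X-V-Y$ is a Markov chain. -/

import Mathlib

open Filter Topology

noncomputable section

namespace RDP

/-! ### Computability -/

/-- A map to `ℚ` is computable if it is `a ↦ ± num / den` for a computable map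
`a ↦ (sign, num, den)` with `den > 0`. -/
def ComputableRat {α : Type*} [Primcodable α] (φ : α → ℚ) : Prop :=
  ∃ f : α → Bool × ℕ × ℕ, Computable f ∧
    ∀ a, 0 < (f a).2.2 ∧
      φ a = (if (f a).1 then 1 else -1) * ((f a).2.1 : ℚ) / ((f a).2.2 : ℚ)

/-- `f` is the pointwise limit of a nondecreasing computable sequence of rational-valued maps. -/
def LowerSemicomputable {α : Type*} [Primcodable α] (f : α → ℝ) : Prop :=
  ∃ φ : α × ℕ → ℚ, ComputableRat φ ∧
    (∀ a k, φ (a, k) ≤ φ (a, k + 1)) ∧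
    ∀ a, Tendsto (fun k => (φ (a, k) : ℝ)) atTop (𝓝 (f a))

/-- A computable real-valued map. -/
def ComputableRealMap {α : Type*} [Primcodable α] (f : α → ℝ) : Prop :=
  LowerSemicomputable f ∧ LowerSemicomputable (fun a => -f a)

/-! ### Finite distributions

A distribution on a finite type `α` is an element of `stdSimplex ℝ α`. -/

/-- Expectation of `f` under the mass function `P`. -/
def expect {α : Type*} [Fintype α] (P : α → ℝ) (f : α → ℝ) : ℝ := ∑ a, P a * f a

/-- The `n`-fold product `P^{⊗ n}`. -/
def iid {α : Type*} (P : α → ℝ) (n : ℕ) : (Fin n → α) → ℝ := fun z => ∏ i, P (z i)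

/-- Total variation distance. -/
def tvDist {α : Type*} [Fintype α] (P Q : α → ℝ) : ℝ := (1 / 2) * ∑ a, |P a - Q a|

/-- Mutual information, in bits, between the two coordinates of the joint mass function `Q`.
Pairs of mass zero contribute zero. -/
def mutualInfo {α β : Type*} [Fintype α] [Fintype β] (Q : α × β → ℝ) : ℝ :=
  ∑ a, ∑ b, Q (a, b) * Real.logb 2 (Q (a, b) / ((∑ b', Q (a, b')) * (∑ a', Q (a', b))))

/-! ### Critics -/

/-- A `p^{⊗ *}`-critic. Only the values on nonempty words matter. -/
def IsCritic {X : Type*} [Fintype X] (p : X → ℝ) (δ : List X → ℝ) : Prop :=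
  ∀ n : ℕ, 1 ≤ n →
    ∑ x : Fin n → X, iid p n x * (2 : ℝ) ^ (δ (List.ofFn x)) ≤ 1

/-- The word of length `n * b` obtained by concatenating a batch of `b` words of length `n`. -/
def batchWord {X : Type*} {n b : ℕ} (y : Fin b → Fin n → X) : List X :=
  (List.ofFn fun k => List.ofFn (y k)).flatten

/-! ### Codes -/

/-- The cardinality of `[2^{nR}] = {1, …, ⌊2^{nR}⌋}`. -/
def indexCard (n : ℕ) (R : ℝ) : ℕ := ⌊(2 : ℝ) ^ ((n : ℝ) * R)⌋₊

/-- An `(n, R, Rc)` code: a privately randomized encoder `F_{M | X_{1:n}, J}` (written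
`enc x j m`) and a privately randomized decoder `G_{Y_{1:n} | M, J}` (written `dec m j y`). -/
structure Code (X : Type*) [Fintype X] (n : ℕ) (R Rc : ℝ) where
  enc : (Fin n → X) → Fin (indexCard n Rc) → Fin (indexCard n R) → ℝ
  dec : Fin (indexCard n R) → Fin (indexCard n Rc) → (Fin n → X) → ℝ
  enc_mem : ∀ x j, enc x j ∈ stdSimplex ℝ (Fin (indexCard n R))
  dec_mem : ∀ m j, dec m j ∈ stdSimplex ℝ (Fin n → X)

namespace Code

variable {X : Type*} [Fintype X] {n : ℕ} {R Rc : ℝ}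

/-- The distribution of `(X_{1:n}, J, M, Y_{1:n})` induced by the code, with `X_{1:n}` i.i.d.
according to `p` and `J` uniform and independent of `X_{1:n}`. -/
def induced (c : Code X n R Rc) (p : X → ℝ) :
    (Fin n → X) × Fin (indexCard n Rc) × Fin (indexCard n R) × (Fin n → X) → ℝ :=
  fun w => iid p n w.1 * (1 / (indexCard n Rc : ℝ)) * c.enc w.1 w.2.1 w.2.2.1 *
    c.dec w.2.2.1 w.2.1 w.2.2.2

/-- The induced distribution of `(X_{1:n}, Y_{1:n})`. -/
def inducedXY (c : Code X n R Rc) (p : X → ℝ) : (Fin n → X) × (Fin n → X) → ℝ :=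
  fun z => ∑ j, ∑ m, c.induced p (z.1, j, m, z.2)

/-- The induced distribution of the reconstruction `Y_{1:n}`. -/
def inducedY (c : Code X n R Rc) (p : X → ℝ) : (Fin n → X) → ℝ :=
  fun y => ∑ x, c.inducedXY p (x, y)

end Code

/-! ### Achievability -/

/-- Additive extension of a distortion measure to sequences of length `b`. -/
def avgDist {α : Type*} (d : α → α → ℝ) {b : ℕ} (x y : Fin b → α) : ℝ :=
  (1 / (b : ℝ)) * ∑ k, d (x k) (y k)

/-- Expected distortion of a batch of `b` i.i.d. pairs `(X_{1:n}, Y_{1:n})`. -/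
def batchDistortion {X : Type*} [Fintype X] (p : X → ℝ) (d : X → X → ℝ) {n : ℕ} {R Rc : ℝ}
    (c : Code X n R Rc) (b : ℕ) : ℝ :=
  expect (iid (c.inducedXY p) b)
    (fun z => avgDist (avgDist d) (fun k => (z k).1) (fun k => (z k).2))

/-- Expected score given by `δ` to a batch of `b` i.i.d. reconstructions. -/
def batchScore {X : Type*} [Fintype X] (p : X → ℝ) (δ : List X → ℝ) {n : ℕ} {R Rc : ℝ}
    (c : Code X n R Rc) (b : ℕ) : ℝ :=
  expect (iid (c.inducedXY p) b) (fun z => δ (batchWord fun k => (z k).2))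

/-- Expected distortion of a single pair `(X_{1:n}, Y_{1:n})`. -/
def distortion {X : Type*} [Fintype X] (p : X → ℝ) (d : X → X → ℝ) {n : ℕ} {R Rc : ℝ}
    (c : Code X n R Rc) : ℝ :=
  expect (c.inducedXY p) (fun z => avgDist d z.1 z.2)

/-- Asymptotic achievability with algorithmic realism. Block lengths are the `n ≥ 1`.
The code sequence is chosen before the critic, and the bound on the score may depend on
the critic. (The distortion sequences in this and the next definitions are bounded since the
alphabet is finite, so that `limsup` is the genuine one.) -/
def AchievableAlgorithmic {X : Type*} [Fintype X] [Primcodable X] (p : X → ℝ) (d : X → X → ℝ)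
    (R Rc : ℝ) (B : ℕ → ℕ) (Δ : ℝ) : Prop :=
  ∀ ε : ℝ, 0 < ε → ∃ c : ∀ n : ℕ, Code X n (R + ε) Rc,
    limsup (fun n => batchDistortion p d (c n) (B n)) atTop ≤ Δ + ε ∧
    ∀ δ : List X → ℝ, LowerSemicomputable δ → IsCritic p δ →
      ∃ C : ℝ, ∀ n : ℕ, 1 ≤ n → batchScore p δ (c n) (B n) ≤ C

/-- Asymptotic achievability with near-perfect realism. -/
def AchievableNearPerfect {X : Type*} [Fintype X] (p : X → ℝ) (d : X → X → ℝ)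
    (R Rc Δ : ℝ) : Prop :=
  ∀ ε : ℝ, 0 < ε → ∃ c : ∀ n : ℕ, Code X n (R + ε) Rc,
    limsup (fun n => distortion p d (c n)) atTop ≤ Δ + ε ∧
    Tendsto (fun n => tvDist ((c n).inducedY p) (iid p n)) atTop (𝓝 0)

/-- Asymptotic achievability with perfect realism. -/
def AchievablePerfect {X : Type*} [Fintype X] (p : X → ℝ) (d : X → X → ℝ)
    (R Rc Δ : ℝ) : Prop :=
  ∀ ε : ℝ, 0 < ε → ∃ c : ∀ n : ℕ, Code X n (R + ε) Rc,
    limsup (fun n => distortion p d (c n)) atTop ≤ Δ + ε ∧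
    ∃ N : ℕ, ∀ n : ℕ, N ≤ n → (c n).inducedY p = iid p n

/-! ### The single-letter region -/

/-- The joint mass function of `(X, Y, V)` when `X` has law `p` and `(Y, V)` has conditional law
`W x` given `X = x`. -/
def jointXYV {X V : Type*} (p : X → ℝ) (W : X → X × V → ℝ) (x y : X) (v : V) : ℝ :=
  p x * W x (y, v)

/-- The triplets `(R, Rc, Δ)` with `Rc ≥ 0` for which there are a finite alphabet for `V` and a
conditional distribution `W = p_{Y,V|X}` with `p_Y = p_X`, `X - V - Y` a Markov chain,
`R ≥ I(X;V)`, `R + Rc ≥ I(Y;V)` and `Δ ≥ E[d(X,Y)]`. -/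
def region {X : Type*} [Fintype X] (p : X → ℝ) (d : X → X → ℝ) : Set (ℝ × ℝ × ℝ) :=
  {t | 0 ≤ t.2.1 ∧ ∃ (s : ℕ) (W : X → X × Fin s → ℝ),
    (∀ x, W x ∈ stdSimplex ℝ (X × Fin s)) ∧
    (∀ y, ∑ x, ∑ v, jointXYV p W x y v = p y) ∧
    mutualInfo (fun a : X × Fin s => ∑ y, jointXYV p W a.1 y a.2) ≤ t.1 ∧
    mutualInfo (fun a : X × Fin s => ∑ x, jointXYV p W x a.1 a.2) ≤ t.1 + t.2.1 ∧
    ∑ x, ∑ y, ∑ v, jointXYV p W x y v * d x y ≤ t.2.2 ∧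
    ∀ x y v, jointXYV p W x y v * (∑ x', ∑ y', jointXYV p W x' y' v) =
      (∑ y', jointXYV p W x y' v) * (∑ x', jointXYV p W x' y v)}

end RDP

end

/-!
Near-perfect realism is upgraded to perfect realism by composing the decoder with a maximal coupling
of `P_Y` and `p^{⊗ n}`, which costs at most `max d` times the total variation distance; conversely,
under perfect realism `E[δ(Y)] = E_p[δ] ≤ 0` for every critic, by Jensen's inequality.

For algorithmic realism the point is that the empirical distribution of `B_n ≫ |X|^n` i.i.d. blocks
is typically within `√(|X|^n / B_n)` of their law. Hence the largest `ℓ` such that some event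
witnesses an excess of the empirical distribution over `p^{⊗ n}` of more than `1 / q`, subject to
`4^ℓ |X|^n q² ≤ B_n`, is up to the additive constant `-1` a critic, and it is lower semicomputable
because `p` can be approximated from above. As `B_n / |X|^n → ∞`, bounded scores force
`‖P_Y - p^{⊗ n}‖_TV < 2 / q` for large `n`, for every `q`.

Conditionally on `V`, the Markov chain makes `X` and `Y` independent, so the region consists of the
triplets dominated by mixtures of product distributions `q ⊗ r` with values `D(q‖p)`, `D(r‖p)` and
`E[d]`. It is therefore a projection of the convex hull of a compact set, which makes it closed. The
converse conditions on `(M, J)` and single-letterizes by superadditivity of relative entropy and a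
uniform random time. For achievability, the codewords are drawn i.i.d. from `p_V`, the encoder is
the likelihood encoder, and soft covering at rates `R > I(X;V)` and `R + R_c > I(Y;V)` makes the
induced law of `(X, Y)` close to the ideal one.
-/

noncomputable section

namespace RDP

/-! ### Weighted averages on finite types -/

section Weights

variable {α : Type*} [Fintype α] {w : α → ℝ}

theorem nonempty_of_mem_stdSimplex (hw : w ∈ stdSimplex ℝ α) : Nonempty α := by
  by_contra hα
  have := not_nonempty_iff.1 hα
  simpa using hw.2

theorem apply_le_one_of_mem_stdSimplex (hw : w ∈ stdSimplex ℝ α) (a : α) : w a ≤ 1 :=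
  (Finset.single_le_sum (fun b _ => hw.1 b) (Finset.mem_univ a)).trans_eq hw.2

theorem mul_kernel_mem_stdSimplex {β : Type*} [Fintype β] (hw : w ∈ stdSimplex ℝ α)
    {k : α → β → ℝ} (hk : ∀ a, k a ∈ stdSimplex ℝ β) :
    (fun z : α × β => w z.1 * k z.1 z.2) ∈ stdSimplex ℝ (α × β) := by
  refine ⟨fun z => mul_nonneg (hw.1 _) ((hk _).1 _), ?_⟩
  simp only [Fintype.sum_prod_type, ← Finset.mul_sum, (hk _).2, mul_one, hw.2]

theorem exists_mem_stdSimplex_sum_mul_eq [Nonempty α] {f : α → ℝ} (hf : ∀ a, 0 ≤ f a) :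
    ∃ w ∈ stdSimplex ℝ α, ∀ a, (∑ a', f a') * w a = f a := by
  classical
  rcases (Finset.sum_nonneg fun a (_ : a ∈ Finset.univ) => hf a).eq_or_lt with h0 | hpos
  · have hzero (a) : f a = 0 :=
      (Finset.sum_eq_zero_iff_of_nonneg fun a _ => hf a).1 h0.symm a (Finset.mem_univ a)
    exact ⟨_, single_mem_stdSimplex ℝ (Classical.arbitrary α), by simp [hzero]⟩
  · refine ⟨fun a => f a / ∑ a', f a', ⟨fun a => div_nonneg (hf a) hpos.le, ?_⟩,
      fun a => mul_div_cancel₀ _ hpos.ne'⟩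
    rw [← Finset.sum_div, div_self hpos.ne']

theorem sum_mul_le_add_mul_one_sub (hw : w ∈ stdSimplex ℝ α) {f : α → ℝ} {D : ℝ}
    (hf : ∀ a, f a ≤ D) {a : α} (ha : 0 ≤ f a) :
    ∑ a', w a' * f a' ≤ f a + D * (1 - w a) := by
  classical
  calc ∑ a', w a' * f a' = w a * f a + ∑ a' ∈ Finset.univ.erase a, w a' * f a' :=
        (Finset.add_sum_erase _ _ (Finset.mem_univ a)).symm
    _ ≤ 1 * f a + ∑ a' ∈ Finset.univ.erase a, w a' * D := by
        gcongr with a'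
        exacts [apply_le_one_of_mem_stdSimplex hw a, hw.1 a', hf a']
    _ = f a + D * (1 - w a) := by
        rw [← Finset.sum_mul, Finset.sum_erase_eq_sub (Finset.mem_univ a), hw.2]
        ring

theorem sum_mul_le_sqrt_sum_mul_sq (hw : w ∈ stdSimplex ℝ α) {z : α → ℝ} (hz : ∀ a, 0 ≤ z a) :
    ∑ a, w a * z a ≤ √(∑ a, w a * z a ^ 2) :=
  Real.le_sqrt_of_sq_le
    (Real.pow_arith_mean_le_arith_mean_pow Finset.univ w z (fun a _ => hw.1 a) hw.2
      (fun a _ => hz a) 2)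

theorem sum_sqrt_mul_le (hw : w ∈ stdSimplex ℝ α) (c : ℝ) :
    ∑ a, √(w a * c) ≤ √(Fintype.card α * c) := by
  rcases le_total c 0 with hc | hc
  · rw [Finset.sum_eq_zero fun a _ =>
      Real.sqrt_eq_zero_of_nonpos (mul_nonpos_of_nonneg_of_nonpos (hw.1 a) hc)]
    exact Real.sqrt_nonneg _
  · refine Real.le_sqrt_of_sq_le ?_
    calc (∑ a, √(w a * c)) ^ 2 ≤ Fintype.card α * ∑ a, √(w a * c) ^ 2 :=
          sq_sum_le_card_mul_sum_sq
      _ = Fintype.card α * c := by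
          simp only [Real.sq_sqrt (mul_nonneg (hw.1 _) hc), ← Finset.sum_mul, hw.2, one_mul]

theorem exists_le_of_sum_mul_le (hw : w ∈ stdSimplex ℝ α) {f : α → ℝ} {b : ℝ}
    (h : ∑ a, w a * f a ≤ b) : ∃ a, f a ≤ b := by
  have := nonempty_of_mem_stdSimplex hw
  obtain ⟨a, ha⟩ := Finite.exists_min f
  refine ⟨a, le_trans ?_ h⟩
  calc f a = ∑ a', w a' * f a := by rw [← Finset.sum_mul, hw.2, one_mul]
    _ ≤ ∑ a', w a' * f a' := by gcongr with a'; exacts [hw.1 a', ha a']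

theorem sum_mul_logb_le (hw : w ∈ stdSimplex ℝ α) {z : α → ℝ} (hz : ∀ a, 0 < w a → 0 < z a)
    {b : ℝ} (hb : ∑ a, w a * z a ≤ b) :
    ∑ a, w a * Real.logb 2 (z a) ≤ Real.logb 2 b := by
  -- Values at points of weight zero are irrelevant, so they may be taken positive.
  obtain ⟨z', hz', hzz'⟩ : ∃ z' : α → ℝ, (∀ a, 0 < z' a) ∧ ∀ a, w a ≠ 0 → z a = z' a := by
    refine ⟨fun a => if 0 < w a then z a else 1, fun a => ?_, fun a ha => ?_⟩
    · dsimp only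
      split_ifs with h
      exacts [hz a h, one_pos]
    · exact (if_pos ((hw.1 a).lt_of_ne' ha)).symm
  have hcongr (f : ℝ → ℝ) : ∑ a, w a * f (z a) = ∑ a, w a * f (z' a) :=
    Finset.sum_congr rfl fun a _ => by
      by_cases h : w a = 0
      · simp [h]
      · rw [hzz' a h]
  have hpos : 0 < ∑ a, w a * z' a := by
    simpa using (convex_Ioi (0 : ℝ)).sum_mem (fun a _ => hw.1 a) hw.2 fun a _ => hz' a
  have hjensen : ∑ a, w a * Real.log (z' a) ≤ Real.log (∑ a, w a * z' a) :=
    strictConcaveOn_log_Ioi.concaveOn.le_map_sum (fun a _ => hw.1 a) hw.2 fun a _ => hz' a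
  calc ∑ a, w a * Real.logb 2 (z a) = (∑ a, w a * Real.log (z' a)) / Real.log 2 := by
        rw [hcongr (Real.logb 2), Finset.sum_div]
        exact Finset.sum_congr rfl fun a _ => (mul_div_assoc _ _ _).symm
    _ ≤ Real.logb 2 (∑ a, w a * z' a) := by
        rw [Real.logb]
        gcongr
    _ ≤ Real.logb 2 b :=
        Real.logb_le_logb_of_le one_lt_two hpos ((hcongr id).symm.trans_le hb)

theorem sum_mul_sub_mean_sq_le (hw : ∑ a, w a = 1) (f : α → ℝ) :
    ∑ a, w a * (f a - ∑ a', w a' * f a') ^ 2 ≤ ∑ a, w a * f a ^ 2 := by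
  set μ := ∑ a, w a * f a with hμ
  calc ∑ a, w a * (f a - μ) ^ 2
      = ∑ a, (w a * f a ^ 2 - 2 * μ * (w a * f a) + μ ^ 2 * w a) :=
        Finset.sum_congr rfl fun a _ => by ring
    _ = ∑ a, w a * f a ^ 2 - μ ^ 2 := by
        rw [Finset.sum_add_distrib, Finset.sum_sub_distrib, ← Finset.mul_sum, ← Finset.mul_sum, hw,
          ← hμ]
        ring
    _ ≤ ∑ a, w a * f a ^ 2 := sub_le_self _ (sq_nonneg μ)

end Weights

/-! ### Finite product distributions -/

section Product

variable {ι α : Type*} [Fintype ι]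

theorem prod_apply_nonneg {w : α → ℝ} (hw : ∀ a, 0 ≤ w a) (c : ι → α) : 0 ≤ ∏ i, w (c i) :=
  Finset.prod_nonneg fun _ _ => hw _

variable [DecidableEq ι] [Fintype α] {w : α → ℝ}

theorem prod_apply_mem_stdSimplex (hw : w ∈ stdSimplex ℝ α) :
    (fun c : ι → α => ∏ i, w (c i)) ∈ stdSimplex ℝ (ι → α) :=
  ⟨prod_apply_nonneg hw.1, by rw [← Fintype.prod_sum fun _ : ι => w, hw.2, Finset.prod_const_one]⟩

theorem sum_prod_mul_apply_mul_apply (hw : ∑ a, w a = 1) (f g : α → ℝ) {i j : ι} (hij : i ≠ j) :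
    ∑ c : ι → α, (∏ k, w (c k)) * (f (c i) * g (c j)) = (∑ a, w a * f a) * ∑ a, w a * g a := by
  have hfactor (c : ι → α) : (∏ k, w (c k)) * (f (c i) * g (c j)) =
      ∏ k, w (c k) * ((if k = i then f (c k) else 1) * (if k = j then g (c k) else 1)) := by
    rw [Finset.prod_mul_distrib, Finset.prod_mul_distrib]
    simp
  have hcoord (k : ι) : (∑ a, w a * ((if k = i then f a else 1) * (if k = j then g a else 1))) =
      (if k = i then ∑ a, w a * f a else 1) * (if k = j then ∑ a, w a * g a else 1) := by
    by_cases hi : k = i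
    · subst hi; simp [hij]
    · by_cases hj : k = j
      · subst hj; simp [hi]
      · simp [hi, hj, hw]
  simp only [hfactor]
  rw [← Fintype.prod_sum fun k a =>
    w a * ((if k = i then f a else 1) * (if k = j then g a else 1))]
  rw [Finset.prod_congr rfl fun k _ => hcoord k, Finset.prod_mul_distrib]
  simp

theorem sum_prod_mul_apply (hw : ∑ a, w a = 1) (f : α → ℝ) (i : ι) :
    ∑ c : ι → α, (∏ k, w (c k)) * f (c i) = ∑ a, w a * f a := by
  have hfactor (c : ι → α) : (∏ k, w (c k)) * f (c i) =
      ∏ k, w (c k) * (if k = i then f (c k) else 1) := by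
    rw [Finset.prod_mul_distrib]
    simp
  have hcoord (k : ι) : (∑ a, w a * (if k = i then f a else 1)) =
      if k = i then ∑ a, w a * f a else 1 := by
    by_cases hi : k = i <;> simp [hi, hw]
  simp only [hfactor]
  rw [← Fintype.prod_sum fun k a => w a * (if k = i then f a else 1)]
  rw [Finset.prod_congr rfl fun k _ => hcoord k]
  simp

theorem sum_prod_mul_sum (hw : ∑ a, w a = 1) (f : α → ℝ) (s : Finset ι) :
    ∑ c : ι → α, (∏ k, w (c k)) * ∑ i ∈ s, f (c i) = s.card * ∑ a, w a * f a := by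
  simp_rw [Finset.mul_sum]
  rw [Finset.sum_comm, Finset.sum_congr rfl fun i _ => sum_prod_mul_apply hw f i]
  simp [Finset.mul_sum]

theorem sum_prod_mul_sum_sq (hw : ∑ a, w a = 1) {g : α → ℝ} (hg : ∑ a, w a * g a = 0)
    (s : Finset ι) :
    ∑ c : ι → α, (∏ k, w (c k)) * (∑ i ∈ s, g (c i)) ^ 2 = s.card * ∑ a, w a * g a ^ 2 := by
  have hrow (i) (hi : i ∈ s) : ∑ c : ι → α, ∑ j ∈ s, (∏ k, w (c k)) * (g (c i) * g (c j)) =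
      ∑ a, w a * g a ^ 2 := by
    rw [Finset.sum_comm, Finset.sum_eq_single_of_mem i hi]
    · simp_rw [← sq]
      exact sum_prod_mul_apply hw (fun a => g a ^ 2) i
    · intro j _ hj
      rw [sum_prod_mul_apply_mul_apply hw g g hj.symm, hg, zero_mul]
  calc ∑ c : ι → α, (∏ k, w (c k)) * (∑ i ∈ s, g (c i)) ^ 2
      = ∑ c : ι → α, ∑ i ∈ s, ∑ j ∈ s, (∏ k, w (c k)) * (g (c i) * g (c j)) := by
        simp_rw [sq (Finset.sum _ _), Finset.sum_mul_sum, Finset.mul_sum]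
    _ = s.card * ∑ a, w a * g a ^ 2 := by
        rw [Finset.sum_comm, Finset.sum_congr rfl hrow, Finset.sum_const, nsmul_eq_mul]

theorem mean_abs_sub_mean_le (hw : w ∈ stdSimplex ℝ α) (f : α → ℝ) {s : Finset ι}
    (hs : s.Nonempty) :
    ∑ c : ι → α, (∏ k, w (c k)) *
        |(1 / (s.card : ℝ)) * ∑ i ∈ s, f (c i) - ∑ a, w a * f a| ≤
      √((∑ a, w a * f a ^ 2) / s.card) := by
  have hcard : (0 : ℝ) < s.card := by exact_mod_cast hs.card_pos
  set μ := ∑ a, w a * f a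
  have hcentered : ∑ a, w a * (f a - μ) = 0 := by
    simp_rw [mul_sub]
    rw [Finset.sum_sub_distrib, ← Finset.sum_mul, hw.2, one_mul, sub_self]
  have hsq (c : ι → α) : (∏ k, w (c k)) * |(1 / (s.card : ℝ)) * ∑ i ∈ s, f (c i) - μ| ^ 2 =
      (1 / (s.card : ℝ)) ^ 2 * ((∏ k, w (c k)) * (∑ i ∈ s, (f (c i) - μ)) ^ 2) := by
    rw [sq_abs, Finset.sum_sub_distrib, Finset.sum_const, nsmul_eq_mul]
    field_simp
  refine (sum_mul_le_sqrt_sum_mul_sq (prod_apply_mem_stdSimplex hw) fun c => abs_nonneg _).trans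
    (Real.sqrt_le_sqrt ?_)
  calc ∑ c : ι → α, (∏ k, w (c k)) * |(1 / (s.card : ℝ)) * ∑ i ∈ s, f (c i) - μ| ^ 2
      = (∑ a, w a * (f a - μ) ^ 2) / s.card := by
        rw [Finset.sum_congr rfl fun c _ => hsq c, ← Finset.mul_sum,
          sum_prod_mul_sum_sq hw.2 hcentered]
        field_simp
    _ ≤ (∑ a, w a * f a ^ 2) / s.card :=
        div_le_div_of_nonneg_right (sum_mul_sub_mean_sq_le hw.2 f) hcard.le

theorem prob_le_abs_sub_mean_le (hw : w ∈ stdSimplex ℝ α) (f : α → ℝ) [Nonempty ι]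
    {γ : ℝ} (hγ : 0 < γ) (A : (ι → α) → Prop) [DecidablePred A]
    (hA : ∀ c, A c →
      γ ≤ |(1 / (Fintype.card ι : ℝ)) * ∑ i, f (c i) - ∑ a, w a * f a|) :
    ∑ c : ι → α, (∏ k, w (c k)) * (if A c then 1 else 0) ≤
      √((∑ a, w a * f a ^ 2) / Fintype.card ι) / γ := by
  rw [le_div_iff₀ hγ, Finset.sum_mul]
  refine le_trans (Finset.sum_le_sum fun c _ => ?_)
    (mean_abs_sub_mean_le hw f (s := (Finset.univ : Finset ι)) Finset.univ_nonempty)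
  rw [mul_assoc]
  refine mul_le_mul_of_nonneg_left ?_ (prod_apply_nonneg hw.1 c)
  split_ifs with h
  · simpa using hA c h
  · simp

end Product

theorem iid_mem_stdSimplex {α : Type*} [Fintype α] {p : α → ℝ} (hp : p ∈ stdSimplex ℝ α) (n : ℕ) :
    iid p n ∈ stdSimplex ℝ (Fin n → α) :=
  prod_apply_mem_stdSimplex hp

/-! ### Limits superior of sequences -/

theorem limsup_le_of_forall_pos {u : ℕ → ℝ} {a : ℝ} (h0 : ∀ n, 0 ≤ u n)
    (h : ∀ e, 0 < e → ∀ᶠ n in atTop, u n ≤ a + e) : limsup u atTop ≤ a :=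
  le_of_forall_pos_le_add fun e he =>
    limsup_le_of_le (isCoboundedUnder_le_of_le atTop h0) (h e he)

theorem eventually_le_of_limsup_le {u : ℕ → ℝ} {a D : ℝ} (hD : ∀ n, u n ≤ D)
    (h : limsup u atTop ≤ a) {e : ℝ} (he : 0 < e) : ∀ᶠ n in atTop, u n ≤ a + e :=
  (eventually_lt_of_limsup_lt (lt_of_le_of_lt h (by linarith))
    (isBoundedUnder_of ⟨D, hD⟩)).mono fun _ hn => hn.le

/-! ### Elementary properties of codes -/

theorem indexCard_pos (n : ℕ) {R : ℝ} (hR : 0 ≤ R) : 0 < indexCard n R :=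
  Nat.floor_pos.2 (Real.one_le_rpow one_le_two (by positivity))

section AvgDist

variable {α : Type*} {d : α → α → ℝ} {b : ℕ}

theorem avgDist_nonneg (hd : ∀ x y, 0 ≤ d x y) (x y : Fin b → α) : 0 ≤ avgDist d x y :=
  mul_nonneg (by positivity) (Finset.sum_nonneg fun _ _ => hd _ _)

theorem avgDist_le {D : ℝ} (hD : 0 ≤ D) (hd : ∀ x y, d x y ≤ D) (x y : Fin b → α) :
    avgDist d x y ≤ D := by
  rw [avgDist]
  rcases Nat.eq_zero_or_pos b with rfl | hb
  · simpa using hD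
  · calc 1 / (b : ℝ) * ∑ k, d (x k) (y k) ≤ 1 / (b : ℝ) * ∑ _k : Fin b, D := by
          gcongr with k
          exact hd _ _
      _ = D := by
          rw [Finset.sum_const, Finset.card_univ, Fintype.card_fin, nsmul_eq_mul]
          field_simp

theorem exists_distortion_bound [Finite α] (d : α → α → ℝ) :
    ∃ D : ℝ, 0 ≤ D ∧ ∀ x y, d x y ≤ D := by
  obtain ⟨D, hD⟩ := (Set.finite_range fun z : α × α => d z.1 z.2).bddAbove
  exact ⟨max D 0, le_max_right _ _, fun x y => le_max_of_le_left (hD ⟨(x, y), rfl⟩)⟩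

end AvgDist

section Codes

variable {X : Type*} [Fintype X] {n : ℕ} {R Rc : ℝ} {p : X → ℝ}

namespace Code

theorem induced_nonneg (c : Code X n R Rc) (hp : p ∈ stdSimplex ℝ X) (w) :
    0 ≤ c.induced p w := by
  have h_source := (iid_mem_stdSimplex hp n).1 w.1
  have h_enc := (c.enc_mem w.1 w.2.1).1 w.2.2.1
  have h_dec := (c.dec_mem w.2.2.1 w.2.1).1 w.2.2.2
  unfold induced
  positivity

theorem sum_inducedXY_fst (c : Code X n R Rc) (hRc : 0 ≤ Rc) (p : X → ℝ) (x : Fin n → X) :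
    ∑ y, c.inducedXY p (x, y) = iid p n x := by
  have hJ : (indexCard n Rc : ℝ) ≠ 0 := by exact_mod_cast (indexCard_pos n hRc).ne'
  calc ∑ y, c.inducedXY p (x, y)
      = ∑ j, ∑ m, ∑ y,
          iid p n x * (1 / (indexCard n Rc : ℝ)) * c.enc x j m * c.dec m j y := by
        simp only [inducedXY, induced]
        rw [Finset.sum_comm]
        exact Finset.sum_congr rfl fun j _ => Finset.sum_comm
    _ = ∑ _j : Fin (indexCard n Rc), iid p n x * (1 / (indexCard n Rc : ℝ)) := by
        simp only [← Finset.mul_sum, (c.dec_mem _ _).2, (c.enc_mem _ _).2, mul_one]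
    _ = iid p n x := by
        rw [Finset.sum_const, Finset.card_univ, Fintype.card_fin, nsmul_eq_mul]
        field_simp

theorem inducedXY_mem_stdSimplex (c : Code X n R Rc) (hp : p ∈ stdSimplex ℝ X) (hRc : 0 ≤ Rc) :
    c.inducedXY p ∈ stdSimplex ℝ ((Fin n → X) × (Fin n → X)) := by
  refine ⟨fun z => Finset.sum_nonneg fun j _ => Finset.sum_nonneg fun m _ =>
    c.induced_nonneg hp _, ?_⟩
  rw [Fintype.sum_prod_type, Finset.sum_congr rfl fun x _ => c.sum_inducedXY_fst hRc p x,
    (iid_mem_stdSimplex hp n).2]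

theorem inducedY_mem_stdSimplex (c : Code X n R Rc) (hp : p ∈ stdSimplex ℝ X) (hRc : 0 ≤ Rc) :
    c.inducedY p ∈ stdSimplex ℝ (Fin n → X) := by
  have h := c.inducedXY_mem_stdSimplex hp hRc
  refine ⟨fun y => Finset.sum_nonneg fun x _ => h.1 _, ?_⟩
  rw [← h.2, Fintype.sum_prod_type_right]
  rfl

end Code

theorem distortion_nonneg (c : Code X n R Rc) (hp : p ∈ stdSimplex ℝ X)
    (hRc : 0 ≤ Rc) {d : X → X → ℝ} (hd : ∀ x y, 0 ≤ d x y) : 0 ≤ distortion p d c :=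
  Finset.sum_nonneg fun z _ =>
    mul_nonneg ((c.inducedXY_mem_stdSimplex hp hRc).1 z) (avgDist_nonneg hd _ _)

theorem distortion_le (c : Code X n R Rc) (hp : p ∈ stdSimplex ℝ X)
    (hRc : 0 ≤ Rc) {d : X → X → ℝ} {D : ℝ} (hD : 0 ≤ D) (hd : ∀ x y, d x y ≤ D) :
    distortion p d c ≤ D := by
  have h := c.inducedXY_mem_stdSimplex hp hRc
  calc distortion p d c ≤ ∑ z, c.inducedXY p z * D :=
        Finset.sum_le_sum fun z _ => mul_le_mul_of_nonneg_left (avgDist_le hD hd _ _) (h.1 z)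
    _ = D := by rw [← Finset.sum_mul, h.2, one_mul]

theorem batchDistortion_eq_distortion (c : Code X n R Rc) (hp : p ∈ stdSimplex ℝ X)
    (hRc : 0 ≤ Rc) (d : X → X → ℝ) {b : ℕ} (hb : 0 < b) :
    batchDistortion p d c b = distortion p d c := by
  have hb' : (b : ℝ) ≠ 0 := by exact_mod_cast hb.ne'
  calc batchDistortion p d c b
      = (1 / (b : ℝ)) * ∑ z : Fin b → (Fin n → X) × (Fin n → X),
          (∏ k, c.inducedXY p (z k)) * ∑ i, avgDist d (z i).1 (z i).2 := by
        rw [Finset.mul_sum]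
        exact Finset.sum_congr rfl fun z _ => mul_left_comm _ _ _
    _ = (1 / (b : ℝ)) * (b * distortion p d c) := by
        rw [sum_prod_mul_sum (c.inducedXY_mem_stdSimplex hp hRc).2 fun z => avgDist d z.1 z.2,
          Finset.card_univ, Fintype.card_fin, distortion, expect]
    _ = distortion p d c := by field_simp

theorem batchScore_eq_expect (c : Code X n R Rc) (p : X → ℝ) (δ : List X → ℝ) (b : ℕ) :
    batchScore p δ c b = expect (iid (c.inducedY p) b) fun y => δ (batchWord y) := by
  have hmarginal (y : Fin b → Fin n → X) :
      iid (c.inducedY p) b y = ∑ x : Fin b → Fin n → X, ∏ k, c.inducedXY p (x k, y k) := by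
    rw [← Fintype.prod_sum fun k x => c.inducedXY p (x, y k)]
    rfl
  unfold batchScore expect
  rw [← (Equiv.arrowProdEquivProdArrow (Fin b) (fun _ => Fin n → X)
    (fun _ => Fin n → X)).symm.sum_comp, Fintype.sum_prod_type_right]
  refine Finset.sum_congr rfl fun y _ => ?_
  rw [hmarginal, Finset.sum_mul]
  rfl

/-! ### Near-perfect realism implies perfect realism -/

namespace Code

/-- The code whose reconstruction is that of `c` passed through the channel `T`. -/
def postprocess (c : Code X n R Rc) (T : (Fin n → X) → (Fin n → X) → ℝ)
    (hT : ∀ y, T y ∈ stdSimplex ℝ (Fin n → X)) : Code X n R Rc where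
  enc := c.enc
  dec := fun m j y' => ∑ y, c.dec m j y * T y y'
  enc_mem := c.enc_mem
  dec_mem := fun m j => by
    refine ⟨fun y' => Finset.sum_nonneg fun y _ =>
      mul_nonneg ((c.dec_mem m j).1 y) ((hT y).1 y'), ?_⟩
    rw [Finset.sum_comm]
    simp_rw [← Finset.mul_sum, (hT _).2, mul_one]
    exact (c.dec_mem m j).2

variable {T : (Fin n → X) → (Fin n → X) → ℝ}

theorem inducedXY_postprocess (c : Code X n R Rc) (hT : ∀ y, T y ∈ stdSimplex ℝ (Fin n → X))
    (p : X → ℝ) (x y' : Fin n → X) :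
    (c.postprocess T hT).inducedXY p (x, y') = ∑ y, c.inducedXY p (x, y) * T y y' := by
  simp only [inducedXY, induced, postprocess, Finset.sum_mul, Finset.mul_sum]
  conv_rhs => rw [Finset.sum_comm]
  refine Finset.sum_congr rfl fun j _ => ?_
  conv_rhs => rw [Finset.sum_comm]
  simp only [mul_assoc]

theorem inducedY_postprocess (c : Code X n R Rc) (hT : ∀ y, T y ∈ stdSimplex ℝ (Fin n → X))
    (p : X → ℝ) (y' : Fin n → X) :
    (c.postprocess T hT).inducedY p y' = ∑ y, c.inducedY p y * T y y' := by
  simp only [inducedY, inducedXY_postprocess, Finset.sum_mul]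
  rw [Finset.sum_comm]

end Code

theorem distortion_postprocess (c : Code X n R Rc) {T : (Fin n → X) → (Fin n → X) → ℝ}
    (hT : ∀ y, T y ∈ stdSimplex ℝ (Fin n → X)) (p : X → ℝ) (d : X → X → ℝ) :
    distortion p d (c.postprocess T hT) =
      ∑ z, c.inducedXY p z * ∑ y', T z.2 y' * avgDist d z.1 y' := by
  rw [distortion, expect, Fintype.sum_prod_type, Fintype.sum_prod_type]
  refine Finset.sum_congr rfl fun x _ => ?_
  simp only [Code.inducedXY_postprocess, Finset.sum_mul, Finset.mul_sum]
  rw [Finset.sum_comm]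
  simp only [mul_assoc]

theorem distortion_postprocess_le (c : Code X n R Rc) (hp : p ∈ stdSimplex ℝ X)
    (hRc : 0 ≤ Rc) {T : (Fin n → X) → (Fin n → X) → ℝ}
    (hT : ∀ y, T y ∈ stdSimplex ℝ (Fin n → X)) {d : X → X → ℝ} (hd : ∀ x y, 0 ≤ d x y)
    {D : ℝ} (hD : 0 ≤ D) (hdD : ∀ x y, d x y ≤ D) :
    distortion p d (c.postprocess T hT) ≤
      distortion p d c + D * ∑ y, c.inducedY p y * (1 - T y y) := by
  calc distortion p d (c.postprocess T hT)
      ≤ ∑ z, c.inducedXY p z * (avgDist d z.1 z.2 + D * (1 - T z.2 z.2)) := by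
        rw [distortion_postprocess]
        refine Finset.sum_le_sum fun z _ => mul_le_mul_of_nonneg_left ?_
          ((c.inducedXY_mem_stdSimplex hp hRc).1 z)
        exact sum_mul_le_add_mul_one_sub (hT z.2) (avgDist_le hD hdD z.1)
          (avgDist_nonneg hd z.1 z.2)
    _ = distortion p d c + D * ∑ z, c.inducedXY p z * (1 - T z.2 z.2) := by
        simp only [mul_add, Finset.sum_add_distrib, distortion, expect, Finset.mul_sum,
          mul_left_comm D]
    _ = distortion p d c + D * ∑ y, c.inducedY p y * (1 - T y y) := by
        simp only [Fintype.sum_prod_type_right, Code.inducedY, Finset.sum_mul]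

end Codes

section Coupling

variable {α : Type*} [Fintype α] {P Q : α → ℝ}

theorem tvDist_comm (P Q : α → ℝ) : tvDist P Q = tvDist Q P := by
  simp only [tvDist, abs_sub_comm]

theorem tvDist_eq_sum_sub_min (hP : P ∈ stdSimplex ℝ α) (hQ : Q ∈ stdSimplex ℝ α) :
    tvDist P Q = ∑ a, (P a - min (P a) (Q a)) := by
  have h (a) : P a - min (P a) (Q a) = 1 / 2 * |P a - Q a| + 1 / 2 * (P a - Q a) := by
    rcases le_total (P a) (Q a) with h | h
    · rw [min_eq_left h, abs_of_nonpos (by linarith)]; ring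
    · rw [min_eq_right h, abs_of_nonneg (by linarith)]; ring
  rw [Finset.sum_congr rfl fun a _ => h a, Finset.sum_add_distrib, ← Finset.mul_sum,
    ← Finset.mul_sum, Finset.sum_sub_distrib, hP.2, hQ.2, tvDist]
  ring

theorem exists_coupling_kernel (hP : P ∈ stdSimplex ℝ α) (hQ : Q ∈ stdSimplex ℝ α) :
    ∃ T : α → α → ℝ, (∀ a, T a ∈ stdSimplex ℝ α) ∧ (∀ b, ∑ a, P a * T a b = Q b) ∧
      ∑ a, P a * (1 - T a a) ≤ tvDist P Q := by
  classical
  have := nonempty_of_mem_stdSimplex hP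
  set m : α → ℝ := fun a => min (P a) (Q a)
  have hm (a) : 0 ≤ m a := le_min (hP.1 a) (hQ.1 a)
  have hPm : ∑ a, (P a - m a) = tvDist P Q := (tvDist_eq_sum_sub_min hP hQ).symm
  have hQm : ∑ a, (Q a - m a) = tvDist P Q := by
    simp only [m, tvDist_comm P Q, tvDist_eq_sum_sub_min hQ hP, min_comm]
  -- From `a`, stay with probability `m a / P a`, and otherwise move according to `S`,
  -- the normalization of `Q - m`.
  obtain ⟨S, hS, hSQ⟩ := exists_mem_stdSimplex_sum_mul_eq
    (f := fun a => Q a - m a) fun a => sub_nonneg.2 (min_le_right _ _)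
  have hdiv (a) : P a * (m a / P a) = m a :=
    mul_div_cancel_of_imp' fun h => le_antisymm ((min_le_left _ _).trans_eq h) (hm a)
  have hstay_nonneg (a) : 0 ≤ m a / P a := div_nonneg (hm a) (hP.1 a)
  have hstay_le (a) : m a / P a ≤ 1 := div_le_one_of_le₀ (min_le_left _ _) (hP.1 a)
  have hmove_nonneg (a b) : 0 ≤ (1 - m a / P a) * S b :=
    mul_nonneg (sub_nonneg.2 (hstay_le a)) (hS.1 b)
  refine ⟨fun a b => (if a = b then m a / P a else 0) + (1 - m a / P a) * S b,
    fun a => ⟨fun b => add_nonneg ?_ (hmove_nonneg a b), ?_⟩, fun b => ?_, ?_⟩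
  · split_ifs
    exacts [hstay_nonneg a, le_rfl]
  · rw [Finset.sum_add_distrib, ← Finset.mul_sum, hS.2]
    simp
  · have hterm (a) : P a * ((if a = b then m a / P a else 0) + (1 - m a / P a) * S b) =
        (if a = b then m a else 0) + (P a - m a) * S b := by
      rw [mul_add, mul_ite, hdiv, mul_zero, ← mul_assoc, mul_sub, hdiv, mul_one]
    rw [Finset.sum_congr rfl fun a _ => hterm a, Finset.sum_add_distrib, ← Finset.sum_mul, hPm,
      ← hQm, hSQ]
    simp
  · refine (Finset.sum_le_sum fun a _ => ?_).trans_eq hPm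
    simp only [if_true]
    rw [← sub_sub, mul_sub, mul_sub, hdiv, mul_one]
    exact sub_le_self _ (mul_nonneg (hP.1 a) (hmove_nonneg a a))

end Coupling

theorem ofFn_eq_batchWord {X : Type*} {n b : ℕ} (x : Fin (b * n) → X) :
    List.ofFn x = batchWord fun i j => x (finProdFinEquiv (i, j)) := by
  rw [List.ofFn_mul, batchWord]
  congr! 5
  simp [finProdFinEquiv, mul_comm, add_comm]

section Realism

variable {X : Type*} [Fintype X] {p : X → ℝ} {d : X → X → ℝ} {R Rc Δ : ℝ}

theorem AchievableNearPerfect.perfect (hp : p ∈ stdSimplex ℝ X) (hd : ∀ x y, 0 ≤ d x y)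
    (hRc : 0 ≤ Rc) (h : AchievableNearPerfect p d R Rc Δ) : AchievablePerfect p d R Rc Δ := by
  intro ε hε
  obtain ⟨c, hc, htv⟩ := h ε hε
  obtain ⟨D, hD, hdD⟩ := exists_distortion_bound d
  choose T hT hTQ hTle using fun n =>
    exists_coupling_kernel ((c n).inducedY_mem_stdSimplex hp hRc) (iid_mem_stdSimplex hp n)
  refine ⟨fun n => (c n).postprocess (T n) (hT n), ?_, 0, fun n _ => ?_⟩
  · refine limsup_le_of_forall_pos (fun n => distortion_nonneg _ hp hRc hd) fun e he => ?_
    have h_dist := eventually_le_of_limsup_le (fun n => distortion_le (c n) hp hRc hD hdD) hc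
      (half_pos he)
    have h_tv : ∀ᶠ n in atTop, D * tvDist ((c n).inducedY p) (iid p n) < e / 2 :=
      (htv.const_mul D).eventually_lt_const (by simpa using half_pos he)
    filter_upwards [h_dist, h_tv] with n h_dist h_tv
    have := distortion_postprocess_le (c n) hp hRc (hT n) hd hD hdD
    have := mul_le_mul_of_nonneg_left (hTle n) hD
    linarith
  · funext y
    rw [Code.inducedY_postprocess, hTQ]

theorem AchievablePerfect.nearPerfect (h : AchievablePerfect p d R Rc Δ) :
    AchievableNearPerfect p d R Rc Δ := by
  intro ε hε
  obtain ⟨c, hc, N, hN⟩ := h ε hε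
  refine ⟨c, hc, tendsto_const_nhds.congr' ?_⟩
  filter_upwards [eventually_ge_atTop N] with n hn
  simp [hN n hn, tvDist]

/-! ### Perfect realism fools every critic -/

theorem expect_iid_mul (p : X → ℝ) (n b : ℕ) (F : List X → ℝ) :
    expect (iid p (b * n)) (fun x => F (List.ofFn x)) =
      expect (iid (iid p n) b) fun y => F (batchWord y) := by
  let e : (Fin (b * n) → X) ≃ (Fin b → Fin n → X) :=
    (Equiv.arrowCongr finProdFinEquiv.symm (Equiv.refl X)).trans (Equiv.curry _ _ _)
  have hiid (x) : iid p (b * n) x = iid (iid p n) b (e x) := by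
    unfold iid
    rw [← finProdFinEquiv.prod_comp, Fintype.prod_prod_type]
    rfl
  refine Fintype.sum_equiv e _ _ fun x => ?_
  dsimp only
  rw [hiid, ofFn_eq_batchWord]
  rfl

theorem IsCritic.expect_batchWord_nonpos (hp : p ∈ stdSimplex ℝ X) {δ : List X → ℝ}
    (hδ : IsCritic p δ) {n b : ℕ} (hn : 1 ≤ n) (hb : 0 < b) :
    expect (iid (iid p n) b) (fun y => δ (batchWord y)) ≤ 0 := by
  rw [← expect_iid_mul, expect]
  have h := sum_mul_logb_le (iid_mem_stdSimplex hp (b * n))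
    (fun x _ => Real.rpow_pos_of_pos two_pos (δ (List.ofFn x))) (hδ (b * n) (Nat.mul_pos hb hn))
  simpa [Real.logb_rpow] using h

theorem AchievablePerfect.algorithmic [Primcodable X] (hp : p ∈ stdSimplex ℝ X)
    (hRc : 0 ≤ Rc) {B : ℕ → ℕ} (hB : ∀ n, 1 ≤ n → 0 < B n)
    (h : AchievablePerfect p d R Rc Δ) : AchievableAlgorithmic p d R Rc B Δ := by
  intro ε hε
  obtain ⟨c, hc, N, hN⟩ := h ε hε
  refine ⟨c, ?_, fun δ _ hδ => ?_⟩
  · rwa [limsup_congr (v := fun n => distortion p d (c n))]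
    filter_upwards [eventually_ge_atTop 1] with n hn
    exact batchDistortion_eq_distortion (c n) hp hRc d (hB n hn)
  · have hbdd : BddAbove (Set.range fun n : Fin N => batchScore p δ (c n) (B n)) :=
      (Set.finite_range _).bddAbove
    obtain ⟨C, hC⟩ := hbdd
    refine ⟨max C 0, fun n hn => ?_⟩
    rcases lt_or_ge n N with hlt | hge
    · exact le_max_of_le_left (hC ⟨⟨n, hlt⟩, rfl⟩)
    · rw [batchScore_eq_expect, hN n hge]
      exact le_max_of_le_right (hδ.expect_batchWord_nonpos hp hn (hB n hn))

end Realism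

/-! ### Lower semicomputable functions from witness searches -/

theorem lowerSemicomputable_natCast_sub_one {α : Type*} [Primcodable α] {g : α → ℕ → ℕ}
    (hg : Computable₂ g) (hmono : ∀ a, Monotone (g a)) {f : α → ℕ}
    (hf : ∀ a, ∀ᶠ K in atTop, g a K = f a) :
    LowerSemicomputable fun a => (f a : ℝ) - 1 := by
  have hpred : Primrec fun n : ℕ => (Nat.casesOn n (false, 1, 1) fun m => (true, m, 1) :
      Bool × ℕ × ℕ) :=
    Primrec.nat_casesOn Primrec.id (Primrec.const _)
      (Primrec.pair (Primrec.const _) (Primrec.pair Primrec.snd (Primrec.const _)))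
  refine ⟨fun x => (g x.1 x.2 : ℚ) - 1, ⟨_, hpred.to_comp.comp hg, fun x => ?_⟩, fun a k => ?_,
    fun a => ?_⟩
  · dsimp only
    rcases g x.1 x.2 with _ | m <;> simp
  · simpa using hmono a (Nat.le_succ k)
  · refine tendsto_const_nhds.congr' ?_
    filter_upwards [hf a] with K hK
    simp [hK]

section Search

variable {α ω : Type*} [Primcodable ω]

/-- The largest value of `val` among those of the first `K` elements of `ω` that pass the test
for `a`. -/
def searchMax (test : α → ω → Bool) (val : ω → ℕ) (a : α) (K : ℕ) : ℕ :=
  Nat.rec 0 (fun i r => Option.casesOn (Encodable.decode (α := ω) i) r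
    fun w => bif test a w then max r (val w) else r) K

variable {test : α → ω → Bool} {val : ω → ℕ} {a : α}

theorem searchMax_succ (test : α → ω → Bool) (val : ω → ℕ) (a : α) (K : ℕ) :
    searchMax test val a (K + 1) = Option.casesOn (Encodable.decode (α := ω) K)
      (searchMax test val a K) fun w =>
        bif test a w then max (searchMax test val a K) (val w) else searchMax test val a K := rfl

theorem monotone_searchMax (test : α → ω → Bool) (val : ω → ℕ) (a : α) :
    Monotone (searchMax test val a) := by
  refine monotone_nat_of_le_succ fun K => ?_
  rw [searchMax_succ]
  rcases Encodable.decode (α := ω) K with _ | w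
  · exact le_rfl
  · cases h : test a w <;> simp [h]

theorem le_searchMax {w : ω} (h : test a w = true) {K : ℕ} (hK : Encodable.encode w < K) :
    val w ≤ searchMax test val a K := by
  refine le_trans ?_ (monotone_searchMax test val a hK)
  rw [Nat.succ_eq_add_one, searchMax_succ, Encodable.encodek]
  simp [h]

theorem searchMax_le {M : ℕ} (hM : ∀ w, test a w = true → val w ≤ M) (K : ℕ) :
    searchMax test val a K ≤ M := by
  induction K with
  | zero => exact Nat.zero_le M
  | succ K ih =>
    rw [searchMax_succ]
    rcases Encodable.decode (α := ω) K with _ | w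
    · exact ih
    · cases h : test a w
      · simpa [h] using ih
      · simpa [h] using ⟨ih, hM w h⟩

theorem eventually_searchMax_eq_sSup (h : BddAbove (val '' {w | test a w = true})) :
    ∀ᶠ K in atTop, searchMax test val a K = sSup (val '' {w | test a w = true}) := by
  have hle (K) : searchMax test val a K ≤ sSup (val '' {w | test a w = true}) :=
    searchMax_le (fun w hw => le_csSup h ⟨w, hw, rfl⟩) K
  rcases (val '' {w | test a w = true}).eq_empty_or_nonempty with hempty | hne
  · refine Eventually.of_forall fun K => Nat.le_antisymm (hle K) ?_
    simp [hempty]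
  · obtain ⟨w, hw, hval⟩ := Nat.sSup_mem hne h
    filter_upwards [eventually_gt_atTop (Encodable.encode w)] with K hK
    exact Nat.le_antisymm (hle K) (hval ▸ le_searchMax hw hK)

variable [Primcodable α]

theorem computable_searchMax (htest : Computable₂ test) (hval : Computable val) :
    Computable₂ (searchMax test val) := by
  unfold searchMax
  refine Computable.nat_rec (σ := ℕ) (f := fun x : α × ℕ => x.2) (g := fun _ => 0)
    (h := fun x ir => Option.casesOn (Encodable.decode (α := ω) ir.1) ir.2
      fun w => bif test x.1 w then max ir.2 (val w) else ir.2)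
    Computable.snd (Computable.const 0) ?_
  refine Computable.option_casesOn (Computable.decode.comp (Computable.fst.comp Computable.snd))
    (Computable.snd.comp Computable.snd) ?_
  refine Computable.cond (htest.comp (Computable.fst.comp (Computable.fst.comp Computable.fst))
    Computable.snd) ?_ (Computable.snd.comp (Computable.snd.comp Computable.fst))
  exact Primrec.nat_max.to_comp.comp (Computable.snd.comp (Computable.snd.comp Computable.fst))
    (hval.comp Computable.snd)

theorem lowerSemicomputable_sSup_sub_one {P : α → ω → Prop}
    (hP : ComputablePred fun x : α × ω => P x.1 x.2) (hval : Computable val)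
    (hbdd : ∀ a, BddAbove (val '' {w | P a w})) :
    LowerSemicomputable fun a => ((sSup (val '' {w | P a w}) : ℕ) : ℝ) - 1 := by
  obtain ⟨t, ht, htP⟩ := ComputablePred.computable_iff.1 hP
  have hPt (a w) : P a w ↔ t (a, w) = true := iff_of_eq (congrFun htP (a, w))
  simp only [hPt] at hbdd ⊢
  exact lowerSemicomputable_natCast_sub_one
    (computable_searchMax (test := fun a w => t (a, w)) ht hval)
    (fun a => monotone_searchMax _ _ a) fun a => eventually_searchMax_eq_sSup (hbdd a)

end Search

/-! ### Computable predicates -/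

section Computability

variable {α β γ X : Type*} [Primcodable α] [Primcodable β] [Primcodable γ]

theorem computablePred_and {P Q : α → Prop} (hP : ComputablePred P) (hQ : ComputablePred Q) :
    ComputablePred fun a => P a ∧ Q a := by
  obtain ⟨_, hP⟩ := hP
  obtain ⟨_, hQ⟩ := hQ
  exact ⟨inferInstance, (Primrec.and.to_comp.comp hP hQ).of_eq fun a => by simp⟩

theorem computablePred_forall_of_finite [Finite X] {P : X → α → Prop}
    (hP : ∀ x, ComputablePred (P x)) : ComputablePred fun a => ∀ x, P x a := by
  classical
  cases nonempty_fintype X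
  have h (s : Finset X) : ComputablePred fun a => ∀ x ∈ s, P x a := by
    induction s using Finset.induction_on with
    | empty =>
      exact ComputablePred.computable_iff.2 ⟨fun _ => true, Computable.const _, by funext a; simp⟩
    | insert x s _ ih =>
      exact (computablePred_and (hP x) ih).of_eq fun a => by simp
  exact (h Finset.univ).of_eq fun a => by simp

theorem computablePred_rel_comp {r : β → γ → Prop} (hr : PrimrecRel r) {f : α → β} {g : α → γ}
    (hf : Computable f) (hg : Computable g) : ComputablePred fun a => r (f a) (g a) := by
  obtain ⟨_, hr⟩ := hr
  exact ⟨fun a => inferInstanceAs (Decidable ((fun x : β × γ => r x.1 x.2) (f a, g a))),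
    hr.to_comp.comp (hf.pair hg)⟩

theorem primrecRel_mem : PrimrecRel fun (a : α) (l : List α) => a ∈ l :=
  (PrimrecRel.exists_mem_list (R := fun a b : α => a = b) Primrec.eq).swap.of_eq
    fun a l => by simp

theorem primrec_list_sum : Primrec (List.sum : List ℕ → ℕ) :=
  Primrec.list_foldr (h := fun (_ : List ℕ) (x : ℕ × ℕ) => x.1 + x.2) Primrec.id (Primrec.const 0)
    (Primrec.nat_add.comp (Primrec.fst.comp Primrec.snd) (Primrec.snd.comp Primrec.snd))

theorem primrec_list_prod : Primrec (List.prod : List ℕ → ℕ) :=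
  Primrec.list_foldr (h := fun (_ : List ℕ) (x : ℕ × ℕ) => x.1 * x.2) Primrec.id (Primrec.const 1)
    (Primrec.nat_mul.comp (Primrec.fst.comp Primrec.snd) (Primrec.snd.comp Primrec.snd))

theorem primrec_pow : Primrec₂ ((· ^ ·) : ℕ → ℕ → ℕ) := Primrec₂.unpaired'.1 Nat.Primrec.pow

end Computability

/-! ### The empirical test -/

section Test

variable {X : Type*} [Primcodable X]

/-- The product over the letters of the word `s` of their entries in the table `T`, which is
indexed by the codes of letters. -/
def tableProd (T : List ℕ) (s : List X) : ℕ :=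
  (s.map fun x => T.getD (Encodable.encode x) 0).prod

/-- The sum of `tableProd T s` over the words `s` in the list `S`. -/
def tableSum (T : List ℕ) (S : List (List X)) : ℕ :=
  (S.map (tableProd T)).sum

open Classical in
/-- The number of words in the list `L` that belong to `S`. -/
def hits (L S : List (List X)) : ℕ :=
  (L.map fun l => if l ∈ S then 1 else 0).sum

theorem primrec_tableProd : Primrec₂ (tableProd (X := X)) :=
  primrec_list_prod.comp <| Primrec.list_map Primrec.snd <|
    (Primrec.list_getD 0).comp (Primrec.fst.comp Primrec.fst) (Primrec.encode.comp Primrec.snd)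

theorem primrec_tableSum : Primrec₂ (tableSum (X := X)) :=
  primrec_list_sum.comp <| Primrec.list_map Primrec.snd <|
    primrec_tableProd.comp (Primrec.fst.comp Primrec.fst) Primrec.snd

theorem primrec_hits : Primrec₂ (hits (X := X)) := by
  classical
  exact primrec_list_sum.comp <| Primrec.list_map Primrec.fst <|
    Primrec.ite (primrecRel_mem.comp Primrec.snd (Primrec.snd.comp Primrec.fst))
      (Primrec.const 1) (Primrec.const 0)

/-- The data certifying that a word is atypical: the `score` of the word, a decomposition into
`blocks` of length `blockLength`, an `event`, which is a list of such blocks, and fractions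
`table / denom` bounding the mass function from above, as the approximation of rank `precision`
shows. -/
structure Witness (X : Type*) where
  score : ℕ
  blockLength : ℕ
  blocks : List (List X)
  event : List (List X)
  table : List ℕ
  denom : ℕ
  precision : ℕ

namespace Witness

/-- Witnesses as tuples, which makes them `Primcodable`. -/
def equivProd (X : Type*) :
    Witness X ≃ ℕ × ℕ × List (List X) × List (List X) × List ℕ × ℕ × ℕ where
  toFun w := (w.score, w.blockLength, w.blocks, w.event, w.table, w.denom, w.precision)
  invFun t := ⟨t.1, t.2.1, t.2.2.1, t.2.2.2.1, t.2.2.2.2.1, t.2.2.2.2.2.1, t.2.2.2.2.2.2⟩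

instance : Primcodable (Witness X) := Primcodable.ofEquiv _ (equivProd X)

theorem primrec_equivProd : Primrec (equivProd X) := Primrec.of_equiv

theorem primrec_score : Primrec (score (X := X)) := Primrec.fst.comp primrec_equivProd

theorem primrec_blockLength : Primrec (blockLength (X := X)) :=
  Primrec.fst.comp <| Primrec.snd.comp primrec_equivProd

theorem primrec_blocks : Primrec (blocks (X := X)) :=
  Primrec.fst.comp <| Primrec.snd.comp <| Primrec.snd.comp primrec_equivProd

theorem primrec_event : Primrec (event (X := X)) :=
  Primrec.fst.comp <| Primrec.snd.comp <| Primrec.snd.comp <| Primrec.snd.comp primrec_equivProd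

theorem primrec_table : Primrec (table (X := X)) :=
  Primrec.fst.comp <| Primrec.snd.comp <| Primrec.snd.comp <| Primrec.snd.comp <|
    Primrec.snd.comp primrec_equivProd

theorem primrec_denom : Primrec (denom (X := X)) :=
  Primrec.fst.comp <| Primrec.snd.comp <| Primrec.snd.comp <| Primrec.snd.comp <|
    Primrec.snd.comp <| Primrec.snd.comp primrec_equivProd

theorem primrec_precision : Primrec (precision (X := X)) :=
  Primrec.snd.comp <| Primrec.snd.comp <| Primrec.snd.comp <| Primrec.snd.comp <|
    Primrec.snd.comp <| Primrec.snd.comp primrec_equivProd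

end Witness

/-- `w` certifies that `y` is a batch of `B n` blocks of some length `n` for which the empirical
mass of an event exceeds its probability by more than `1 / q`. The approximation of
rank `k` of the mass of `x` is `num (x, k) / den (x, k)`. Scores `ℓ` are limited by
`4 ^ ℓ * N ^ n * q ^ 2 ≤ B n`, where `N` stands for the size of the alphabet. -/
structure Passes (B : ℕ → ℕ) (num den : X × ℕ → ℕ) (N q : ℕ) (y : List X) (w : Witness X) :
    Prop where
  flatten_blocks : w.blocks.flatten = y
  length_of_mem_blocks : ∀ l ∈ w.blocks, l.length = w.blockLength
  length_blocks : w.blocks.length = B w.blockLength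
  blockLength_pos : 0 < w.blockLength
  score_le : 4 ^ w.score * N ^ w.blockLength * q ^ 2 ≤ B w.blockLength
  denom_pos : 0 < w.denom
  num_mul_le : ∀ x, num (x, w.precision) * w.denom ≤
    w.table.getD (Encodable.encode x) 0 * den (x, w.precision)
  mass_lt_hits : B w.blockLength * (tableSum w.table w.event * q + w.denom ^ w.blockLength) <
    hits w.blocks w.event * w.denom ^ w.blockLength * q

theorem computablePred_passes [Finite X] {B : ℕ → ℕ} (hB : Computable B) {num den : X × ℕ → ℕ}
    (hnum : Computable num) (hden : Computable den) (N q : ℕ) :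
    ComputablePred fun x : List X × Witness X => Passes B num den N q x.1 x.2 := by
  have hw : Primrec (Prod.snd : List X × Witness X → Witness X) := Primrec.snd
  have hscore := Witness.primrec_score.comp hw
  have hn := Witness.primrec_blockLength.comp hw
  have hL := Witness.primrec_blocks.comp hw
  have hS := Witness.primrec_event.comp hw
  have hT := Witness.primrec_table.comp hw
  have hD := Witness.primrec_denom.comp hw
  have hk := Witness.primrec_precision.comp hw
  have hBn := hB.comp hn.to_comp
  have hDn := primrec_pow.comp hD hn
  have hlength : PrimrecRel fun (l : List X) (n : ℕ) => l.length = n :=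
    Primrec.eq.comp (Primrec.list_length.comp Primrec.fst) Primrec.snd
  have hbound : Primrec fun x : List X × Witness X =>
      4 ^ x.2.score * N ^ x.2.blockLength * q ^ 2 :=
    Primrec.nat_mul.comp (Primrec.nat_mul.comp (primrec_pow.comp (Primrec.const 4) hscore)
      (primrec_pow.comp (Primrec.const N) hn)) (Primrec.const _)
  have hnumk (x) := hnum.comp ((Computable.const x).pair hk.to_comp)
  have hdenk (x) := hden.comp ((Computable.const x).pair hk.to_comp)
  have htable (x : X) := (Primrec.list_getD 0).comp hT (Primrec.const (Encodable.encode x))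
  have hmass := Primrec.nat_add.comp
    (Primrec.nat_mul.comp (primrec_tableSum.comp hT hS) (Primrec.const q)) hDn
  have hhits := Primrec.nat_mul.comp (Primrec.nat_mul.comp (primrec_hits.comp hL hS) hDn)
    (Primrec.const q)
  have hmul := Primrec.nat_mul.to_comp
  refine ComputablePred.of_eq (computablePred_and
    (computablePred_rel_comp Primrec.eq (Primrec.list_flatten.comp hL).to_comp Computable.fst) <|
    computablePred_and (hlength.forall_mem_list.comp hL hn).computablePred <| computablePred_and
    (computablePred_rel_comp Primrec.eq (Primrec.list_length.comp hL).to_comp hBn) <|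
    computablePred_and (Primrec.nat_lt.comp (Primrec.const 0) hn).computablePred <|
    computablePred_and
    (computablePred_rel_comp Primrec.nat_le hbound.to_comp hBn) <|
    computablePred_and (Primrec.nat_lt.comp (Primrec.const 0) hD).computablePred <|
    computablePred_and (computablePred_forall_of_finite fun x => computablePred_rel_comp
      Primrec.nat_le (hmul.comp (hnumk x) hD.to_comp) (hmul.comp (htable x).to_comp (hdenk x)))
    (computablePred_rel_comp Primrec.nat_lt (hmul.comp hBn hmass.to_comp) hhits.to_comp))
    fun x => ⟨fun ⟨h₁, h₂, h₃, h₄, h₅, h₆, h₇, h₈⟩ => ⟨h₁, h₂, h₃, h₄, h₅, h₆, h₇, h₈⟩,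
      fun ⟨h₁, h₂, h₃, h₄, h₅, h₆, h₇, h₈⟩ => ⟨h₁, h₂, h₃, h₄, h₅, h₆, h₇, h₈⟩⟩

end Test

/-! ### Empirical distributions -/

section Empirical

variable {α : Type*} {b : ℕ}

open Classical in
/-- The empirical distribution of a finite sample. -/
def empirical (z : Fin b → α) (a : α) : ℝ :=
  (1 / (b : ℝ)) * ∑ i, if z i = a then 1 else 0

open Classical in
theorem sum_empirical (z : Fin b → α) (A : Finset α) :
    ∑ a ∈ A, empirical z a = (1 / (b : ℝ)) * ∑ i, if z i ∈ A then 1 else 0 := by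
  unfold empirical
  rw [← Finset.mul_sum, Finset.sum_comm]
  simp

variable [Fintype α]

theorem mean_sum_abs_empirical_sub_le {w : α → ℝ} (hw : w ∈ stdSimplex ℝ α) (hb : 0 < b) :
    ∑ z : Fin b → α, iid w b z * ∑ a, |empirical z a - w a| ≤ √(Fintype.card α / b) := by
  classical
  have : Nonempty (Fin b) := ⟨⟨0, hb⟩⟩
  have hdev (a) : ∑ z : Fin b → α, iid w b z * |empirical z a - w a| ≤ √(w a * (b : ℝ)⁻¹) := by
    simpa [iid, empirical, div_eq_mul_inv] using mean_abs_sub_mean_le (ι := Fin b) hw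
      (fun x => if x = a then (1 : ℝ) else 0) (s := Finset.univ) Finset.univ_nonempty
  calc ∑ z : Fin b → α, iid w b z * ∑ a, |empirical z a - w a|
      = ∑ a, ∑ z : Fin b → α, iid w b z * |empirical z a - w a| := by
        simp_rw [Finset.mul_sum]
        exact Finset.sum_comm
    _ ≤ ∑ a, √(w a * (b : ℝ)⁻¹) := Finset.sum_le_sum fun a _ => hdev a
    _ ≤ √(Fintype.card α / b) := sum_sqrt_mul_le hw _

theorem sum_sub_le_sum_abs (f g : α → ℝ) (A : Finset α) :
    ∑ a ∈ A, f a - ∑ a ∈ A, g a ≤ ∑ a, |f a - g a| := by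
  rw [← Finset.sum_sub_distrib]
  exact (Finset.sum_le_sum fun a _ => le_abs_self _).trans
    (Finset.sum_le_univ_sum_of_nonneg fun a => abs_nonneg _)

theorem exists_sum_sub_eq_tvDist {P Q : α → ℝ} (hP : P ∈ stdSimplex ℝ α)
    (hQ : Q ∈ stdSimplex ℝ α) :
    ∃ A : Finset α, ∑ a ∈ A, P a - ∑ a ∈ A, Q a = tvDist P Q := by
  classical
  refine ⟨Finset.univ.filter fun a => Q a ≤ P a, ?_⟩
  rw [tvDist_eq_sum_sub_min hP hQ, ← Finset.sum_sub_distrib, Finset.sum_filter]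
  refine Finset.sum_congr rfl fun a _ => ?_
  split_ifs with h
  · rw [min_eq_right h]
  · rw [min_eq_left (not_le.1 h).le, sub_self]

end Empirical

/-! ### Semantics of the test -/

section Tables

variable {X : Type*}

theorem hits_ofFn {b n : ℕ} (z : Fin b → Fin n → X) {S : List (List X)} {A : Finset (Fin n → X)}
    (hA : ∀ a, a ∈ A ↔ List.ofFn a ∈ S) :
    (hits (List.ofFn fun i => List.ofFn (z i)) S : ℝ) = b * ∑ a ∈ A, empirical z a := by
  classical
  rcases Nat.eq_zero_or_pos b with rfl | hb
  · simp [hits]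
  · rw [sum_empirical, hits, List.map_ofFn, List.sum_ofFn]
    push_cast
    field_simp
    refine Finset.sum_congr rfl fun i _ => ?_
    simp only [Function.comp_apply, hA, Nat.cast_ite, Nat.cast_one, Nat.cast_zero]

theorem length_batchWord {n b : ℕ} (z : Fin b → Fin n → X) : (batchWord z).length = b * n := by
  simp [batchWord, List.length_flatten, List.map_ofFn, Function.comp_def]

variable [Primcodable X]

/-- The mass function with the fractions `T / D`. -/
def tableMass (T : List ℕ) (D : ℕ) (x : X) : ℝ :=
  (T.getD (Encodable.encode x) 0 : ℝ) / D

variable {T : List ℕ} {D : ℕ}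

theorem tableProd_ofFn (hD : D ≠ 0) {n : ℕ} (a : Fin n → X) :
    (tableProd T (List.ofFn a) : ℝ) = (D : ℝ) ^ n * iid (tableMass T D) n a := by
  have : (D : ℝ) ≠ 0 := by exact_mod_cast hD
  rw [tableProd, List.map_ofFn, List.prod_ofFn]
  simp only [iid, tableMass, Finset.prod_div_distrib, Finset.prod_const, Finset.card_univ,
    Fintype.card_fin, Function.comp_apply, Nat.cast_prod]
  field_simp

theorem tableSum_map_ofFn (hD : D ≠ 0) {n : ℕ} (A : Finset (Fin n → X)) :
    (tableSum T (A.toList.map List.ofFn) : ℝ) = (D : ℝ) ^ n * ∑ a ∈ A, iid (tableMass T D) n a := by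
  rw [tableSum, List.map_map, Finset.sum_map_toList, Finset.mul_sum]
  push_cast
  exact Finset.sum_congr rfl fun a _ => tableProd_ofFn hD a

theorem sum_iid_le_tableSum (hD : D ≠ 0) {n : ℕ} {S : List (List X)} {A : Finset (Fin n → X)}
    (hA : ∀ a ∈ A, List.ofFn a ∈ S) :
    (D : ℝ) ^ n * ∑ a ∈ A, iid (tableMass T D) n a ≤ tableSum T S := by
  classical
  have hsum : ∑ a ∈ A, tableProd T (List.ofFn a) ≤ tableSum T S := by
    calc ∑ a ∈ A, tableProd T (List.ofFn a) = ∑ s ∈ A.image List.ofFn, tableProd T s :=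
          (Finset.sum_image List.ofFn_injective.injOn).symm
      _ ≤ ∑ s ∈ S.dedup.toFinset, tableProd T s :=
          Finset.sum_le_sum_of_subset fun s hs => by
            obtain ⟨a, ha, rfl⟩ := Finset.mem_image.1 hs
            exact List.mem_toFinset.2 (List.mem_dedup.2 (hA a ha))
      _ = (S.dedup.map (tableProd T)).sum := List.sum_toFinset _ S.nodup_dedup
      _ ≤ tableSum T S := ((List.dedup_sublist S).map _).sum_le_sum fun _ _ => Nat.zero_le _
  calc (D : ℝ) ^ n * ∑ a ∈ A, iid (tableMass T D) n a
      = ((∑ a ∈ A, tableProd T (List.ofFn a) : ℕ) : ℝ) := by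
        push_cast
        rw [Finset.mul_sum]
        exact Finset.sum_congr rfl fun a _ => (tableProd_ofFn hD a).symm
    _ ≤ tableSum T S := by exact_mod_cast hsum

theorem exists_list_getD_encode_eq [Finite X] (t : X → ℕ) :
    ∃ T : List ℕ, ∀ x, T.getD (Encodable.encode x) 0 = t x := by
  obtain ⟨M, hM⟩ := (Set.finite_range (Encodable.encode (α := X))).bddAbove
  refine ⟨(List.range (M + 1)).map fun i => ((Encodable.decode (α := X) i).map t).getD 0,
    fun x => ?_⟩
  have : Encodable.encode x < M + 1 := Nat.lt_succ_of_le (hM ⟨x, rfl⟩)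
  simp [List.getD_eq_getElem?_getD, this]

theorem exists_tableMass_eq [Finite X] (num : X → ℕ) {den : X → ℕ} (hden : ∀ x, 0 < den x) :
    ∃ (T : List ℕ) (D : ℕ), 0 < D ∧
      (∀ x, T.getD (Encodable.encode x) 0 * den x = num x * D) ∧
      ∀ x, tableMass T D x = (num x : ℝ) / den x := by
  classical
  cases nonempty_fintype X
  obtain ⟨T, hT⟩ :=
    exists_list_getD_encode_eq fun x => num x * ∏ x' ∈ Finset.univ.erase x, den x'
  have hD : 0 < ∏ x, den x := Finset.prod_pos fun x _ => hden x
  have hTD (x) : T.getD (Encodable.encode x) 0 * den x = num x * ∏ x, den x := by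
    rw [hT, ← Finset.mul_prod_erase Finset.univ _ (Finset.mem_univ x)]
    ring
  refine ⟨T, ∏ x, den x, hD, hTD, fun x => ?_⟩
  rw [tableMass, div_eq_div_iff (by exact_mod_cast hD.ne') (by exact_mod_cast (hden x).ne')]
  exact_mod_cast hTD x

end Tables

theorem mul_add_lt_mul_iff_one_div_lt_sub {b u q m e : ℝ} (hb : 0 < b) (hu : 0 < u) (hq : 0 < q) :
    b * (u * m * q + u) < b * e * u * q ↔ 1 / q < e - m := by
  rw [div_lt_iff₀ hq]
  calc b * (u * m * q + u) < b * e * u * q ↔ b * u * (m * q + 1) < b * u * (e * q) := by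
        ring_nf
    _ ↔ m * q + 1 < e * q := mul_lt_mul_iff_right₀ (mul_pos hb hu)
    _ ↔ 1 < (e - m) * q := by rw [sub_mul, lt_sub_iff_add_lt, add_comm]

theorem injOn_mul_self {B : ℕ → ℕ} (hB_pos : ∀ n, 1 ≤ n → 0 < B n)
    (hB_mono : ∀ m n, 1 ≤ m → m ≤ n → B m ≤ B n) :
    Set.InjOn (fun n => B n * n) (Set.Ici 1) := by
  refine StrictMonoOn.injOn fun m hm n _ hmn => ?_
  calc B m * m < B m * n := Nat.mul_lt_mul_of_pos_left hmn (hB_pos m hm)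
    _ ≤ B n * n := Nat.mul_le_mul_right n (hB_mono m n hm hmn.le)

section Semantics

variable {X : Type*} [Primcodable X] {B : ℕ → ℕ} {num den : X × ℕ → ℕ} {N q n : ℕ}

namespace Passes

variable {y : List X} {w : Witness X}

theorem map_length_blocks (h : Passes B num den N q y w) :
    w.blocks.map List.length = List.replicate (B w.blockLength) w.blockLength := by
  rw [List.map_congr_left h.length_of_mem_blocks, List.map_const', h.length_blocks]

theorem length_eq (h : Passes B num den N q y w) :
    y.length = B w.blockLength * w.blockLength := by
  rw [← h.flatten_blocks, List.length_flatten, h.map_length_blocks, List.sum_replicate,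
    smul_eq_mul]

theorem score_le_length (h : Passes B num den N q y w) (hN : 0 < N) (hq : 0 < q) :
    w.score ≤ y.length := by
  calc w.score ≤ 4 ^ w.score := (Nat.lt_pow_self (by norm_num)).le
    _ ≤ 4 ^ w.score * (N ^ w.blockLength * q ^ 2) := Nat.le_mul_of_pos_right _ (by positivity)
    _ ≤ B w.blockLength := (mul_assoc _ _ _).symm.trans_le h.score_le
    _ ≤ B w.blockLength * w.blockLength := Nat.le_mul_of_pos_right _ h.blockLength_pos
    _ = y.length := h.length_eq.symm

theorem blockLength_eq (hB_pos : ∀ n, 1 ≤ n → 0 < B n)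
    (hB_mono : ∀ m n, 1 ≤ m → m ≤ n → B m ≤ B n) (hn : 1 ≤ n) {z : Fin (B n) → Fin n → X}
    (h : Passes B num den N q (batchWord z) w) : w.blockLength = n :=
  injOn_mul_self hB_pos hB_mono h.blockLength_pos hn (h.length_eq.symm.trans (length_batchWord z))

theorem blocks_eq {z : Fin (B n) → Fin n → X} (h : Passes B num den N q (batchWord z) w)
    (hn : w.blockLength = n) : w.blocks = List.ofFn fun i => List.ofFn (z i) := by
  refine List.eq_iff_flatten_eq.2 ⟨h.flatten_blocks, ?_⟩
  rw [h.map_length_blocks, hn, List.map_ofFn]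
  simp [Function.comp_def, List.ofFn_const]

theorem exists_event (hB_pos : ∀ n, 1 ≤ n → 0 < B n) {p : X → ℝ} [Finite X]
    (hp : ∀ x, 0 ≤ p x) (hden : ∀ x, 0 < den x)
    (hnum : ∀ x k, p x ≤ (num (x, k) : ℝ) / den (x, k)) (hq : 0 < q)
    {z : Fin (B n) → Fin n → X} (h : Passes B num den N q (batchWord z) w)
    (hn : w.blockLength = n) :
    ∃ A : Finset (Fin n → X), 1 / (q : ℝ) < ∑ a ∈ A, empirical z a - ∑ a ∈ A, iid p n a := by
  classical
  cases nonempty_fintype X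
  have hD : (0 : ℝ) < w.denom := by exact_mod_cast h.denom_pos
  have hB : (0 : ℝ) < B n := by exact_mod_cast hB_pos n (hn ▸ h.blockLength_pos)
  have hmass (x) : p x ≤ tableMass w.table w.denom x := by
    have hd : (0 : ℝ) < den (x, w.precision) := by exact_mod_cast hden _
    refine (hnum x w.precision).trans ?_
    rw [tableMass, div_le_div_iff₀ hd hD]
    exact_mod_cast h.num_mul_le x
  set A : Finset (Fin n → X) := Finset.univ.filter fun a => List.ofFn a ∈ w.event
  have hA (a) : a ∈ A ↔ List.ofFn a ∈ w.event := by simp [A]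
  have hlt : (B n : ℝ) * (tableSum w.table w.event * q + (w.denom : ℝ) ^ n) <
      B n * (∑ a ∈ A, empirical z a) * (w.denom : ℝ) ^ n * q := by
    rw [← hits_ofFn z hA, ← h.blocks_eq hn, ← hn]
    exact_mod_cast h.mass_lt_hits
  have htable : 1 / (q : ℝ) <
      ∑ a ∈ A, empirical z a - ∑ a ∈ A, iid (tableMass w.table w.denom) n a := by
    rw [← mul_add_lt_mul_iff_one_div_lt_sub hB (pow_pos hD n) (by exact_mod_cast hq)]
    refine lt_of_le_of_lt ?_ hlt
    gcongr
    exact sum_iid_le_tableSum h.denom_pos.ne' fun a ha => (hA a).1 ha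
  refine ⟨A, htable.trans_le (sub_le_sub_left (Finset.sum_le_sum fun a _ => ?_) _)⟩
  exact Finset.prod_le_prod (fun i _ => hp _) fun i _ => hmass _

end Passes

theorem exists_passes [Finite X] {p : X → ℝ} (hden : ∀ x, 0 < den x)
    (hlim : ∀ x, Tendsto (fun k => (num (x, k) : ℝ) / den (x, k)) atTop (𝓝 (p x)))
    (hq : 0 < q) (hn : 1 ≤ n) (hB : 0 < B n) {ℓ : ℕ}
    (hℓ : 4 ^ ℓ * N ^ n * q ^ 2 ≤ B n) {z : Fin (B n) → Fin n → X} {A : Finset (Fin n → X)}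
    (hA : 1 / (q : ℝ) < ∑ a ∈ A, empirical z a - ∑ a ∈ A, iid p n a) :
    ∃ w : Witness X, Passes B num den N q (batchWord z) w ∧ w.score = ℓ := by
  have hlim' : Tendsto (fun k => ∑ a ∈ A, empirical z a -
      ∑ a ∈ A, iid (fun x => (num (x, k) : ℝ) / den (x, k)) n a) atTop
      (𝓝 (∑ a ∈ A, empirical z a - ∑ a ∈ A, iid p n a)) :=
    tendsto_const_nhds.sub <|
      tendsto_finsetSum _ fun a _ => tendsto_finsetProd _ fun i _ => hlim (a i)
  obtain ⟨k, hk⟩ := (hlim'.eventually_const_lt hA).exists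
  obtain ⟨T, D, hD, hTD, hmass⟩ :=
    exists_tableMass_eq (fun x => num (x, k)) fun x => hden (x, k)
  have hA_mem (a) : a ∈ A ↔ List.ofFn a ∈ A.toList.map List.ofFn := by
    rw [List.mem_map_of_injective List.ofFn_injective, Finset.mem_toList]
  have hlt : (B n : ℝ) * (tableSum T (A.toList.map List.ofFn) * q + (D : ℝ) ^ n) <
      hits (List.ofFn fun i => List.ofFn (z i)) (A.toList.map List.ofFn) * (D : ℝ) ^ n * q := by
    rw [hits_ofFn z hA_mem, tableSum_map_ofFn hD.ne', mul_add_lt_mul_iff_one_div_lt_sub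
      (by exact_mod_cast hB) (by positivity) (by exact_mod_cast hq), funext hmass]
    exact hk
  refine ⟨⟨ℓ, n, List.ofFn fun i => List.ofFn (z i), A.toList.map List.ofFn, T, D, k⟩,
    ⟨rfl, fun l hl => ?_, by simp, hn, hℓ, hD, fun x => (hTD x).ge, by exact_mod_cast hlt⟩, rfl⟩
  obtain ⟨i, rfl⟩ := (List.mem_ofFn' _ _).1 hl
  simp

end Semantics

/-! ### The empirical critic -/

section Critic

variable {X : Type*} [Primcodable X]

theorem exists_computable_upper_approx {p : X → ℝ} (hp : ∀ x, 0 ≤ p x)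
    (hp_comp : LowerSemicomputable fun x => -p x) :
    ∃ num den : X × ℕ → ℕ, Computable num ∧ Computable den ∧ (∀ x, 0 < den x) ∧
      (∀ x k, p x ≤ (num (x, k) : ℝ) / den (x, k)) ∧
      ∀ x, Tendsto (fun k => (num (x, k) : ℝ) / den (x, k)) atTop (𝓝 (p x)) := by
  obtain ⟨φ, ⟨f, hf, hφ⟩, hmono, hlim⟩ := hp_comp
  have hle (x k) : (φ (x, k) : ℝ) ≤ -p x :=
    Monotone.ge_of_tendsto (f := fun k => (φ (x, k) : ℝ))
      (monotone_nat_of_le_succ fun k => by exact_mod_cast hmono x k) (hlim x) k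
  have hratio (x k) : ((f (x, k)).2.1 : ℝ) / (f (x, k)).2.2 = -(φ (x, k) : ℝ) := by
    have hφx : (φ (x, k) : ℝ) =
        (if (f (x, k)).1 then 1 else -1) * ((f (x, k)).2.1 : ℝ) / (f (x, k)).2.2 := by
      rw [(hφ (x, k)).2]
      split_ifs <;> push_cast <;> rfl
    have hnonneg : (0 : ℝ) ≤ ((f (x, k)).2.1 : ℝ) / (f (x, k)).2.2 := by positivity
    rw [mul_div_assoc] at hφx
    split_ifs at hφx
    · linarith [hle x k, hp x]
    · linarith
  refine ⟨fun x => (f x).2.1, fun x => (f x).2.2, Computable.fst.comp (Computable.snd.comp hf),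
    Computable.snd.comp (Computable.snd.comp hf), fun x => (hφ x).1, fun x k => ?_, fun x => ?_⟩
  · rw [hratio]
    exact le_neg_of_le_neg (hle x k)
  · simpa only [hratio, neg_neg] using (hlim x).neg

section MaxScore

variable {B : ℕ → ℕ} {num den : X × ℕ → ℕ} {N q n : ℕ} {y : List X}

variable (B num den N q y) in
/-- The highest score that a witness certifies for the word `y`, which is zero if there is no
witness. -/
def maxScore : ℕ := sSup (Witness.score '' {w | Passes B num den N q y w})

theorem bddAbove_score_passes (hN : 0 < N) (hq : 0 < q) (y : List X) :
    BddAbove (Witness.score '' {w | Passes B num den N q y w}) :=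
  ⟨y.length, Set.forall_mem_image.2 fun _ hw => hw.score_le_length hN hq⟩

theorem lowerSemicomputable_maxScore_sub_one [Finite X] (hB : Computable B)
    (hnum : Computable num) (hden : Computable den) (hN : 0 < N) (hq : 0 < q) :
    LowerSemicomputable fun y : List X => (maxScore B num den N q y : ℝ) - 1 :=
  lowerSemicomputable_sSup_sub_one (computablePred_passes hB hnum hden N q)
    Witness.primrec_score.to_comp (bddAbove_score_passes hN hq)

theorem exists_passes_of_maxScore_ne_zero (hN : 0 < N) (hq : 0 < q)
    (h : maxScore B num den N q y ≠ 0) :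
    ∃ w, Passes B num den N q y w ∧ w.score = maxScore B num den N q y := by
  refine Nat.sSup_mem (Set.nonempty_iff_ne_empty.2 fun hempty => h ?_)
    (bddAbove_score_passes hN hq y)
  rw [maxScore, hempty, csSup_empty, bot_eq_zero]

theorem maxScore_eq_zero (hN : 0 < N) (hq : 0 < q) (h : ∀ n, 1 ≤ n → y.length ≠ B n * n) :
    maxScore B num den N q y = 0 := by
  by_contra hne
  obtain ⟨w, hw, -⟩ := exists_passes_of_maxScore_ne_zero hN hq hne
  exact h _ hw.blockLength_pos hw.length_eq

theorem two_pow_le_sqrt_div_mul {ℓ : ℕ} {b k q e : ℝ} (hk : 0 < k) (hq : 0 < q)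
    (hℓ : 4 ^ ℓ * k * q ^ 2 ≤ b) (he : 1 / q ≤ e) : 2 ^ ℓ ≤ √(b / k) * e := by
  have hsq : (2 ^ ℓ * q) ^ 2 * k = 4 ^ ℓ * k * q ^ 2 := by
    rw [mul_pow, ← pow_mul, mul_comm ℓ, pow_mul]
    norm_num
    ring
  calc (2 : ℝ) ^ ℓ = 2 ^ ℓ * q * (1 / q) := by field_simp
    _ ≤ √(b / k) * e := by
      gcongr
      exact Real.le_sqrt_of_sq_le ((le_div_iff₀ hk).2 (hsq.trans_le hℓ))

variable {p : X → ℝ}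

theorem le_maxScore [Finite X] (hden : ∀ x, 0 < den x)
    (hlim : ∀ x, Tendsto (fun k => (num (x, k) : ℝ) / den (x, k)) atTop (𝓝 (p x)))
    (hN : 0 < N) (hq : 0 < q) (hn : 1 ≤ n) (hB : 0 < B n) {ℓ : ℕ}
    (hℓ : 4 ^ ℓ * N ^ n * q ^ 2 ≤ B n) {z : Fin (B n) → Fin n → X} {A : Finset (Fin n → X)}
    (hA : 1 / (q : ℝ) < ∑ a ∈ A, empirical z a - ∑ a ∈ A, iid p n a) :
    ℓ ≤ maxScore B num den N q (batchWord z) := by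
  obtain ⟨w, hw, rfl⟩ := exists_passes hden hlim hq hn hB hℓ hA
  exact le_csSup (bddAbove_score_passes hN hq _) ⟨w, hw, rfl⟩

variable [Fintype X]

theorem two_rpow_maxScore_sub_one_le (hp : ∀ x, 0 ≤ p x) (hden : ∀ x, 0 < den x)
    (hnum : ∀ x k, p x ≤ (num (x, k) : ℝ) / den (x, k)) (hB_pos : ∀ n, 1 ≤ n → 0 < B n)
    (hB_mono : ∀ m n, 1 ≤ m → m ≤ n → B m ≤ B n) (hN : 0 < N) (hq : 0 < q) (hn : 1 ≤ n)
    (z : Fin (B n) → Fin n → X) :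
    (2 : ℝ) ^ ((maxScore B num den N q (batchWord z) : ℝ) - 1) ≤
      1 / 2 * (1 + √(B n / N ^ n) * ∑ a, |empirical z a - iid p n a|) := by
  have hdev : 0 ≤ √(B n / N ^ n) * ∑ a, |empirical z a - iid p n a| := by positivity
  rw [Real.rpow_sub two_pos, Real.rpow_natCast, Real.rpow_one, div_eq_inv_mul, ← one_div]
  gcongr
  by_cases h0 : maxScore B num den N q (batchWord z) = 0
  · rw [h0, pow_zero]
    exact le_add_of_nonneg_right hdev
  · obtain ⟨w, hw, hscore⟩ := exists_passes_of_maxScore_ne_zero hN hq h0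
    have hlen := hw.blockLength_eq hB_pos hB_mono hn
    obtain ⟨A, hA⟩ := hw.exists_event hB_pos hp hden hnum hq hlen
    have hle := hlen ▸ hw.score_le
    rw [← hscore]
    have := two_pow_le_sqrt_div_mul (b := B n) (k := N ^ n) (by positivity)
      (Nat.cast_pos.2 hq) (by exact_mod_cast hle) (hA.le.trans (sum_sub_le_sum_abs _ _ A))
    linarith

theorem isCritic_maxScore_sub_one (hp : p ∈ stdSimplex ℝ X) (hden : ∀ x, 0 < den x)
    (hnum : ∀ x k, p x ≤ (num (x, k) : ℝ) / den (x, k)) (hB_pos : ∀ n, 1 ≤ n → 0 < B n)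
    (hB_mono : ∀ m n, 1 ≤ m → m ≤ n → B m ≤ B n) (hq : 0 < q) :
    IsCritic p fun y => (maxScore B num den (Fintype.card X) q y : ℝ) - 1 := by
  intro m _
  have : Nonempty X := nonempty_of_mem_stdSimplex hp
  have hN : 0 < Fintype.card X := Fintype.card_pos
  by_cases hm : ∃ n, 1 ≤ n ∧ m = B n * n
  · obtain ⟨n, hn, rfl⟩ := hm
    have hw := iid_mem_stdSimplex (iid_mem_stdSimplex hp n) (B n)
    have hb : (0 : ℝ) < B n := by exact_mod_cast hB_pos n hn
    have hk : (0 : ℝ) < (Fintype.card X : ℝ) ^ n := by positivity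
    have hdev := mean_sum_abs_empirical_sub_le (iid_mem_stdSimplex hp n) (hB_pos n hn)
    rw [Fintype.card_fun, Fintype.card_fin, Nat.cast_pow] at hdev
    calc _ = ∑ z : Fin (B n) → Fin n → X, iid (iid p n) (B n) z *
            (2 : ℝ) ^ ((maxScore B num den (Fintype.card X) q (batchWord z) : ℝ) - 1) :=
          expect_iid_mul p n (B n)
            fun y => (2 : ℝ) ^ ((maxScore B num den (Fintype.card X) q y : ℝ) - 1)
      _ ≤ ∑ z : Fin (B n) → Fin n → X, iid (iid p n) (B n) z *
            (1 / 2 * (1 + √(B n / Fintype.card X ^ n) * ∑ a, |empirical z a - iid p n a|)) :=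
          Finset.sum_le_sum fun z _ => mul_le_mul_of_nonneg_left
            (two_rpow_maxScore_sub_one_le hp.1 hden hnum hB_pos hB_mono hN hq hn z) (hw.1 z)
      _ = 1 / 2 * (1 + √(B n / Fintype.card X ^ n) *
            ∑ z : Fin (B n) → Fin n → X,
              iid (iid p n) (B n) z * ∑ a, |empirical z a - iid p n a|) := by
          simp_rw [mul_left_comm _ (1 / 2 : ℝ), ← Finset.mul_sum, mul_add, mul_one,
            Finset.sum_add_distrib, hw.2, mul_left_comm _ (√_), ← Finset.mul_sum]
          ring
      _ ≤ 1 / 2 * (1 + √(B n / Fintype.card X ^ n) * √(Fintype.card X ^ n / B n)) := by gcongr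
      _ = 1 := by
          rw [← Real.sqrt_mul (by positivity), div_mul_div_cancel₀ hk.ne', div_self hb.ne',
            Real.sqrt_one]
          norm_num
  · have h0 (x : Fin m → X) : maxScore B num den (Fintype.card X) q (List.ofFn x) = 0 :=
      maxScore_eq_zero hN hq fun n hn hlen => hm ⟨n, hn, by simpa using hlen⟩
    simp only [h0, Nat.cast_zero, zero_sub]
    rw [← Finset.sum_mul, (iid_mem_stdSimplex hp m).2, one_mul]
    exact Real.rpow_le_one_of_one_le_of_nonpos one_le_two (by norm_num)

end MaxScore

variable [Fintype X] {p : X → ℝ} {B : ℕ → ℕ}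

theorem exists_empirical_critic (hp : p ∈ stdSimplex ℝ X)
    (hp_comp : LowerSemicomputable fun x => -p x) (hB_comp : Computable B)
    (hB_pos : ∀ n, 1 ≤ n → 0 < B n) (hB_mono : ∀ m n, 1 ≤ m → m ≤ n → B m ≤ B n)
    {q : ℕ} (hq : 0 < q) :
    ∃ δ : List X → ℝ, LowerSemicomputable δ ∧ IsCritic p δ ∧ (∀ y, -1 ≤ δ y) ∧
      ∀ (n ℓ : ℕ), 1 ≤ n → 4 ^ ℓ * Fintype.card X ^ n * q ^ 2 ≤ B n →
        ∀ (z : Fin (B n) → Fin n → X) (A : Finset (Fin n → X)),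
          1 / (q : ℝ) < ∑ a ∈ A, empirical z a - ∑ a ∈ A, iid p n a →
            (ℓ : ℝ) - 1 ≤ δ (batchWord z) := by
  obtain ⟨num, den, hnum, hden, hden_pos, hle, hlim⟩ := exists_computable_upper_approx hp.1 hp_comp
  have : Nonempty X := nonempty_of_mem_stdSimplex hp
  have hN : 0 < Fintype.card X := Fintype.card_pos
  refine ⟨fun y => (maxScore B num den (Fintype.card X) q y : ℝ) - 1,
    lowerSemicomputable_maxScore_sub_one hB_comp hnum hden hN hq,
    isCritic_maxScore_sub_one hp hden_pos hle hB_pos hB_mono hq,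
    fun y => (zero_sub (1 : ℝ)).ge.trans (sub_le_sub_right (Nat.cast_nonneg _) _),
    fun n ℓ hn hℓ z A hA => sub_le_sub_right (Nat.cast_le.2 ?_) _⟩
  exact le_maxScore hden_pos hlim hN hq hn (hB_pos n hn) hℓ hA

end Critic

theorem tvDist_nonneg {α : Type*} [Fintype α] (P Q : α → ℝ) : 0 ≤ tvDist P Q := by
  unfold tvDist
  positivity

section Detection

variable {α : Type*} [Fintype α] {w : α → ℝ}

open Classical in
theorem prob_sum_empirical_sub_le (hw : w ∈ stdSimplex ℝ α) {b : ℕ} {q v : ℝ} (hq : 0 < q)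
    (hb : 4 * q ^ 2 ≤ b) {A : Finset α} (hv : 2 / q ≤ ∑ a ∈ A, w a - v) :
    ∑ z : Fin b → α, iid w b z * (if ∑ a ∈ A, empirical z a - v ≤ 1 / q then 1 else 0) ≤
      1 / 2 := by
  have hb0 : (0 : ℝ) < b := (by positivity : 0 < 4 * q ^ 2).trans_le hb
  have : Nonempty (Fin b) := ⟨⟨0, by exact_mod_cast hb0⟩⟩
  have hmean : ∑ a, w a * (if a ∈ A then (1 : ℝ) else 0) = ∑ a ∈ A, w a := by simp
  have hsq : ∑ a, w a * (if a ∈ A then (1 : ℝ) else 0) ^ 2 ≤ 1 := by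
    refine (Finset.sum_le_sum fun a _ => mul_le_of_le_one_right (hw.1 a) ?_).trans hw.2.le
    split_ifs <;> norm_num
  have hcheb := prob_le_abs_sub_mean_le (ι := Fin b) hw (fun a => if a ∈ A then (1 : ℝ) else 0)
    (γ := 1 / q) (by positivity) (fun z => ∑ a ∈ A, empirical z a - v ≤ 1 / q) fun z hz => by
      rw [hmean, Fintype.card_fin, ← sum_empirical z A, abs_sub_comm]
      refine le_trans ?_ (le_abs_self _)
      linarith [show 2 / q = 1 / q + 1 / q by ring]
  refine hcheb.trans ?_
  rw [div_le_iff₀ (by positivity), Real.sqrt_le_left (by positivity), Fintype.card_fin,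
    div_le_iff₀ hb0]
  refine hsq.trans ?_
  rw [one_div_mul_one_div, div_pow, one_pow, mul_pow, one_div_mul_eq_div,
    le_div_iff₀ (by positivity)]
  linarith

theorem half_sub_one_le_sum_mul (hw : w ∈ stdSimplex ℝ α) {f : α → ℝ} {ℓ : ℝ} (hℓ : 0 ≤ ℓ)
    (P : α → Prop) [DecidablePred P] (hP : ∑ a, w a * (if P a then 1 else 0) ≤ 1 / 2)
    (hf : ∀ a, -1 ≤ f a) (hfP : ∀ a, ¬ P a → ℓ - 1 ≤ f a) :
    ℓ / 2 - 1 ≤ ∑ a, w a * f a := by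
  have hle (a) : ℓ - 1 - ℓ * (if P a then 1 else 0) ≤ f a := by
    split_ifs with h
    · linarith [hf a]
    · linarith [hfP a h]
  calc ℓ / 2 - 1 ≤ ℓ - 1 - ℓ * ∑ a, w a * (if P a then 1 else 0) := by
        linarith [mul_le_mul_of_nonneg_left hP hℓ]
    _ = ∑ a, w a * (ℓ - 1 - ℓ * (if P a then 1 else 0)) := by
        simp_rw [mul_sub (w _) (ℓ - 1), Finset.sum_sub_distrib, ← Finset.sum_mul, hw.2, one_mul,
          mul_left_comm _ ℓ, ← Finset.mul_sum]
    _ ≤ ∑ a, w a * f a :=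
        Finset.sum_le_sum fun a _ => mul_le_mul_of_nonneg_left (hle a) (hw.1 a)

theorem half_sub_one_le_expect_batchWord {X : Type*} [Fintype X] {n b ℓ : ℕ}
    {P p : (Fin n → X) → ℝ} (hP : P ∈ stdSimplex ℝ (Fin n → X))
    (hp : p ∈ stdSimplex ℝ (Fin n → X)) {q : ℝ} (hq : 0 < q) (hb : 4 * q ^ 2 ≤ b)
    (htv : 2 / q ≤ tvDist P p) {δ : List X → ℝ} (hδ : ∀ y, -1 ≤ δ y)
    (hδℓ : ∀ (z : Fin b → Fin n → X) (A : Finset (Fin n → X)),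
      1 / q < ∑ a ∈ A, empirical z a - ∑ a ∈ A, p a → (ℓ : ℝ) - 1 ≤ δ (batchWord z)) :
    (ℓ : ℝ) / 2 - 1 ≤ expect (iid P b) fun z => δ (batchWord z) := by
  classical
  obtain ⟨A, hA⟩ := exists_sum_sub_eq_tvDist hP hp
  exact half_sub_one_le_sum_mul (iid_mem_stdSimplex hP b) (Nat.cast_nonneg ℓ)
    (fun z => ∑ a ∈ A, empirical z a - ∑ a ∈ A, p a ≤ 1 / q)
    (prob_sum_empirical_sub_le hP hq hb (htv.trans_eq hA.symm)) (fun z => hδ _)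
    fun z hz => hδℓ z A (not_le.1 hz)

end Detection

section AlgorithmicToNearPerfect

variable {X : Type*} [Fintype X] [Primcodable X] {p : X → ℝ} {R Rc : ℝ} {B : ℕ → ℕ}

theorem eventually_tvDist_lt_of_batchScore_le (hp : p ∈ stdSimplex ℝ X)
    (hp_comp : LowerSemicomputable fun x => -p x) (hB_comp : Computable B)
    (hB_pos : ∀ n, 1 ≤ n → 0 < B n) (hB_mono : ∀ m n, 1 ≤ m → m ≤ n → B m ≤ B n)
    (hB_lim : Tendsto (fun n => (B n : ℝ) / (Fintype.card X : ℝ) ^ n) atTop atTop)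
    (hRc : 0 ≤ Rc) {c : ∀ n, Code X n R Rc}
    (h : ∀ δ : List X → ℝ, LowerSemicomputable δ → IsCritic p δ →
      ∃ C : ℝ, ∀ n, 1 ≤ n → batchScore p δ (c n) (B n) ≤ C) {q : ℕ} (hq : 0 < q) :
    ∀ᶠ n in atTop, tvDist ((c n).inducedY p) (iid p n) < 2 / q := by
  have : Nonempty X := nonempty_of_mem_stdSimplex hp
  obtain ⟨δ, hδ, hδ_critic, hδ_ge, hδ_score⟩ :=
    exists_empirical_critic hp hp_comp hB_comp hB_pos hB_mono hq
  obtain ⟨C, hC⟩ := h δ hδ hδ_critic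
  obtain ⟨ℓ, hℓ⟩ := exists_nat_gt (2 * (C + 1))
  filter_upwards [hB_lim.eventually_ge_atTop (4 ^ (ℓ + 1) * (q : ℝ) ^ 2),
    eventually_ge_atTop 1] with n hBn hn
  by_contra! htv
  have hlarge : 4 ^ (ℓ + 1) * (q : ℝ) ^ 2 * Fintype.card X ^ n ≤ B n := by
    rwa [le_div_iff₀ (by positivity)] at hBn
  have hcard : (1 : ℝ) ≤ Fintype.card X ^ n :=
    one_le_pow₀ (by exact_mod_cast Fintype.card_pos (α := X))
  have hlarge_sq : 4 * (q : ℝ) ^ 2 ≤ B n :=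
    calc 4 * (q : ℝ) ^ 2 = 4 ^ 1 * (q : ℝ) ^ 2 * 1 := by ring
      _ ≤ 4 ^ (ℓ + 1) * (q : ℝ) ^ 2 * Fintype.card X ^ n := by
        gcongr
        exacts [by norm_num, Nat.le_add_left 1 ℓ]
      _ ≤ B n := hlarge
  have hlarge_score : 4 ^ ℓ * Fintype.card X ^ n * q ^ 2 ≤ B n :=
    calc 4 ^ ℓ * Fintype.card X ^ n * q ^ 2 ≤ 4 ^ (ℓ + 1) * Fintype.card X ^ n * q ^ 2 := by
          gcongr
          exacts [by norm_num, Nat.le_succ ℓ]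
      _ = 4 ^ (ℓ + 1) * q ^ 2 * Fintype.card X ^ n := mul_right_comm _ _ _
      _ ≤ B n := by exact_mod_cast hlarge
  have hscore := half_sub_one_le_expect_batchWord ((c n).inducedY_mem_stdSimplex hp hRc)
    (iid_mem_stdSimplex hp n) (Nat.cast_pos.2 hq) hlarge_sq htv hδ_ge
    (hδ_score n ℓ hn hlarge_score)
  rw [← batchScore_eq_expect] at hscore
  linarith [hC n hn]

theorem AchievableAlgorithmic.nearPerfect {d : X → X → ℝ} {Δ : ℝ} (hp : p ∈ stdSimplex ℝ X)
    (hp_comp : LowerSemicomputable fun x => -p x) (hB_comp : Computable B)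
    (hB_pos : ∀ n, 1 ≤ n → 0 < B n) (hB_mono : ∀ m n, 1 ≤ m → m ≤ n → B m ≤ B n)
    (hB_lim : Tendsto (fun n => (B n : ℝ) / (Fintype.card X : ℝ) ^ n) atTop atTop)
    (hRc : 0 ≤ Rc) (h : AchievableAlgorithmic p d R Rc B Δ) :
    AchievableNearPerfect p d R Rc Δ := by
  intro ε hε
  obtain ⟨c, hc, hscore⟩ := h ε hε
  refine ⟨c, ?_, tendsto_order.2 ⟨fun a ha => .of_forall fun n =>
    ha.trans_le (tvDist_nonneg _ _), fun η hη => ?_⟩⟩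
  · rwa [limsup_congr (v := fun n => distortion p d (c n))] at hc
    filter_upwards [eventually_ge_atTop 1] with n hn
    exact batchDistortion_eq_distortion (c n) hp hRc d (hB_pos n hn)
  · obtain ⟨q, hq⟩ := exists_nat_gt (2 / η)
    have hq_pos : (0 : ℝ) < q := (div_pos two_pos hη).trans hq
    filter_upwards [eventually_tvDist_lt_of_batchScore_le hp hp_comp hB_comp hB_pos hB_mono hB_lim
      hRc hscore (Nat.cast_pos.1 hq_pos)] with n hn
    exact hn.trans ((div_lt_comm₀ hη hq_pos).1 hq)

end AlgorithmicToNearPerfect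

/-! ### Convex hulls of compact sets -/

theorem isCompact_convexHull_of_finiteDimensional {E : Type*} [NormedAddCommGroup E]
    [NormedSpace ℝ E] [FiniteDimensional ℝ E] {K : Set E} (hK : IsCompact K) :
    IsCompact (convexHull ℝ K) := by
  let comb (m : ℕ) (x : (Fin m → ℝ) × (Fin m → E)) : E := ∑ i, x.1 i • x.2 i
  have hcomb (m) : IsCompact (comb m '' (stdSimplex ℝ (Fin m) ×ˢ Set.univ.pi fun _ => K)) :=
    ((isCompact_stdSimplex ℝ (Fin m)).prod (isCompact_univ_pi fun _ => hK)).image (by fun_prop)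
  convert isCompact_iUnion fun m : Fin (Module.finrank ℝ E + 2) => hcomb m
  refine Set.Subset.antisymm (fun x hx => ?_) (Set.iUnion_subset fun m => ?_)
  · obtain ⟨ι, _, z, w, hz, hind, hw_pos, hw_sum, rfl⟩ := eq_pos_convex_span_of_mem_convexHull hx
    have hcard : Fintype.card ι < Module.finrank ℝ E + 2 :=
      Nat.lt_succ_of_le (hind.card_le_finrank_succ.trans
        (Nat.succ_le_succ (Submodule.finrank_le _)))
    let e := (Fintype.equivFin ι).symm
    refine Set.mem_iUnion.2 ⟨⟨Fintype.card ι, hcard⟩, (w ∘ e, z ∘ e),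
      ⟨⟨fun i => (hw_pos _).le, (e.sum_comp w).trans hw_sum⟩, fun i _ => hz ⟨_, rfl⟩⟩,
      e.sum_comp fun i => w i • z i⟩
  · rintro _ ⟨⟨w, z⟩, ⟨hw, hz⟩, rfl⟩
    exact (convex_convexHull ℝ K).sum_mem (fun i _ => hw.1 i) hw.2
      fun i _ => subset_convexHull ℝ K (hz i (Set.mem_univ i))

/-! ### The region in terms of mixtures of product distributions -/

section Region

variable {X V : Type*} [Fintype X] [Fintype V] {p : X → ℝ} {d : X → X → ℝ}

/-- The relative entropy, in bits, of `q` with respect to `p`. -/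
def relEnt (p q : X → ℝ) : ℝ := ∑ x, q x * Real.logb 2 (q x / p x)

theorem relEnt_nonneg {q : X → ℝ} (hp : p ∈ stdSimplex ℝ X) (hpq : ∀ x, 0 < q x → 0 < p x)
    (hq : q ∈ stdSimplex ℝ X) : 0 ≤ relEnt p q := by
  have hmean : ∑ x, q x * (p x / q x) ≤ 1 := by
    rw [← hp.2]
    refine Finset.sum_le_sum fun x _ => ?_
    rcases eq_or_ne (q x) 0 with h | h
    · simpa [h] using hp.1 x
    · rw [mul_div_cancel₀ _ h]
  have hjensen := sum_mul_logb_le hq (fun x hx => div_pos (hpq x hx) hx) hmean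
  rw [Real.logb_one] at hjensen
  have hneg : relEnt p q = -∑ x, q x * Real.logb 2 (p x / q x) := by
    rw [relEnt, ← Finset.sum_neg_distrib]
    exact Finset.sum_congr rfl fun x _ => by rw [← mul_neg, ← Real.logb_inv, inv_div]
  linarith

theorem continuous_relEnt (hp_pos : ∀ x, 0 < p x) : Continuous (relEnt p) := by
  have hterm (q : X → ℝ) (x) : q x * Real.logb 2 (q x / p x) =
      p x * ((q x / p x) * Real.log (q x / p x)) / Real.log 2 := by
    have := (hp_pos x).ne'
    rw [Real.logb]
    field_simp
  unfold relEnt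
  simp_rw [hterm]
  refine continuous_finsetSum _ fun x _ => (continuous_const.mul ?_).div_const _
  exact Real.continuous_mul_log.comp ((continuous_apply (A := fun _ : X => ℝ) x).div_const (p x))

theorem mutualInfo_eq_sum_relEnt {w : V → ℝ} {k : V → X → ℝ} (hk : ∀ v, k v ∈ stdSimplex ℝ X)
    (havg : ∀ x, ∑ v, w v * k v x = p x) :
    mutualInfo (fun a : X × V => w a.2 * k a.2 a.1) = ∑ v, w v * relEnt p (k v) := by
  unfold mutualInfo relEnt
  simp only [havg, ← Finset.mul_sum, (hk _).2, mul_one]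
  rw [Finset.sum_comm]
  simp_rw [Finset.mul_sum]
  refine Finset.sum_congr rfl fun v _ => Finset.sum_congr rfl fun x _ => ?_
  rcases eq_or_ne (w v) 0 with hw | hw
  · simp [hw]
  · rw [mul_comm (p x), mul_div_mul_left _ _ hw, mul_assoc]

/-- The triplet `t` is attained by the mixture with weights `w` of the products `q v ⊗ r v`, that
is by letting `X` and `Y` be independent with laws `q v` and `r v` conditionally on `V = v`. -/
structure IsMixture (p : X → ℝ) (d : X → X → ℝ) (w : V → ℝ) (q r : V → X → ℝ)
    (t : ℝ × ℝ × ℝ) : Prop where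
  w_mem : w ∈ stdSimplex ℝ V
  q_mem : ∀ v, q v ∈ stdSimplex ℝ X
  r_mem : ∀ v, r v ∈ stdSimplex ℝ X
  q_avg : ∀ x, ∑ v, w v * q v x = p x
  r_avg : ∀ y, ∑ v, w v * r v y = p y
  q_ent : ∑ v, w v * relEnt p (q v) ≤ t.1
  r_ent : ∑ v, w v * relEnt p (r v) ≤ t.1 + t.2.1
  dist_le : ∑ v, w v * (∑ x, ∑ y, q v x * r v y * d x y) ≤ t.2.2

namespace IsMixture

variable {w : V → ℝ} {q r : V → X → ℝ} {t : ℝ × ℝ × ℝ}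

theorem comp_equiv {V' : Type*} [Fintype V'] (h : IsMixture p d w q r t) (e : V' ≃ V) :
    IsMixture p d (w ∘ e) (q ∘ e) (r ∘ e) t where
  w_mem := ⟨fun v => h.w_mem.1 (e v), (e.sum_comp w).trans h.w_mem.2⟩
  q_mem v := h.q_mem (e v)
  r_mem v := h.r_mem (e v)
  q_avg x := (e.sum_comp fun v => w v * q v x).trans (h.q_avg x)
  r_avg y := (e.sum_comp fun v => w v * r v y).trans (h.r_avg y)
  q_ent := (e.sum_comp fun v => w v * relEnt p (q v)).trans_le h.q_ent
  r_ent := (e.sum_comp fun v => w v * relEnt p (r v)).trans_le h.r_ent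
  dist_le := (e.sum_comp fun v => w v * ∑ x, ∑ y, q v x * r v y * d x y).trans_le h.dist_le

theorem mono {R Rc Δ R' Δ' : ℝ} (h : IsMixture p d w q r (R, Rc, Δ)) (hR : R ≤ R') (hΔ : Δ ≤ Δ') :
    IsMixture p d w q r (R', Rc, Δ') where
  __ := h
  q_ent := h.q_ent.trans hR
  r_ent := h.r_ent.trans (add_le_add_left hR Rc)
  dist_le := h.dist_le.trans hΔ

end IsMixture

section Joint

variable {V : Type*} {w : V → ℝ} {q r : V → X → ℝ} {W : X → X × V → ℝ}

theorem sum_snd_jointXYV (hr : ∀ v, r v ∈ stdSimplex ℝ X)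
    (hJ : ∀ x y v, jointXYV p W x y v = w v * (q v x * r v y)) (x : X) (v : V) :
    ∑ y, jointXYV p W x y v = w v * q v x := by
  simp only [hJ, ← Finset.mul_sum, (hr v).2, mul_one]

theorem sum_fst_jointXYV (hq : ∀ v, q v ∈ stdSimplex ℝ X)
    (hJ : ∀ x y v, jointXYV p W x y v = w v * (q v x * r v y)) (y : X) (v : V) :
    ∑ x, jointXYV p W x y v = w v * r v y := by
  simp only [hJ, ← Finset.mul_sum, ← Finset.sum_mul, (hq v).2, one_mul]

theorem sum_jointXYV_mul [Fintype V]
    (hJ : ∀ x y v, jointXYV p W x y v = w v * (q v x * r v y)) :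
    ∑ x, ∑ y, ∑ v, jointXYV p W x y v * d x y =
      ∑ v, w v * ∑ x, ∑ y, q v x * r v y * d x y := by
  simp_rw [hJ, Finset.mul_sum, mul_assoc]
  rw [Finset.sum_congr rfl fun x _ => Finset.sum_comm, Finset.sum_comm]

end Joint

theorem IsMixture.mem_region_fin {s : ℕ} {w : Fin s → ℝ} {q r : Fin s → X → ℝ} {t : ℝ × ℝ × ℝ}
    (hp_pos : ∀ x, 0 < p x) (h : IsMixture p d w q r t) (ht : 0 ≤ t.2.1) : t ∈ region p d := by
  set W : X → X × Fin s → ℝ := fun x a => w a.2 * (q a.2 x * r a.2 a.1) / p x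
  have hJ (x y v) : jointXYV p W x y v = w v * (q v x * r v y) :=
    mul_div_cancel₀ _ (hp_pos x).ne'
  have hX := sum_snd_jointXYV h.r_mem hJ
  have hY := sum_fst_jointXYV h.q_mem hJ
  refine ⟨ht, s, W, fun x => ⟨fun a => ?_, ?_⟩, fun y => ?_, ?_, ?_, ?_, fun x y v => ?_⟩
  · exact div_nonneg (mul_nonneg (h.w_mem.1 _)
      (mul_nonneg ((h.q_mem _).1 x) ((h.r_mem _).1 a.1))) (hp_pos x).le
  · refine mul_left_cancel₀ (hp_pos x).ne' ?_
    calc p x * ∑ a, W x a = ∑ v, ∑ y, jointXYV p W x y v := by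
          rw [Fintype.sum_prod_type_right, Finset.mul_sum]
          simp only [Finset.mul_sum, jointXYV]
      _ = p x * 1 := by simp_rw [hX, h.q_avg, mul_one]
  · rw [Finset.sum_comm]
    simp_rw [hY, h.r_avg]
  · simp_rw [hX, mutualInfo_eq_sum_relEnt h.q_mem h.q_avg, h.q_ent]
  · simp_rw [hY, mutualInfo_eq_sum_relEnt h.r_mem h.r_avg, h.r_ent]
  · rw [sum_jointXYV_mul hJ]
    exact h.dist_le
  · simp_rw [hX, hY, ← Finset.mul_sum, (h.q_mem v).2, hJ]
    ring

theorem IsMixture.mem_region {w : V → ℝ} {q r : V → X → ℝ} {t : ℝ × ℝ × ℝ}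
    (hp_pos : ∀ x, 0 < p x) (h : IsMixture p d w q r t) (ht : 0 ≤ t.2.1) : t ∈ region p d :=
  (h.comp_equiv (Fintype.equivFin V).symm).mem_region_fin hp_pos ht

theorem exists_eq_mul_of_cond_indep {α β : Type*} [Fintype α] [Fintype β] [Nonempty α] [Nonempty β]
    {Q : α → β → ℝ} (hQ : ∀ a b, 0 ≤ Q a b)
    (hindep : ∀ a b, Q a b * (∑ a', ∑ b', Q a' b') = (∑ b', Q a b') * ∑ a', Q a' b) :
    ∃ q ∈ stdSimplex ℝ α, ∃ r ∈ stdSimplex ℝ β,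
      ∀ a b, Q a b = (∑ a', ∑ b', Q a' b') * (q a * r b) := by
  obtain ⟨q, hq, hqQ⟩ := exists_mem_stdSimplex_sum_mul_eq (f := fun a => ∑ b, Q a b)
    fun a => Finset.sum_nonneg fun b _ => hQ a b
  obtain ⟨r, hr, hrQ⟩ := exists_mem_stdSimplex_sum_mul_eq (f := fun b => ∑ a, Q a b)
    fun b => Finset.sum_nonneg fun a _ => hQ a b
  rw [Finset.sum_comm] at hrQ
  refine ⟨q, hq, r, hr, fun a b => ?_⟩
  rcases eq_or_ne (∑ a', ∑ b', Q a' b') 0 with h0 | h0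
  · rw [h0, zero_mul]
    refine (hQ a b).antisymm' ?_
    calc Q a b ≤ ∑ b', Q a b' := Finset.single_le_sum (fun b' _ => hQ a b') (Finset.mem_univ b)
      _ = 0 := by rw [← hqQ a, h0, zero_mul]
  · refine mul_right_cancel₀ h0 ?_
    rw [hindep, ← hqQ, ← hrQ]
    ring

theorem exists_isMixture_of_mem_region (hp : p ∈ stdSimplex ℝ X) {t : ℝ × ℝ × ℝ}
    (ht : t ∈ region p d) :
    ∃ (s : ℕ) (w : Fin s → ℝ) (q r : Fin s → X → ℝ), IsMixture p d w q r t := by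
  obtain ⟨-, s, W, hW, hY, hIX, hIY, hd, hmarkov⟩ := ht
  have : Nonempty X := nonempty_of_mem_stdSimplex hp
  have hJ_nonneg (x y v) : 0 ≤ jointXYV p W x y v := mul_nonneg (hp.1 x) ((hW x).1 _)
  choose q hq r hr hJ using fun v => exists_eq_mul_of_cond_indep
    (fun x y => hJ_nonneg x y v) fun x y => hmarkov x y v
  set w : Fin s → ℝ := fun v => ∑ x, ∑ y, jointXYV p W x y v
  have hJ' (x y v) : jointXYV p W x y v = w v * (q v x * r v y) := hJ v x y
  have hq_avg (x) : ∑ v, w v * q v x = p x := by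
    simp_rw [← sum_snd_jointXYV hr hJ', jointXYV]
    rw [Finset.sum_comm, ← Fintype.sum_prod_type', ← Finset.mul_sum, (hW x).2, mul_one]
  have hr_avg (y) : ∑ v, w v * r v y = p y := by
    simp_rw [← sum_fst_jointXYV hq hJ', ← hY y]
    exact Finset.sum_comm
  refine ⟨s, w, q, r, ⟨fun v => Finset.sum_nonneg fun x _ => Finset.sum_nonneg fun y _ =>
    hJ_nonneg x y v, ?_⟩, hq, hr, hq_avg, hr_avg, ?_, ?_, ?_⟩
  · calc ∑ v, w v = ∑ v, ∑ x, w v * q v x := by simp_rw [← Finset.mul_sum, (hq _).2, mul_one]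
      _ = ∑ x, p x := by rw [Finset.sum_comm, Finset.sum_congr rfl fun x _ => hq_avg x]
      _ = 1 := hp.2
  · rw [← mutualInfo_eq_sum_relEnt hq hq_avg]
    simpa only [sum_snd_jointXYV hr hJ'] using hIX
  · rw [← mutualInfo_eq_sum_relEnt hr hr_avg]
    simpa only [sum_fst_jointXYV hq hJ'] using hIY
  · rwa [← sum_jointXYV_mul hJ']

theorem nonneg_of_mem_region (hp : p ∈ stdSimplex ℝ X) (hp_pos : ∀ x, 0 < p x)
    (hd : ∀ x y, 0 ≤ d x y) {t : ℝ × ℝ × ℝ} (ht : t ∈ region p d) :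
    0 ≤ t.1 ∧ 0 ≤ t.2.1 ∧ 0 ≤ t.2.2 := by
  obtain ⟨s, w, q, r, h⟩ := exists_isMixture_of_mem_region hp ht
  refine ⟨le_trans ?_ h.q_ent, ht.1, le_trans ?_ h.dist_le⟩
  · exact Finset.sum_nonneg fun v _ =>
      mul_nonneg (h.w_mem.1 v) (relEnt_nonneg hp (fun x _ => hp_pos x) (h.q_mem v))
  · exact Finset.sum_nonneg fun v _ => mul_nonneg (h.w_mem.1 v) <|
      Finset.sum_nonneg fun x _ => Finset.sum_nonneg fun y _ =>
        mul_nonneg (mul_nonneg ((h.q_mem v).1 x) ((h.r_mem v).1 y)) (hd x y)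

/-- The point `(q, r, D(q‖p), D(r‖p), E[d(X, Y)])` given by the product distribution `q ⊗ r` of
`(X, Y)`, where `z = (q, r)`. -/
def productPoint (p : X → ℝ) (d : X → X → ℝ) (z : (X → ℝ) × (X → ℝ)) :
    (X → ℝ) × (X → ℝ) × ℝ × ℝ × ℝ :=
  (z.1, z.2, relEnt p z.1, relEnt p z.2, ∑ x, ∑ y, z.1 x * z.2 y * d x y)

theorem continuous_productPoint (hp_pos : ∀ x, 0 < p x) : Continuous (productPoint p d) := by
  have := continuous_relEnt hp_pos
  unfold productPoint
  fun_prop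

/-- The points of the ambient space of `productPoint` meeting the constraints of the triplet `t`. -/
def constraintSet {X : Type*} (p : X → ℝ) (t : ℝ × ℝ × ℝ) : Set ((X → ℝ) × (X → ℝ) × ℝ × ℝ × ℝ) :=
  {e | e.1 = p ∧ e.2.1 = p ∧ e.2.2.1 ≤ t.1 ∧ e.2.2.2.1 ≤ t.1 + t.2.1 ∧ e.2.2.2.2 ≤ t.2.2}

theorem isClosed_setOf_mem_constraintSet {X : Type*} (p : X → ℝ) :
    IsClosed {z : (ℝ × ℝ × ℝ) × ((X → ℝ) × (X → ℝ) × ℝ × ℝ × ℝ) | z.2 ∈ constraintSet p z.1} := by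
  unfold constraintSet
  refine .and (isClosed_eq ?_ ?_) <| .and (isClosed_eq ?_ ?_) <| .and (isClosed_le ?_ ?_) <|
    .and (isClosed_le ?_ ?_) (isClosed_le ?_ ?_) <;> fun_prop

theorem sum_smul_productPoint_mem_constraintSet_iff {w : V → ℝ} (z : V → (X → ℝ) × (X → ℝ))
    (hw : w ∈ stdSimplex ℝ V) (hz : ∀ v, z v ∈ stdSimplex ℝ X ×ˢ stdSimplex ℝ X)
    {t : ℝ × ℝ × ℝ} :
    ∑ v, w v • productPoint p d (z v) ∈ constraintSet p t ↔
      IsMixture p d w (fun v => (z v).1) (fun v => (z v).2) t := by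
  simp only [constraintSet, productPoint, Set.mem_ofPred_eq, Prod.fst_sum, Prod.snd_sum,
    Prod.smul_fst, Prod.smul_snd, smul_eq_mul, funext_iff, Finset.sum_apply, Pi.smul_apply]
  exact ⟨fun ⟨h1, h2, h3, h4, h5⟩ => ⟨hw, fun v => (hz v).1, fun v => (hz v).2, h1, h2, h3, h4, h5⟩,
    fun h => ⟨h.q_avg, h.r_avg, h.q_ent, h.r_ent, h.dist_le⟩⟩

theorem mem_region_iff_convexHull (hp : p ∈ stdSimplex ℝ X) (hp_pos : ∀ x, 0 < p x)
    {t : ℝ × ℝ × ℝ} :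
    t ∈ region p d ↔ 0 ≤ t.2.1 ∧
      ∃ e ∈ convexHull ℝ (productPoint p d '' (stdSimplex ℝ X ×ˢ stdSimplex ℝ X)),
        e ∈ constraintSet p t := by
  constructor
  · intro ht
    obtain ⟨s, w, q, r, h⟩ := exists_isMixture_of_mem_region hp ht
    have hz (v) : (q v, r v) ∈ stdSimplex ℝ X ×ˢ stdSimplex ℝ X := ⟨h.q_mem v, h.r_mem v⟩
    refine ⟨ht.1, ∑ v, w v • productPoint p d (q v, r v), ?_,
      (sum_smul_productPoint_mem_constraintSet_iff _ h.w_mem hz).2 h⟩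
    exact (convex_convexHull ℝ _).sum_mem (fun v _ => h.w_mem.1 v) h.w_mem.2 fun v _ =>
      subset_convexHull ℝ _ ⟨_, hz v, rfl⟩
  · rintro ⟨ht, e, he, het⟩
    obtain ⟨ι, _, w, z, hw_nonneg, hw_sum, hz, rfl⟩ := mem_convexHull_iff_exists_fintype.1 he
    choose u hu huz using hz
    simp only [← huz] at het
    exact ((sum_smul_productPoint_mem_constraintSet_iff u ⟨hw_nonneg, hw_sum⟩ hu).1 het).mem_region
      hp_pos ht

theorem isClosed_region (hp : p ∈ stdSimplex ℝ X) (hp_pos : ∀ x, 0 < p x) (d : X → X → ℝ) :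
    IsClosed (region p d) := by
  have hcompact := isCompact_convexHull_of_finiteDimensional
    (((isCompact_stdSimplex ℝ X).prod (isCompact_stdSimplex ℝ X)).image
      (continuous_productPoint (d := d) hp_pos))
  refine IsSeqClosed.isClosed fun u t hu hut => ?_
  choose hu_nonneg e he hue using fun n => (mem_region_iff_convexHull hp hp_pos).1 (hu n)
  obtain ⟨e₀, he₀, φ, hφ, hlim⟩ := hcompact.tendsto_subseq he
  refine (mem_region_iff_convexHull hp hp_pos).2 ⟨?_, e₀, he₀, ?_⟩
  · exact ge_of_tendsto' (hut.snd_nhds.fst_nhds) hu_nonneg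
  · exact (isClosed_setOf_mem_constraintSet p).mem_of_tendsto
      ((hut.comp hφ.tendsto_atTop).prodMk_nhds hlim) (.of_forall fun n => hue (φ n))

end Region

/-! ### The converse -/

section Marginal

variable {X U : Type*} [Fintype X] [Fintype U] {n : ℕ} {p : X → ℝ} {k : (Fin n → X) → ℝ}

open Classical in
/-- The law of the `t`-th letter of a random word with law `k`. -/
def marginal (t : Fin n) (k : (Fin n → X) → ℝ) (a : X) : ℝ := ∑ x with x t = a, k x

theorem sum_marginal_mul (t : Fin n) (k : (Fin n → X) → ℝ) (f : X → ℝ) :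
    ∑ a, marginal t k a * f a = ∑ x, k x * f (x t) := by
  classical
  rw [← Finset.sum_fiberwise Finset.univ (fun x : Fin n → X => x t)]
  refine Finset.sum_congr rfl fun a _ => ?_
  rw [marginal, Finset.sum_mul]
  refine Finset.sum_congr (by congr!) fun x hx => ?_
  rw [(Finset.mem_filter.1 hx).2]

theorem marginal_mem_stdSimplex (t : Fin n) (hk : k ∈ stdSimplex ℝ (Fin n → X)) :
    marginal t k ∈ stdSimplex ℝ X :=
  ⟨fun _ => Finset.sum_nonneg fun x _ => hk.1 x, by
    simpa [hk.2] using sum_marginal_mul t k fun _ => 1⟩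

theorem le_marginal (t : Fin n) (hk : ∀ x, 0 ≤ k x) (x : Fin n → X) : k x ≤ marginal t k (x t) :=
  Finset.single_le_sum (fun x' _ => hk x') (by simp)

theorem marginal_iid (hp : ∑ x, p x = 1) (t : Fin n) : marginal t (iid p n) = p := by
  classical
  funext a
  have h := sum_prod_mul_apply (ι := Fin n) hp (fun x => if x = a then 1 else 0) t
  simp only [mul_ite, mul_one, mul_zero, Finset.sum_ite_eq', Finset.mem_univ, if_true] at h
  rw [← h, marginal, Finset.sum_filter]
  congr!

theorem sum_mul_marginal (w : U → ℝ) (κ : U → (Fin n → X) → ℝ) (t : Fin n) (a : X) :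
    ∑ u, w u * marginal t (κ u) a = marginal t (fun x => ∑ u, w u * κ u x) a := by
  simp only [marginal, Finset.mul_sum]
  exact Finset.sum_comm

theorem sum_marginal_mul_marginal_mul (t : Fin n) (k l : (Fin n → X) → ℝ) (d : X → X → ℝ) :
    ∑ x, ∑ y, marginal t k x * marginal t l y * d x y =
      ∑ x, ∑ y, k x * l y * d (x t) (y t) := by
  simp_rw [mul_assoc, ← Finset.mul_sum]
  rw [sum_marginal_mul t k fun a => ∑ b, marginal t l b * d a b]
  exact Finset.sum_congr rfl fun x _ => by rw [sum_marginal_mul t l (d (x t))]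

theorem sum_relEnt_marginal_le (hp_pos : ∀ x, 0 < p x) (hk : k ∈ stdSimplex ℝ (Fin n → X)) :
    ∑ t, relEnt p (marginal t k) ≤ relEnt (iid p n) k := by
  have hiid (x : Fin n → X) : 0 < iid p n x := Finset.prod_pos fun t _ => hp_pos (x t)
  set m : (Fin n → X) → ℝ := fun x => ∏ t, marginal t k (x t)
  have hm : m ∈ stdSimplex ℝ (Fin n → X) := by
    refine ⟨fun x => Finset.prod_nonneg fun t _ => (marginal_mem_stdSimplex t hk).1 _, ?_⟩
    rw [← Fintype.prod_sum fun t => marginal t k]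
    exact Finset.prod_eq_one fun t _ => (marginal_mem_stdSimplex t hk).2
  have hmarg_pos {x} (hx : 0 < k x) (t) : 0 < marginal t k (x t) :=
    hx.trans_le (le_marginal t hk.1 x)
  have hm_pos (x) (hx : 0 < k x) : 0 < m x := Finset.prod_pos fun t _ => hmarg_pos hx t
  have hlog {x} (hx : 0 < k x) : Real.logb 2 (k x / iid p n x) =
      ∑ t, Real.logb 2 (marginal t k (x t) / p (x t)) + Real.logb 2 (k x / m x) := by
    rw [← Real.logb_prod _ _ fun t _ => (div_pos (hmarg_pos hx t) (hp_pos (x t))).ne',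
      Finset.prod_div_distrib]
    change _ = Real.logb 2 (m x / iid p n x) + _
    rw [← Real.logb_mul (div_pos (hm_pos x hx) (hiid x)).ne' (div_pos hx (hm_pos x hx)).ne',
      mul_comm, div_mul_div_cancel₀ (hm_pos x hx).ne']
  have hchain : relEnt (iid p n) k = ∑ t, relEnt p (marginal t k) + relEnt m k := by
    have hletter (t) : relEnt p (marginal t k) =
        ∑ x, k x * Real.logb 2 (marginal t k (x t) / p (x t)) :=
      sum_marginal_mul t k fun a => Real.logb 2 (marginal t k a / p a)
    simp_rw [hletter, relEnt]
    rw [Finset.sum_comm, ← Finset.sum_add_distrib]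
    refine Finset.sum_congr rfl fun x _ => ?_
    rcases (hk.1 x).eq_or_lt with h0 | hx
    · simp [← h0]
    rw [hlog hx, mul_add, Finset.mul_sum]
  rw [hchain]
  exact le_add_of_nonneg_right (relEnt_nonneg hm hm_pos hk)

theorem sum_mul_relEnt_le_logb (hp_pos : ∀ x, 0 < p x) {w : U → ℝ} (hw : w ∈ stdSimplex ℝ U)
    {q : U → X → ℝ} (hq : ∀ u, q u ∈ stdSimplex ℝ X) {b : U → ℝ}
    (hb : ∀ u x, w u * q u x ≤ b u * p x) :
    ∑ u, w u * relEnt p (q u) ≤ Real.logb 2 (∑ u, b u) := by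
  have hmean : ∑ z : U × X, w z.1 * q z.1 z.2 * (q z.1 z.2 / p z.2) ≤ ∑ u, b u := by
    rw [Fintype.sum_prod_type]
    refine Finset.sum_le_sum fun u _ => ?_
    calc ∑ x, w u * q u x * (q u x / p x) ≤ ∑ x, b u * p x * (q u x / p x) :=
          Finset.sum_le_sum fun x _ =>
            mul_le_mul_of_nonneg_right (hb u x) (div_nonneg ((hq u).1 x) (hp_pos x).le)
      _ = ∑ x, b u * q u x := Finset.sum_congr rfl fun x _ => by
            rw [mul_assoc, mul_div_cancel₀ _ (hp_pos x).ne']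
      _ = b u := by rw [← Finset.mul_sum, (hq u).2, mul_one]
  refine le_of_eq_of_le ?_
    (sum_mul_logb_le (mul_kernel_mem_stdSimplex hw hq) (fun z hz => ?_) hmean)
  · simp only [relEnt, Fintype.sum_prod_type, Finset.mul_sum, mul_assoc]
  · exact div_pos (pos_of_mul_pos_right hz (hw.1 _)) (hp_pos _)

theorem sum_prod_fin_div_mul (w : U → ℝ) (f : U → Fin n → ℝ) :
    ∑ v : U × Fin n, w v.1 / n * f v.1 v.2 = (∑ u, w u * ∑ t, f u t) / n := by
  simp only [Fintype.sum_prod_type, Finset.mul_sum, Finset.sum_div, div_mul_eq_mul_div]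

end Marginal

section Converse

variable {X V : Type*} [Fintype X] [Fintype V] {n : ℕ} {R Rc : ℝ} {p : X → ℝ}

theorem IsMixture.singleLetter (hp : ∑ x, p x = 1) (hp_pos : ∀ x, 0 < p x) (hn : 0 < n)
    {d : X → X → ℝ} {w : V → ℝ} {q r : V → (Fin n → X) → ℝ} {R Rc Δ : ℝ}
    (h : IsMixture (iid p n) (avgDist d) w q r (n * R, n * Rc, Δ)) :
    IsMixture p d (fun v : V × Fin n => w v.1 / n) (fun v => marginal v.2 (q v.1))
      (fun v => marginal v.2 (r v.1)) (R, Rc, Δ) := by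
  have hn' : (0 : ℝ) < n := Nat.cast_pos.2 hn
  have havg {κ : V → (Fin n → X) → ℝ} (hκ : ∀ x, ∑ u, w u * κ u x = iid p n x) (a : X) :
      ∑ v : V × Fin n, w v.1 / n * marginal v.2 (κ v.1) a = p a := by
    rw [sum_prod_fin_div_mul w fun u t => marginal t (κ u) a]
    simp_rw [Finset.mul_sum]
    rw [Finset.sum_comm]
    simp_rw [sum_mul_marginal, hκ, marginal_iid hp]
    simp [hn'.ne']
  have hent {κ : V → (Fin n → X) → ℝ} {C : ℝ} (hκ : ∀ u, κ u ∈ stdSimplex ℝ (Fin n → X))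
      (hC : ∑ u, w u * relEnt (iid p n) (κ u) ≤ n * C) :
      ∑ v : V × Fin n, w v.1 / n * relEnt p (marginal v.2 (κ v.1)) ≤ C := by
    rw [sum_prod_fin_div_mul w fun u t => relEnt p (marginal t (κ u)), div_le_iff₀' hn']
    exact (Finset.sum_le_sum fun u _ => mul_le_mul_of_nonneg_left
      (sum_relEnt_marginal_le hp_pos (hκ u)) (h.w_mem.1 u)).trans hC
  refine ⟨⟨fun v => div_nonneg (h.w_mem.1 _) hn'.le, ?_⟩,
    fun v => marginal_mem_stdSimplex _ (h.q_mem _), fun v => marginal_mem_stdSimplex _ (h.r_mem _),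
    havg h.q_avg, havg h.r_avg, hent h.q_mem h.q_ent,
    hent h.r_mem (h.r_ent.trans_eq (mul_add _ _ _).symm), le_of_eq_of_le ?_ h.dist_le⟩
  · simpa [← Finset.sum_mul, h.w_mem.2, hn'.ne'] using sum_prod_fin_div_mul (n := n) w fun _ _ => 1
  · simp_rw [sum_marginal_mul_marginal_mul]
    rw [sum_prod_fin_div_mul w fun u t => ∑ x, ∑ y, q u x * r u y * d (x t) (y t), Finset.sum_div]
    refine Finset.sum_congr rfl fun u _ => ?_
    rw [mul_div_assoc, Finset.sum_comm, Finset.sum_div]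
    congr! 2 with x
    rw [Finset.sum_comm, Finset.sum_div]
    congr! 1 with y
    rw [← Finset.mul_sum, avgDist, mul_div_assoc, one_div_mul_eq_div]

theorem logb_indexCard_le (hR : 0 ≤ R) : Real.logb 2 (indexCard n R) ≤ n * R := by
  rw [Real.logb_le_iff_le_rpow one_lt_two (Nat.cast_pos.2 (indexCard_pos n hR))]
  exact Nat.floor_le (by positivity)

/-- The joint law of `X_{1:n}` and of the pair `(J, M)` of the indices available to the decoder. -/
def Code.encJoint (c : Code X n R Rc) (p : X → ℝ)
    (u : Fin (indexCard n Rc) × Fin (indexCard n R)) (x : Fin n → X) : ℝ :=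
  iid p n x * (1 / indexCard n Rc) * c.enc x u.1 u.2

theorem Code.sum_encJoint (c : Code X n R Rc) (hRc : 0 ≤ Rc) (p : X → ℝ) (x : Fin n → X) :
    ∑ u, c.encJoint p u x = iid p n x := by
  have hJ : (indexCard n Rc : ℝ) ≠ 0 := Nat.cast_ne_zero.2 (indexCard_pos n hRc).ne'
  simp only [encJoint, Fintype.sum_prod_type, ← Finset.mul_sum, (c.enc_mem _ _).2]
  simp [hJ]

theorem Code.encJoint_nonneg (c : Code X n R Rc) (hp : ∀ x, 0 ≤ p x) (u x) :
    0 ≤ c.encJoint p u x :=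
  mul_nonneg (mul_nonneg (prod_apply_nonneg hp x) (by positivity)) ((c.enc_mem x u.1).1 _)

theorem Code.encJoint_le (c : Code X n R Rc) (hp : ∀ x, 0 ≤ p x) (u x) :
    c.encJoint p u x ≤ 1 / indexCard n Rc * iid p n x := by
  rw [encJoint, mul_comm (1 / _ : ℝ)]
  exact mul_le_of_le_one_right (mul_nonneg (prod_apply_nonneg hp x) (by positivity))
    (apply_le_one_of_mem_stdSimplex (c.enc_mem x u.1) u.2)

theorem Code.inducedXY_eq_sum_encJoint_mul (c : Code X n R Rc) (p : X → ℝ) (x y : Fin n → X) :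
    c.inducedXY p (x, y) = ∑ u, c.encJoint p u x * c.dec u.2 u.1 y := by
  rw [Fintype.sum_prod_type]
  rfl

theorem Code.exists_isMixture_iid [Nonempty X] (c : Code X n R Rc) (hR : 0 ≤ R) (hRc : 0 ≤ Rc)
    (hp : p ∈ stdSimplex ℝ X) (hp_pos : ∀ x, 0 < p x) (d : X → X → ℝ)
    (hY : c.inducedY p = iid p n) :
    ∃ (w : Fin (indexCard n Rc) × Fin (indexCard n R) → ℝ) (q r : _ → (Fin n → X) → ℝ),
      IsMixture (iid p n) (avgDist d) w q r (n * R, n * Rc, distortion p d c) := by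
  have hJ_pos : (0 : ℝ) < indexCard n Rc := Nat.cast_pos.2 (indexCard_pos n hRc)
  have hM_pos : (0 : ℝ) < indexCard n R := Nat.cast_pos.2 (indexCard_pos n hR)
  have hiid_pos (x : Fin n → X) : 0 < iid p n x := Finset.prod_pos fun t _ => hp_pos (x t)
  choose q hq hwq using fun u => exists_mem_stdSimplex_sum_mul_eq (c.encJoint_nonneg hp.1 u)
  set w := fun u => ∑ x, c.encJoint p u x
  set r := fun u : Fin (indexCard n Rc) × Fin (indexCard n R) => c.dec u.2 u.1
  have hr (u) : r u ∈ stdSimplex ℝ (Fin n → X) := c.dec_mem _ _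
  have hw : w ∈ stdSimplex ℝ _ := by
    refine ⟨fun u => Finset.sum_nonneg fun x _ => c.encJoint_nonneg hp.1 u x, ?_⟩
    rw [Finset.sum_comm]
    simp_rw [c.sum_encJoint hRc, (iid_mem_stdSimplex hp n).2]
  have hXY (x y) : c.inducedXY p (x, y) = ∑ u, w u * (q u x * r u y) := by
    simp_rw [c.inducedXY_eq_sum_encJoint_mul, ← mul_assoc, w, hwq, r]
  have hr_avg (y) : ∑ u, w u * r u y = iid p n y := by
    rw [← hY, Code.inducedY]
    simp_rw [hXY]
    rw [Finset.sum_comm]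
    simp_rw [← Finset.mul_sum, ← Finset.sum_mul, (hq _).2, one_mul]
  refine ⟨w, q, r, hw, hq, hr, fun x => ?_, hr_avg, ?_, ?_, ?_⟩
  · simp_rw [w, hwq, c.sum_encJoint hRc]
  · refine (sum_mul_relEnt_le_logb hiid_pos hw hq (b := fun _ => 1 / indexCard n Rc)
      fun u x => ?_).trans ?_
    · exact (hwq u x).trans_le (c.encJoint_le hp.1 u x)
    · have hsum : ∑ u : Fin (indexCard n Rc) × Fin (indexCard n R), (1 / indexCard n Rc : ℝ) =
          indexCard n R := by simp [field]
      exact hsum ▸ logb_indexCard_le hR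
  · refine (sum_mul_relEnt_le_logb hiid_pos hw hr (b := fun _ => 1) fun u x => ?_).trans ?_
    · rw [one_mul, ← hr_avg x]
      exact Finset.single_le_sum (f := fun u => w u * r u x)
        (fun u _ => mul_nonneg (hw.1 u) ((hr u).1 x)) (Finset.mem_univ u)
    · simpa [Real.logb_mul hJ_pos.ne' hM_pos.ne', add_comm] using
        add_le_add (logb_indexCard_le (n := n) hR) (logb_indexCard_le hRc)
  · simp_rw [distortion, expect, Fintype.sum_prod_type (α₁ := Fin n → X), hXY, Finset.sum_mul,
      Finset.mul_sum, mul_assoc]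
    rw [Finset.sum_comm]
    simp_rw [Finset.sum_comm (t := Finset.univ (α := Fin (indexCard n Rc) × Fin (indexCard n R)))]
    exact le_rfl

theorem Code.mem_region_of_inducedY_eq (c : Code X n R Rc) (hn : 0 < n) (hR : 0 ≤ R)
    (hRc : 0 ≤ Rc) (hp : p ∈ stdSimplex ℝ X) (hp_pos : ∀ x, 0 < p x) (d : X → X → ℝ)
    (hY : c.inducedY p = iid p n) : (R, Rc, distortion p d c) ∈ region p d := by
  have : Nonempty X := nonempty_of_mem_stdSimplex hp
  obtain ⟨w, q, r, h⟩ := c.exists_isMixture_iid hR hRc hp hp_pos d hY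
  exact (h.singleLetter hp.2 hp_pos hn).mem_region hp_pos hRc

theorem mem_region_of_achievablePerfect (hp : p ∈ stdSimplex ℝ X) (hp_pos : ∀ x, 0 < p x)
    {d : X → X → ℝ} {R Rc Δ : ℝ} (hR : 0 ≤ R) (hRc : 0 ≤ Rc) (h : AchievablePerfect p d R Rc Δ) :
    (R, Rc, Δ) ∈ region p d := by
  obtain ⟨D, hD, hdD⟩ := exists_distortion_bound d
  have hslack (ε : ℝ) (hε : 0 < ε) : (R + ε, Rc, Δ + ε + ε) ∈ region p d := by
    obtain ⟨c, hc, N, hN⟩ := h ε hε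
    have hdist := eventually_le_of_limsup_le (fun n => distortion_le (c n) hp hRc hD hdD) hc hε
    obtain ⟨n, hn, hnN, hn_pos⟩ :=
      (hdist.and ((eventually_ge_atTop N).and (eventually_gt_atTop 0))).exists
    obtain ⟨s, w, q, r, hmix⟩ := exists_isMixture_of_mem_region hp <|
      (c n).mem_region_of_inducedY_eq hn_pos (by linarith) hRc hp hp_pos d (hN n hnN)
    exact (hmix.mono le_rfl hn).mem_region hp_pos hRc
  have hcont : Continuous fun ε : ℝ => (R + ε, Rc, Δ + ε + ε) := by fun_prop
  have hlim : Tendsto (fun ε : ℝ => (R + ε, Rc, Δ + ε + ε)) (𝓝[>] 0) (𝓝 (R, Rc, Δ)) :=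
    (hcont.tendsto' 0 _ (by simp)).mono_left nhdsWithin_le_nhds
  exact (isClosed_region hp hp_pos d).mem_of_tendsto hlim
    (eventually_nhdsWithin_of_forall hslack)

end Converse

/-! ### Soft covering -/

section SoftCovering

variable {ι α β : Type*} [Fintype ι] [DecidableEq ι] [Fintype α] {w f : α → ℝ} {s : Finset ι}

theorem mean_abs_sub_mean_le_two_mul (hw : w ∈ stdSimplex ℝ α) (hf : ∀ a, 0 ≤ f a)
    (hs : s.Nonempty) :
    ∑ c : ι → α, (∏ i, w (c i)) * |(1 / (s.card : ℝ)) * ∑ i ∈ s, f (c i) - ∑ a, w a * f a| ≤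
      2 * ∑ a, w a * f a := by
  have hcard : (s.card : ℝ) ≠ 0 := by exact_mod_cast hs.card_ne_zero
  set μ := ∑ a, w a * f a
  have hμ : 0 ≤ μ := Finset.sum_nonneg fun a _ => mul_nonneg (hw.1 a) (hf a)
  have habs (c : ι → α) : |(1 / (s.card : ℝ)) * ∑ i ∈ s, f (c i) - μ| ≤
      (1 / (s.card : ℝ)) * ∑ i ∈ s, f (c i) + μ := by
    have hmean : 0 ≤ (1 / (s.card : ℝ)) * ∑ i ∈ s, f (c i) :=
      mul_nonneg (by positivity) (Finset.sum_nonneg fun i _ => hf _)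
    rw [abs_le]
    constructor <;> linarith
  calc ∑ c : ι → α, (∏ i, w (c i)) * |(1 / (s.card : ℝ)) * ∑ i ∈ s, f (c i) - μ|
      ≤ ∑ c : ι → α, (∏ i, w (c i)) * ((1 / (s.card : ℝ)) * ∑ i ∈ s, f (c i) + μ) :=
        Finset.sum_le_sum fun c _ => mul_le_mul_of_nonneg_left (habs c) (prod_apply_nonneg hw.1 c)
    _ = (1 / (s.card : ℝ)) * (s.card * μ) + 1 * μ := by
        simp_rw [mul_add, mul_left_comm _ (1 / (s.card : ℝ))]
        rw [Finset.sum_add_distrib, ← Finset.mul_sum, ← Finset.sum_mul, sum_prod_mul_sum hw.2,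
          (prod_apply_mem_stdSimplex hw).2]
    _ = 2 * μ := by field_simp; ring

theorem mean_abs_sub_mean_le_truncate (hw : w ∈ stdSimplex ℝ α) (hf : ∀ a, 0 ≤ f a) {τ : ℝ}
    (hτ : 0 ≤ τ) (hs : s.Nonempty) :
    ∑ c : ι → α, (∏ i, w (c i)) * |(1 / (s.card : ℝ)) * ∑ i ∈ s, f (c i) - ∑ a, w a * f a| ≤
      2 * ∑ a, w a * (if τ < f a then f a else 0) + √(τ * (∑ a, w a * f a) / s.card) := by
  set large : α → ℝ := fun a => if τ < f a then f a else 0 with hlarge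
  set small : α → ℝ := fun a => if τ < f a then 0 else f a with hsmall
  have hsplit (a) : f a = large a + small a := by
    simp only [hlarge, hsmall]; split_ifs <;> simp
  have hlarge_nonneg (a) : 0 ≤ large a := by
    simp only [hlarge]; split_ifs <;> simp [hf a]
  have hsmall_sq (a) : small a ^ 2 ≤ τ * f a := by
    simp only [hsmall]
    split_ifs with h
    · simpa using mul_nonneg hτ (hf a)
    · rw [sq]
      exact mul_le_mul_of_nonneg_right (not_lt.1 h) (hf a)
  have hsecond : ∑ a, w a * small a ^ 2 ≤ τ * ∑ a, w a * f a := by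
    rw [Finset.mul_sum]
    refine Finset.sum_le_sum fun a _ => ?_
    rw [mul_left_comm]
    exact mul_le_mul_of_nonneg_left (hsmall_sq a) (hw.1 a)
  have habs (c : ι → α) : |(1 / (s.card : ℝ)) * ∑ i ∈ s, f (c i) - ∑ a, w a * f a| ≤
      |(1 / (s.card : ℝ)) * ∑ i ∈ s, large (c i) - ∑ a, w a * large a| +
        |(1 / (s.card : ℝ)) * ∑ i ∈ s, small (c i) - ∑ a, w a * small a| := by
    have hsum : ∑ i ∈ s, f (c i) = ∑ i ∈ s, large (c i) + ∑ i ∈ s, small (c i) := by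
      rw [← Finset.sum_add_distrib]
      exact Finset.sum_congr rfl fun i _ => hsplit _
    have hmean : ∑ a, w a * f a = ∑ a, w a * large a + ∑ a, w a * small a := by
      rw [← Finset.sum_add_distrib]
      exact Finset.sum_congr rfl fun a _ => by rw [hsplit, mul_add]
    rw [hsum, hmean, mul_add, add_sub_add_comm]
    exact abs_add_le _ _
  refine (Finset.sum_le_sum fun c _ =>
    mul_le_mul_of_nonneg_left (habs c) (prod_apply_nonneg hw.1 c)).trans ?_
  simp only [mul_add, Finset.sum_add_distrib]
  exact add_le_add (mean_abs_sub_mean_le_two_mul hw hlarge_nonneg hs)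
    ((mean_abs_sub_mean_le hw small hs).trans (Real.sqrt_le_sqrt
      (div_le_div_of_nonneg_right hsecond s.card.cast_nonneg)))

theorem soft_covering [Fintype β] (hw : w ∈ stdSimplex ℝ α) {K : α → β → ℝ}
    (hK : ∀ a b, 0 ≤ K a b) {o : β → ℝ} (ho : o ∈ stdSimplex ℝ β)
    (hKo : ∀ b, ∑ a, w a * K a b = o b) {T : ℝ} (hT : 0 ≤ T) (hs : s.Nonempty) :
    ∑ c : ι → α, (∏ i, w (c i)) * ∑ b, |(1 / (s.card : ℝ)) * ∑ i ∈ s, K (c i) b - o b| ≤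
      2 * ∑ a, ∑ b, w a * (if T * o b < K a b then K a b else 0) + √(T / s.card) := by
  have hpoint (b) : ∑ c : ι → α, (∏ i, w (c i)) *
      |(1 / (s.card : ℝ)) * ∑ i ∈ s, K (c i) b - o b| ≤
        2 * ∑ a, w a * (if T * o b < K a b then K a b else 0) + o b * √(T / s.card) := by
    have h := mean_abs_sub_mean_le_truncate hw (fun a => hK a b) (mul_nonneg hT (ho.1 b)) hs
    rwa [hKo, show T * o b * o b / s.card = o b ^ 2 * (T / s.card) by ring,
      Real.sqrt_mul (sq_nonneg _), Real.sqrt_sq (ho.1 b)] at h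
  calc ∑ c : ι → α, (∏ i, w (c i)) * ∑ b, |(1 / (s.card : ℝ)) * ∑ i ∈ s, K (c i) b - o b|
      = ∑ b, ∑ c : ι → α, (∏ i, w (c i)) *
          |(1 / (s.card : ℝ)) * ∑ i ∈ s, K (c i) b - o b| := by
        simp only [Finset.mul_sum]
        exact Finset.sum_comm
    _ ≤ ∑ b, (2 * ∑ a, w a * (if T * o b < K a b then K a b else 0) + o b * √(T / s.card)) :=
        Finset.sum_le_sum fun b _ => hpoint b
    _ = _ := by
        rw [Finset.sum_add_distrib, ← Finset.sum_mul, ho.2, one_mul, ← Finset.mul_sum,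
          Finset.sum_comm]

end SoftCovering

section Iid

variable {X V : Type*} {p : X → ℝ} {w : V → ℝ} {k : V → X → ℝ} {n : ℕ}

/-- The `n`-fold product of the kernel `k`: the law of the output word when the channel `k` is
applied letter by letter. -/
def prodKernel (k : V → X → ℝ) {n : ℕ} (a : Fin n → V) (b : Fin n → X) : ℝ := ∏ t, k (a t) (b t)

theorem prodKernel_mem_stdSimplex [Fintype X] (hk : ∀ v, k v ∈ stdSimplex ℝ X) (a : Fin n → V) :
    prodKernel k a ∈ stdSimplex ℝ (Fin n → X) := by
  refine ⟨fun b => Finset.prod_nonneg fun t _ => (hk _).1 _, ?_⟩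
  simp only [prodKernel]
  rw [← Fintype.prod_sum fun t x => k (a t) x]
  simp only [(hk _).2, Finset.prod_const_one]

theorem sum_iid_mul_prodKernel [Fintype V] (havg : ∀ x, ∑ v, w v * k v x = p x) (b : Fin n → X) :
    ∑ a, iid w n a * prodKernel k a b = iid p n b := by
  simp only [iid, prodKernel, ← Finset.prod_mul_distrib]
  rw [← Fintype.prod_sum fun t v => w v * k v (b t)]
  simp only [havg]

theorem lt_sum_logb_of_rpow_mul_iid_lt (hp_pos : ∀ x, 0 < p x) {c : ℝ} {a : Fin n → V}
    {b : Fin n → X} (h : (2 : ℝ) ^ c * iid p n b < prodKernel k a b) :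
    c < ∑ t, Real.logb 2 (k (a t) (b t) / p (b t)) := by
  have hiid : 0 < iid p n b := Finset.prod_pos fun _ _ => hp_pos _
  have hprod : 0 < prodKernel k a b := lt_trans (by positivity) h
  have hne (t) : k (a t) (b t) / p (b t) ≠ 0 :=
    div_ne_zero (Finset.prod_ne_zero_iff.1 hprod.ne' t (Finset.mem_univ t)) (hp_pos _).ne'
  rw [← Real.logb_prod _ _ fun t _ => hne t, Finset.prod_div_distrib]
  exact (Real.lt_logb_iff_rpow_lt one_lt_two (div_pos hprod hiid)).2 ((lt_div_iff₀ hiid).2 h)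

variable [Fintype X] [Fintype V]

theorem exists_prob_atypical_le (hp_pos : ∀ x, 0 < p x) (hw : w ∈ stdSimplex ℝ V)
    (hk : ∀ v, k v ∈ stdSimplex ℝ X) {γ : ℝ} (hγ : 0 < γ) :
    ∃ C : ℝ, 0 ≤ C ∧ ∀ n : ℕ, 1 ≤ n →
      ∑ a, ∑ b, iid w n a *
        (if (2 : ℝ) ^ ((n : ℝ) * (∑ v, w v * relEnt p (k v) + γ)) * iid p n b < prodKernel k a b
          then prodKernel k a b else 0) ≤ C / √n := by
  set I := ∑ v, w v * relEnt p (k v) with hI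
  set P : V × X → ℝ := fun z => w z.1 * k z.1 z.2 with hP
  set density : V × X → ℝ := fun z => Real.logb 2 (k z.1 z.2 / p z.2) with hdensity
  have hmean : ∑ z, P z * density z = I := by
    simp only [hP, hdensity, hI, relEnt, Fintype.sum_prod_type, Finset.mul_sum, mul_assoc]
  refine ⟨√(∑ z, P z * density z ^ 2) / γ, by positivity, fun n hn => ?_⟩
  have hn0 : (0 : ℝ) < n := by exact_mod_cast hn
  have : Nonempty (Fin n) := ⟨⟨0, hn⟩⟩
  have hcheb := prob_le_abs_sub_mean_le (ι := Fin n) (mul_kernel_mem_stdSimplex hw hk) density hγ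
    (fun z => (2 : ℝ) ^ ((n : ℝ) * (I + γ)) * iid p n (fun t => (z t).2) <
      prodKernel k (fun t => (z t).1) (fun t => (z t).2)) fun z hz => by
        have hlt := lt_sum_logb_of_rpow_mul_iid_lt hp_pos hz
        rw [hmean, Fintype.card_fin]
        refine le_trans ?_ (le_abs_self _)
        rw [one_div, inv_mul_eq_div, le_sub_iff_add_le, le_div_iff₀ hn0]
        linarith
  rw [Fintype.card_fin, Real.sqrt_div' _ hn0.le, div_right_comm] at hcheb
  refine le_trans (le_of_eq ?_) hcheb
  rw [← (Equiv.arrowProdEquivProdArrow (Fin n) (fun _ => V) (fun _ => X)).symm.sum_comp,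
    Fintype.sum_prod_type]
  refine Finset.sum_congr rfl fun a _ => Finset.sum_congr rfl fun b _ => ?_
  have hweight : iid w n a * prodKernel k a b = ∏ t, w (a t) * k (a t) (b t) :=
    Finset.prod_mul_distrib.symm
  rw [← mul_boole _ (prodKernel k a b), ← mul_assoc, hweight]
  rfl

theorem iid_soft_covering (hp : p ∈ stdSimplex ℝ X) (hp_pos : ∀ x, 0 < p x)
    (hw : w ∈ stdSimplex ℝ V) (hk : ∀ v, k v ∈ stdSimplex ℝ X)
    (havg : ∀ x, ∑ v, w v * k v x = p x) {I : ℝ} (hI : ∑ v, w v * relEnt p (k v) ≤ I)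
    {γ : ℝ} (hγ : 0 < γ) :
    ∃ C : ℝ, 0 ≤ C ∧ ∀ (n : ℕ), 1 ≤ n → ∀ (ι : Type) [Fintype ι] [DecidableEq ι] (s : Finset ι),
      s.Nonempty → ∑ c : ι → Fin n → V, (∏ i, iid w n (c i)) *
        ∑ b, |(1 / (s.card : ℝ)) * ∑ i ∈ s, prodKernel k (c i) b - iid p n b| ≤
      C / √n + √((2 : ℝ) ^ ((n : ℝ) * (I + γ)) / s.card) := by
  obtain ⟨C, hC, hatyp⟩ := exists_prob_atypical_le hp_pos hw hk hγ
  refine ⟨2 * C, by positivity, fun n hn ι _ _ s hs => ?_⟩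
  refine (soft_covering (iid_mem_stdSimplex hw n)
    (fun a b => (prodKernel_mem_stdSimplex hk a).1 b) (iid_mem_stdSimplex hp n)
    (sum_iid_mul_prodKernel havg)
    (T := (2 : ℝ) ^ ((n : ℝ) * (∑ v, w v * relEnt p (k v) + γ))) (by positivity) hs).trans ?_
  rw [mul_div_assoc]
  gcongr
  · exact hatyp n hn
  · exact one_le_two

end Iid

/-! ### The likelihood encoder -/

section Likelihood

variable {ι X : Type*} [Fintype ι] [Fintype X] {p : X → ℝ} {d : X → X → ℝ} {n : ℕ} {R Rc : ℝ}

/-- The law of `(x, y)` when an index `i` is drawn uniformly and then `x` and `y` are drawn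
independently from the laws `kq i` and `kr i`. A codebook with the likelihood encoder is designed
to imitate it. -/
def idealJoint (kq kr : ι → (Fin n → X) → ℝ) (x y : Fin n → X) : ℝ :=
  (1 / (Fintype.card ι : ℝ)) * ∑ i, kq i x * kr i y

/-- The expected distortion under `idealJoint kq kr`. -/
def idealDistortion (d : X → X → ℝ) (kq kr : ι → (Fin n → X) → ℝ) : ℝ :=
  (1 / (Fintype.card ι : ℝ)) * ∑ i, ∑ x, ∑ y, kq i x * kr i y * avgDist d x y

/-- The `ℓ¹` distance between `p^{⊗ n}` and the uniform mixture of the laws `kr i`. -/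
def outputGap (p : X → ℝ) (kr : ι → (Fin n → X) → ℝ) : ℝ :=
  ∑ y, |(1 / (Fintype.card ι : ℝ)) * ∑ i, kr i y - iid p n y|

/-- The `ℓ¹` distance between `p^{⊗ n}` and the uniform mixture of the laws `kq (m, j)` over the
messages `m`, averaged over the common randomness `j`. -/
def sourceGap (p : X → ℝ)
    (kq : Fin (indexCard n R) × Fin (indexCard n Rc) → (Fin n → X) → ℝ) : ℝ :=
  (1 / (indexCard n Rc : ℝ)) * ∑ j, ∑ x,
    |(1 / (indexCard n R : ℝ)) * ∑ m, kq (m, j) x - iid p n x|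

theorem sum_idealJoint_mul_avgDist (kq kr : ι → (Fin n → X) → ℝ) :
    ∑ x, ∑ y, idealJoint kq kr x y * avgDist d x y = idealDistortion d kq kr := by
  simp only [idealJoint, idealDistortion, mul_assoc, ← Finset.mul_sum, Finset.sum_mul]
  rw [Finset.sum_congr rfl fun x _ => Finset.sum_comm, Finset.sum_comm]
  simp only [Finset.mul_sum]

theorem sum_fst_idealJoint {kq kr : ι → (Fin n → X) → ℝ}
    (hq : ∀ i, kq i ∈ stdSimplex ℝ (Fin n → X)) (y : Fin n → X) :
    ∑ x, idealJoint kq kr x y = (1 / (Fintype.card ι : ℝ)) * ∑ i, kr i y := by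
  simp only [idealJoint, ← Finset.mul_sum]
  rw [Finset.sum_comm]
  simp only [← Finset.sum_mul, (hq _).2, one_mul]

theorem distortion_le_add (c : Code X n R Rc) (p : X → ℝ) (hd : ∀ x y, 0 ≤ d x y) {D : ℝ}
    (hD : 0 ≤ D) (hdD : ∀ x y, d x y ≤ D) (Q : (Fin n → X) → (Fin n → X) → ℝ) :
    distortion p d c ≤ ∑ x, ∑ y, Q x y * avgDist d x y +
      D * ∑ x, ∑ y, |c.inducedXY p (x, y) - Q x y| := by
  rw [distortion, expect, Fintype.sum_prod_type]
  simp only [Finset.mul_sum, ← Finset.sum_add_distrib]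
  refine Finset.sum_le_sum fun x _ => Finset.sum_le_sum fun y _ => ?_
  rw [← sub_le_iff_le_add', ← sub_mul, mul_comm D]
  exact (mul_le_mul_of_nonneg_right (le_abs_self _) (avgDist_nonneg hd x y)).trans
    (mul_le_mul_of_nonneg_left (avgDist_le hD hdD x y) (abs_nonneg _))

theorem tvDist_inducedY_le (c : Code X n R Rc) (p : X → ℝ) (Q : (Fin n → X) → (Fin n → X) → ℝ)
    (o : (Fin n → X) → ℝ) :
    tvDist (c.inducedY p) o ≤
      (1 / 2) * (∑ x, ∑ y, |c.inducedXY p (x, y) - Q x y| + ∑ y, |∑ x, Q x y - o y|) := by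
  refine mul_le_mul_of_nonneg_left ?_ (by norm_num)
  rw [Finset.sum_comm, ← Finset.sum_add_distrib]
  refine Finset.sum_le_sum fun y _ => (abs_sub_le _ (∑ x, Q x y) _).trans ?_
  rw [Code.inducedY, ← Finset.sum_sub_distrib]
  gcongr
  exact Finset.abs_sum_le_sum_abs _ _

variable {kq kr : Fin (indexCard n R) × Fin (indexCard n Rc) → (Fin n → X) → ℝ}

theorem exists_code_dec_eq_sum_mul_enc_eq (hR : 0 ≤ R) (hq : ∀ i x, 0 ≤ kq i x)
    (hr : ∀ i, kr i ∈ stdSimplex ℝ (Fin n → X)) :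
    ∃ c : Code X n R Rc, (∀ m j, c.dec m j = kr (m, j)) ∧
      ∀ x j m, (∑ m', kq (m', j) x) * c.enc x j m = kq (m, j) x := by
  have : Nonempty (Fin (indexCard n R)) := ⟨⟨0, indexCard_pos n hR⟩⟩
  choose enc henc hmul using fun (x : Fin n → X) (j : Fin (indexCard n Rc)) =>
    exists_mem_stdSimplex_sum_mul_eq (f := fun m => kq (m, j) x) fun m => hq _ x
  exact ⟨⟨enc, fun m j => kr (m, j), henc, fun m j => hr (m, j)⟩, fun _ _ => rfl, hmul⟩

theorem Code.nonempty (hR : 0 ≤ R) (hp : p ∈ stdSimplex ℝ X) : Nonempty (Code X n R Rc) :=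
  ⟨(exists_code_dec_eq_sum_mul_enc_eq hR (fun _ => (iid_mem_stdSimplex hp n).1)
    fun _ => iid_mem_stdSimplex hp n).choose⟩

/- Under the ideal joint law the message has conditional law `c.enc` given `(x, j)`, so the two
joint laws differ only in the law of the source word given `j`. -/
theorem sum_abs_inducedXY_sub_idealJoint_le (c : Code X n R Rc) (p : X → ℝ)
    (hdec : ∀ m j, c.dec m j = kr (m, j))
    (henc : ∀ x j m, (∑ m', kq (m', j) x) * c.enc x j m = kq (m, j) x) :
    ∑ x, ∑ y, |c.inducedXY p (x, y) - idealJoint kq kr x y| ≤ sourceGap p kq := by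
  set M : ℝ := (indexCard n R : ℝ) with hM
  set J : ℝ := (indexCard n Rc : ℝ) with hJ
  set mean := fun j x => 1 / M * ∑ m, kq (m, j) x with hmean
  have hcell (x y j m) : iid p n x * (1 / J) * c.enc x j m * c.dec m j y -
      1 / (M * J) * (kq (m, j) x * kr (m, j) y) =
        1 / J * (iid p n x - mean j x) * (c.enc x j m * c.dec m j y) := by
    simp only [hmean]
    rw [← henc x j m, hdec]
    ring
  have habs (x y) : |c.inducedXY p (x, y) - idealJoint kq kr x y| ≤
      ∑ j, ∑ m, 1 / J * |mean j x - iid p n x| * (c.enc x j m * c.dec m j y) := by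
    simp only [Code.inducedXY, Code.induced, idealJoint, Fintype.card_prod, Fintype.card_fin,
      Nat.cast_mul, Fintype.sum_prod_type_right, Finset.mul_sum, ← hM, ← hJ,
      ← Finset.sum_sub_distrib, hcell]
    refine (Finset.abs_sum_le_sum_abs _ _).trans (Finset.sum_le_sum fun j _ =>
      (Finset.abs_sum_le_sum_abs _ _).trans (Finset.sum_le_sum fun m _ => ?_))
    rw [abs_mul, abs_mul, abs_sub_comm, abs_of_nonneg (show 0 ≤ 1 / J by positivity),
      abs_of_nonneg (mul_nonneg ((c.enc_mem x j).1 m) ((c.dec_mem m j).1 y))]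
  have hrow (x) : ∑ y, |c.inducedXY p (x, y) - idealJoint kq kr x y| ≤
      ∑ j, 1 / J * |mean j x - iid p n x| := by
    refine (Finset.sum_le_sum fun y _ => habs x y).trans_eq ?_
    rw [Finset.sum_comm]
    refine Finset.sum_congr rfl fun j _ => ?_
    rw [Finset.sum_comm]
    simp only [← Finset.mul_sum, (c.dec_mem _ _).2, (c.enc_mem _ _).2, mul_one]
  refine (Finset.sum_le_sum fun x _ => hrow x).trans_eq ?_
  rw [Finset.sum_comm]
  simp only [← Finset.mul_sum]
  rfl

theorem exists_likelihood_code (hR : 0 ≤ R) (p : X → ℝ) (hd : ∀ x y, 0 ≤ d x y) {D : ℝ}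
    (hD : 0 ≤ D) (hdD : ∀ x y, d x y ≤ D) (hq : ∀ i, kq i ∈ stdSimplex ℝ (Fin n → X))
    (hr : ∀ i, kr i ∈ stdSimplex ℝ (Fin n → X)) :
    ∃ c : Code X n R Rc,
      distortion p d c ≤ idealDistortion d kq kr + D * sourceGap p kq ∧
      tvDist (c.inducedY p) (iid p n) ≤ (1 / 2) * (sourceGap p kq + outputGap p kr) := by
  obtain ⟨c, hdec, henc⟩ := exists_code_dec_eq_sum_mul_enc_eq hR (fun i => (hq i).1) hr
  have hgap := sum_abs_inducedXY_sub_idealJoint_le c p hdec henc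
  refine ⟨c, ?_, ?_⟩
  · rw [← sum_idealJoint_mul_avgDist]
    exact (distortion_le_add c p hd hD hdD _).trans (by gcongr)
  · refine (tvDist_inducedY_le c p (idealJoint kq kr) _).trans ?_
    simp only [sum_fst_idealJoint hq]
    exact mul_le_mul_of_nonneg_left (add_le_add hgap le_rfl) (by norm_num)

end Likelihood

/-! ### Random coding -/

/- Markov's inequality for `f + g / √a`, whose mean is at most `b + √a`. -/
theorem exists_le_and_le_of_sum_mul_le {α : Type*} [Fintype α] {w f g : α → ℝ} {a b : ℝ}
    (hw : w ∈ stdSimplex ℝ α) (hf : ∀ x, 0 ≤ f x) (hg : ∀ x, 0 ≤ g x) (ha : 0 < a)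
    (hfb : ∑ x, w x * f x ≤ b) (hga : ∑ x, w x * g x ≤ a) :
    ∃ x, f x ≤ b + √a ∧ g x ≤ √a * (b + √a) := by
  have hsqrt : 0 < √a := Real.sqrt_pos.2 ha
  obtain ⟨x, hx⟩ := exists_le_of_sum_mul_le hw (f := fun x => f x + g x / √a) (b := b + √a) <| by
    simp only [mul_add, ← mul_div_assoc, Finset.sum_add_distrib, ← Finset.sum_div]
    refine add_le_add hfb ?_
    rwa [div_le_iff₀ hsqrt, Real.mul_self_sqrt ha.le]
  have hgx : 0 ≤ g x / √a := div_nonneg (hg x) hsqrt.le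
  refine ⟨x, by linarith, ?_⟩
  rw [mul_comm, ← div_le_iff₀ hsqrt]
  linarith [hf x]

section ProdKernel

variable {X V : Type*} [Fintype X] {n : ℕ}

theorem sum_prodKernel_mul_apply {k : V → X → ℝ} (hk : ∀ v, k v ∈ stdSimplex ℝ X)
    (a : Fin n → V) (t : Fin n) (f : X → ℝ) :
    ∑ x, prodKernel k a x * f (x t) = ∑ x, k (a t) x * f x := by
  have hfactor (x : Fin n → X) : prodKernel k a x * f (x t) =
      ∏ i, k (a i) (x i) * (if i = t then f (x i) else 1) := by
    rw [Finset.prod_mul_distrib]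
    simp [prodKernel]
  have hcoord (i) : ∑ x, k (a i) x * (if i = t then f x else 1) =
      if i = t then ∑ x, k (a t) x * f x else 1 := by
    by_cases hi : i = t
    · subst hi; simp
    · simp [hi, (hk _).2]
  rw [Finset.sum_congr rfl fun x _ => hfactor x,
    ← Fintype.prod_sum fun i x => k (a i) x * (if i = t then f x else 1),
    Finset.prod_congr rfl fun i _ => hcoord i]
  simp

variable {q r : V → X → ℝ}

theorem sum_prodKernel_mul_avgDist (hq : ∀ v, q v ∈ stdSimplex ℝ X)
    (hr : ∀ v, r v ∈ stdSimplex ℝ X) (d : X → X → ℝ) (a : Fin n → V) :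
    ∑ x, ∑ y, prodKernel q a x * prodKernel r a y * avgDist d x y =
      (1 / (n : ℝ)) * ∑ t, ∑ x, ∑ y, q (a t) x * r (a t) y * d x y := by
  have hletter (t) : ∑ x, ∑ y, prodKernel q a x * prodKernel r a y * d (x t) (y t) =
      ∑ x, ∑ y, q (a t) x * r (a t) y * d x y := by
    simp only [mul_assoc, ← Finset.mul_sum]
    rw [← sum_prodKernel_mul_apply hq a t fun x => ∑ y, r (a t) y * d x y]
    simp only [sum_prodKernel_mul_apply hr a t]
  simp_rw [← hletter, avgDist, mul_left_comm _ (1 / (n : ℝ)), ← Finset.mul_sum]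
  congr 1
  simp_rw [Finset.mul_sum]
  rw [Finset.sum_comm (s := (Finset.univ : Finset (Fin n)))]
  exact Finset.sum_congr rfl fun x _ => Finset.sum_comm

theorem sum_iid_mul_avgDist [Fintype V] {w : V → ℝ} (hw : w ∈ stdSimplex ℝ V)
    (hq : ∀ v, q v ∈ stdSimplex ℝ X) (hr : ∀ v, r v ∈ stdSimplex ℝ X) (d : X → X → ℝ)
    (hn : n ≠ 0) :
    ∑ a, iid w n a * (∑ x, ∑ y, prodKernel q a x * prodKernel r a y * avgDist d x y) =
      ∑ v, w v * ∑ x, ∑ y, q v x * r v y * d x y := by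
  have hn0 : (n : ℝ) ≠ 0 := by exact_mod_cast hn
  have hsum := sum_prod_mul_sum (ι := Fin n) hw.2
    (fun v => ∑ x, ∑ y, q v x * r v y * d x y) Finset.univ
  simp only [sum_prodKernel_mul_avgDist hq hr, mul_left_comm _ (1 / (n : ℝ)), ← Finset.mul_sum]
  rw [Finset.card_fin] at hsum
  simp only [iid]
  rw [hsum, ← mul_assoc, one_div_mul_cancel hn0, one_mul]

end ProdKernel

section RandomCoding

variable {X V : Type*} [Fintype X] [Fintype V] {p : X → ℝ} {d : X → X → ℝ} {w : V → ℝ}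
  {q r k : V → X → ℝ} {t : ℝ × ℝ × ℝ} {n : ℕ} {R Rc : ℝ}

theorem rpow_div_indexCard_le (n : ℕ) (hR : 0 ≤ R) (S : ℝ) :
    (2 : ℝ) ^ ((n : ℝ) * S) / indexCard n R ≤ 2 * (2 : ℝ) ^ ((n : ℝ) * (S - R)) := by
  have hpos : (1 : ℝ) ≤ indexCard n R := by exact_mod_cast indexCard_pos n hR
  have hfloor : (2 : ℝ) ^ ((n : ℝ) * R) ≤ 2 * indexCard n R := by
    have := Nat.lt_floor_add_one ((2 : ℝ) ^ ((n : ℝ) * R))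
    rw [indexCard] at *
    linarith
  rw [div_le_iff₀ (by linarith)]
  calc (2 : ℝ) ^ ((n : ℝ) * S) = (2 : ℝ) ^ ((n : ℝ) * (S - R)) * (2 : ℝ) ^ ((n : ℝ) * R) := by
        rw [← Real.rpow_add two_pos, ← mul_add, sub_add_cancel]
    _ ≤ (2 : ℝ) ^ ((n : ℝ) * (S - R)) * (2 * indexCard n R) := by gcongr
    _ = 2 * (2 : ℝ) ^ ((n : ℝ) * (S - R)) * indexCard n R := by ring

theorem exists_mean_sourceGap_le (hp : p ∈ stdSimplex ℝ X) (hp_pos : ∀ x, 0 < p x)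
    (hw : w ∈ stdSimplex ℝ V) (hk : ∀ v, k v ∈ stdSimplex ℝ X)
    (havg : ∀ x, ∑ v, w v * k v x = p x) {I : ℝ} (hI : ∑ v, w v * relEnt p (k v) ≤ I)
    {γ : ℝ} (hγ : 0 < γ) (hR : 0 ≤ R) (hRc : 0 ≤ Rc) :
    ∃ C : ℝ, 0 ≤ C ∧ ∀ n : ℕ, 1 ≤ n →
      ∑ c : Fin (indexCard n R) × Fin (indexCard n Rc) → Fin n → V, (∏ i, iid w n (c i)) *
        sourceGap p (fun i => prodKernel k (c i)) ≤
      C / √n + √(2 * (2 : ℝ) ^ ((n : ℝ) * (I + γ - R))) := by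
  obtain ⟨C, hC, hcov⟩ := iid_soft_covering hp hp_pos hw hk havg hI hγ
  refine ⟨C, hC, fun n hn => ?_⟩
  have hM : Nonempty (Fin (indexCard n R)) := ⟨⟨0, indexCard_pos n hR⟩⟩
  have hJ : (indexCard n Rc : ℝ) ≠ 0 := by exact_mod_cast (indexCard_pos n hRc).ne'
  set bound := C / √n + √(2 * (2 : ℝ) ^ ((n : ℝ) * (I + γ - R)))
  have hrow (j : Fin (indexCard n Rc)) :
      ∑ c : Fin (indexCard n R) × Fin (indexCard n Rc) → Fin n → V, (∏ i, iid w n (c i)) *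
        ∑ x, |(1 / (indexCard n R : ℝ)) * ∑ m, prodKernel k (c (m, j)) x - iid p n x| ≤ bound := by
    have h := hcov n hn (Fin (indexCard n R) × Fin (indexCard n Rc)) (Finset.univ ×ˢ {j})
      (Finset.univ_nonempty.product (Finset.singleton_nonempty j))
    simp only [Finset.card_product, Finset.card_fin, Finset.card_singleton, mul_one,
      Finset.sum_product, Finset.sum_singleton] at h
    exact h.trans (add_le_add_right (Real.sqrt_le_sqrt (rpow_div_indexCard_le n hR _)) _)
  simp only [sourceGap, mul_left_comm _ (1 / (indexCard n Rc : ℝ)), ← Finset.mul_sum]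
  simp only [Finset.mul_sum (Finset.univ : Finset (Fin (indexCard n Rc)))]
  rw [Finset.sum_comm]
  calc _ ≤ (1 / (indexCard n Rc : ℝ)) * ∑ _j : Fin (indexCard n Rc), bound := by
        gcongr with j
        exact hrow j
    _ = bound := by
        rw [Finset.sum_const, Finset.card_fin, nsmul_eq_mul, ← mul_assoc, one_div_mul_cancel hJ,
          one_mul]

theorem exists_mean_outputGap_le (hp : p ∈ stdSimplex ℝ X) (hp_pos : ∀ x, 0 < p x)
    (hw : w ∈ stdSimplex ℝ V) (hk : ∀ v, k v ∈ stdSimplex ℝ X)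
    (havg : ∀ x, ∑ v, w v * k v x = p x) {I : ℝ} (hI : ∑ v, w v * relEnt p (k v) ≤ I)
    {γ : ℝ} (hγ : 0 < γ) (hR : 0 ≤ R) (hRc : 0 ≤ Rc) :
    ∃ C : ℝ, 0 ≤ C ∧ ∀ n : ℕ, 1 ≤ n →
      ∑ c : Fin (indexCard n R) × Fin (indexCard n Rc) → Fin n → V, (∏ i, iid w n (c i)) *
        outputGap p (fun i => prodKernel k (c i)) ≤
      C / √n + √(4 * (2 : ℝ) ^ ((n : ℝ) * (I + γ - (R + Rc)))) := by
  obtain ⟨C, hC, hcov⟩ := iid_soft_covering hp hp_pos hw hk havg hI hγ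
  refine ⟨C, hC, fun n hn => ?_⟩
  have hM : Nonempty (Fin (indexCard n R)) := ⟨⟨0, indexCard_pos n hR⟩⟩
  have hJ : Nonempty (Fin (indexCard n Rc)) := ⟨⟨0, indexCard_pos n hRc⟩⟩
  have hcard : (2 : ℝ) ^ ((n : ℝ) * (I + γ)) / (indexCard n R * indexCard n Rc) ≤
      4 * (2 : ℝ) ^ ((n : ℝ) * (I + γ - (R + Rc))) := by
    calc (2 : ℝ) ^ ((n : ℝ) * (I + γ)) / (indexCard n R * indexCard n Rc)
        = (2 : ℝ) ^ ((n : ℝ) * (I + γ)) / indexCard n R / indexCard n Rc := by rw [div_div]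
      _ ≤ 2 * (2 : ℝ) ^ ((n : ℝ) * (I + γ - R)) / indexCard n Rc := by
          gcongr
          exact rpow_div_indexCard_le n hR _
      _ = 2 * ((2 : ℝ) ^ ((n : ℝ) * (I + γ - R)) / indexCard n Rc) := mul_div_assoc _ _ _
      _ ≤ 2 * (2 * (2 : ℝ) ^ ((n : ℝ) * (I + γ - R - Rc))) := by
          gcongr
          exact rpow_div_indexCard_le n hRc _
      _ = 4 * (2 : ℝ) ^ ((n : ℝ) * (I + γ - (R + Rc))) := by rw [sub_sub]; ring
  have h := hcov n hn (Fin (indexCard n R) × Fin (indexCard n Rc)) Finset.univ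
    Finset.univ_nonempty
  simp only [Finset.card_univ, Fintype.card_prod, Fintype.card_fin, Nat.cast_mul] at h
  simp only [outputGap, Fintype.card_prod, Fintype.card_fin, Nat.cast_mul]
  exact h.trans (by gcongr)

theorem IsMixture.mean_idealDistortion_le {ι : Type*} [Fintype ι] [DecidableEq ι] [Nonempty ι]
    (h : IsMixture p d w q r t) (hn : n ≠ 0) :
    ∑ c : ι → Fin n → V, (∏ i, iid w n (c i)) *
      idealDistortion d (fun i => prodKernel q (c i)) (fun i => prodKernel r (c i)) ≤ t.2.2 := by
  have hcard : (Fintype.card ι : ℝ) ≠ 0 := by exact_mod_cast Fintype.card_ne_zero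
  refine le_trans (le_of_eq ?_) h.dist_le
  simp only [idealDistortion, mul_left_comm _ (1 / (Fintype.card ι : ℝ)), ← Finset.mul_sum]
  rw [sum_prod_mul_sum (iid_mem_stdSimplex h.w_mem n).2 (fun a => ∑ x, ∑ y,
    prodKernel q a x * prodKernel r a y * avgDist d x y) Finset.univ,
    sum_iid_mul_avgDist h.w_mem h.q_mem h.r_mem d hn, Finset.card_univ, ← mul_assoc,
    one_div_mul_cancel hcard, one_mul]

theorem IsMixture.exists_code (h : IsMixture p d w q r t) (hd : ∀ x y, 0 ≤ d x y) {D : ℝ}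
    (hD : 0 ≤ D) (hdD : ∀ x y, d x y ≤ D) (hR : 0 ≤ R) (hRc : 0 ≤ Rc) (hn : n ≠ 0) {a : ℝ}
    (ha : 0 < a)
    (hgap : ∑ c : Fin (indexCard n R) × Fin (indexCard n Rc) → Fin n → V,
      (∏ i, iid w n (c i)) * (sourceGap p (fun i => prodKernel q (c i)) +
        outputGap p (fun i => prodKernel r (c i))) ≤ a) :
    ∃ c : Code X n R Rc, distortion p d c ≤ t.2.2 + √a + D * (√a * (t.2.2 + √a)) ∧
      tvDist (c.inducedY p) (iid p n) ≤ √a * (t.2.2 + √a) := by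
  have hM : Nonempty (Fin (indexCard n R)) := ⟨⟨0, indexCard_pos n hR⟩⟩
  have hJ : Nonempty (Fin (indexCard n Rc)) := ⟨⟨0, indexCard_pos n hRc⟩⟩
  have hq (a : Fin n → V) := prodKernel_mem_stdSimplex h.q_mem a
  have hr (a : Fin n → V) := prodKernel_mem_stdSimplex h.r_mem a
  have hsource (c : Fin (indexCard n R) × Fin (indexCard n Rc) → Fin n → V) :
      0 ≤ sourceGap p (fun i => prodKernel q (c i)) := by rw [sourceGap]; positivity
  have houtput (c : Fin (indexCard n R) × Fin (indexCard n Rc) → Fin n → V) :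
      0 ≤ outputGap p (fun i => prodKernel r (c i)) := by rw [outputGap]; positivity
  have hideal (c : Fin (indexCard n R) × Fin (indexCard n Rc) → Fin n → V) :
      0 ≤ idealDistortion d (fun i => prodKernel q (c i)) (fun i => prodKernel r (c i)) :=
    mul_nonneg (by positivity) (Finset.sum_nonneg fun i _ => Finset.sum_nonneg fun x _ =>
      Finset.sum_nonneg fun y _ => mul_nonneg (mul_nonneg ((hq _).1 _) ((hr _).1 _))
        (avgDist_nonneg hd x y))
  obtain ⟨codebook, hdist, hgaps⟩ := exists_le_and_le_of_sum_mul_le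
    (prod_apply_mem_stdSimplex (iid_mem_stdSimplex h.w_mem n)) hideal
    (fun c => add_nonneg (hsource c) (houtput c)) ha (h.mean_idealDistortion_le hn) hgap
  obtain ⟨c, hc_dist, hc_tv⟩ := exists_likelihood_code hR p hd hD hdD
    (fun i => hq (codebook i)) (fun i => hr (codebook i))
  refine ⟨c, hc_dist.trans ?_, hc_tv.trans ?_⟩
  · gcongr
    linarith [houtput codebook]
  · linarith [hsource codebook, houtput codebook]

theorem tendsto_div_sqrt_add_sqrt_rpow (C : ℝ) {γ : ℝ} (hγ : γ < 0) :
    Tendsto (fun n : ℕ => C / √n + 2 * √(4 * (2 : ℝ) ^ ((n : ℝ) * γ))) atTop (𝓝 0) := by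
  have hdiv : Tendsto (fun n : ℕ => C / √(n : ℝ)) atTop (𝓝 0) :=
    (Real.tendsto_sqrt_atTop.comp tendsto_natCast_atTop_atTop).const_div_atTop _
  have hgeom : Tendsto (fun n : ℕ => (2 : ℝ) ^ ((n : ℝ) * γ)) atTop (𝓝 0) := by
    simp_rw [mul_comm _ γ, Real.rpow_mul_natCast zero_le_two]
    exact tendsto_pow_atTop_nhds_zero_of_lt_one (by positivity)
      (Real.rpow_lt_one_of_one_lt_of_neg one_lt_two hγ)
  simpa using hdiv.add ((hgeom.const_mul 4).sqrt.const_mul 2)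

theorem IsMixture.exists_codes (h : IsMixture p d w q r (t.1, t.2.1, t.2.2))
    (hp : p ∈ stdSimplex ℝ X) (hp_pos : ∀ x, 0 < p x) (hd : ∀ x y, 0 ≤ d x y) {D : ℝ}
    (hD : 0 ≤ D) (hdD : ∀ x y, d x y ≤ D) (hR : 0 ≤ t.1) (hRc : 0 ≤ t.2.1) {ε : ℝ} (hε : 0 < ε) :
    ∃ a : ℕ → ℝ, Tendsto a atTop (𝓝 0) ∧ ∀ n : ℕ, n ≠ 0 →
      ∃ c : Code X n (t.1 + ε) t.2.1,
        distortion p d c ≤ t.2.2 + √(a n) + D * (√(a n) * (t.2.2 + √(a n))) ∧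
        tvDist (c.inducedY p) (iid p n) ≤ √(a n) * (t.2.2 + √(a n)) := by
  have hRε : 0 ≤ t.1 + ε := by linarith
  obtain ⟨C₁, hC₁, hsource⟩ := exists_mean_sourceGap_le hp hp_pos h.w_mem h.q_mem h.q_avg h.q_ent
    (half_pos hε) hRε hRc
  obtain ⟨C₂, hC₂, houtput⟩ := exists_mean_outputGap_le hp hp_pos h.w_mem h.r_mem h.r_avg h.r_ent
    (half_pos hε) hRε hRc
  refine ⟨_, tendsto_div_sqrt_add_sqrt_rpow (C₁ + C₂) (γ := -(ε / 2)) (by linarith),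
    fun n hn => h.exists_code hd hD hdD hRε hRc hn (by positivity) ?_⟩
  have hn1 : 1 ≤ n := Nat.one_le_iff_ne_zero.2 hn
  have hS := hsource n hn1
  have hO := houtput n hn1
  rw [show t.1 + ε / 2 - (t.1 + ε) = -(ε / 2) by ring] at hS
  rw [show t.1 + t.2.1 + ε / 2 - (t.1 + ε + t.2.1) = -(ε / 2) by ring] at hO
  have hsqrt : √(2 * (2 : ℝ) ^ ((n : ℝ) * -(ε / 2))) ≤ √(4 * (2 : ℝ) ^ ((n : ℝ) * -(ε / 2))) := by
    gcongr
    norm_num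
  simp only [mul_add, Finset.sum_add_distrib]
  rw [add_div]
  linarith

theorem IsMixture.achievableNearPerfect {Δ : ℝ} (h : IsMixture p d w q r (R, Rc, Δ))
    (hp : p ∈ stdSimplex ℝ X) (hp_pos : ∀ x, 0 < p x) (hd : ∀ x y, 0 ≤ d x y)
    (hR : 0 ≤ R) (hRc : 0 ≤ Rc) : AchievableNearPerfect p d R Rc Δ := by
  intro ε hε
  obtain ⟨D, hD, hdD⟩ := exists_distortion_bound d
  obtain ⟨a, ha, hcode⟩ := h.exists_codes (t := (R, Rc, Δ)) hp hp_pos hd hD hdD hR hRc hε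
  have hcode_all (n : ℕ) : ∃ c : Code X n (R + ε) Rc, n ≠ 0 →
      distortion p d c ≤ Δ + √(a n) + D * (√(a n) * (Δ + √(a n))) ∧
      tvDist (c.inducedY p) (iid p n) ≤ √(a n) * (Δ + √(a n)) := by
    rcases eq_or_ne n 0 with hn | hn
    · obtain ⟨c⟩ := Code.nonempty (n := n) (R := R + ε) (Rc := Rc) (by linarith) hp
      exact ⟨c, fun hn' => absurd hn hn'⟩
    · exact (hcode n hn).imp fun c hc _ => hc
  choose c hc using hcode_all
  have hsqrt : Tendsto (fun n => √(a n)) atTop (𝓝 0) := by simpa using ha.sqrt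
  have htv : Tendsto (fun n => √(a n) * (Δ + √(a n))) atTop (𝓝 0) := by
    simpa using hsqrt.mul (hsqrt.const_add Δ)
  have hdist : Tendsto (fun n => Δ + √(a n) + D * (√(a n) * (Δ + √(a n)))) atTop (𝓝 Δ) := by
    simpa using (hsqrt.const_add Δ).add (htv.const_mul D)
  refine ⟨c, limsup_le_of_forall_pos (fun n => distortion_nonneg _ hp hRc hd) fun e he => ?_,
    squeeze_zero' (Eventually.of_forall fun n => tvDist_nonneg _ _) ?_ htv⟩
  · filter_upwards [hdist.eventually_lt_const (show Δ < Δ + ε + e by linarith),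
      eventually_ne_atTop 0] with n hlt hn
    exact (hc n hn).1.trans hlt.le
  · filter_upwards [eventually_ne_atTop 0] with n hn
    exact (hc n hn).2

end RandomCoding

/-! ### The closure of the achievable set -/

theorem region_subset_closure {X : Type*} [Fintype X] {p : X → ℝ} {d : X → X → ℝ}
    (hp : p ∈ stdSimplex ℝ X) (hp_pos : ∀ x, 0 < p x) (hd : ∀ x y, 0 ≤ d x y) :
    region p d ⊆ closure {t : ℝ × ℝ × ℝ | 0 < t.1 ∧ 0 ≤ t.2.1 ∧ 0 < t.2.2 ∧
      AchievableNearPerfect p d t.1 t.2.1 t.2.2} := by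
  rintro ⟨R, Rc, Δ⟩ ht
  obtain ⟨hR, hRc, hΔ⟩ : 0 ≤ R ∧ 0 ≤ Rc ∧ 0 ≤ Δ := nonneg_of_mem_region hp hp_pos hd ht
  obtain ⟨s, w, q, r, hmix⟩ := exists_isMixture_of_mem_region hp ht
  have hcont : Continuous fun ε : ℝ => (R + ε, Rc, Δ + ε) := by fun_prop
  have hlim : Tendsto (fun ε : ℝ => (R + ε, Rc, Δ + ε)) (𝓝[>] 0) (𝓝 (R, Rc, Δ)) :=
    (hcont.tendsto' 0 _ (by simp)).mono_left nhdsWithin_le_nhds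
  refine mem_closure_of_tendsto hlim (eventually_nhdsWithin_of_forall fun ε hε => ?_)
  have hε : 0 < ε := hε
  exact ⟨add_pos_of_nonneg_of_pos hR hε, hRc, add_pos_of_nonneg_of_pos hΔ hε,
    (hmix.mono (le_add_of_nonneg_right hε.le) (le_add_of_nonneg_right hε.le)).achievableNearPerfect
      hp hp_pos hd (add_nonneg hR hε.le) hRc⟩

end RDP

end

theorem theorem3 {X : Type*} [Fintype X] [Primcodable X]
    (p : X → ℝ) (hp : p ∈ stdSimplex ℝ X) (hp_pos : ∀ x, 0 < p x)
    (hp_comp : RDP.ComputableRealMap p)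
    (d : X → X → ℝ) (hd : ∀ x y, 0 ≤ d x y)
    (B : ℕ → ℕ) (hB_comp : Computable B) (hB_pos : ∀ n, 1 ≤ n → 0 < B n)
    (hB_mono : ∀ m n, 1 ≤ m → m ≤ n → B m ≤ B n)
    (hB_lim : Filter.Tendsto (fun n => (B n : ℝ) / (Fintype.card X : ℝ) ^ n)
      Filter.atTop Filter.atTop) :
    (∀ R Rc Δ : ℝ, 0 < R → 0 ≤ Rc → 0 < Δ →
      (RDP.AchievableAlgorithmic p d R Rc B Δ ↔ RDP.AchievableNearPerfect p d R Rc Δ) ∧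
      (RDP.AchievableNearPerfect p d R Rc Δ ↔ RDP.AchievablePerfect p d R Rc Δ)) ∧
    closure {t : ℝ × ℝ × ℝ | 0 < t.1 ∧ 0 ≤ t.2.1 ∧ 0 < t.2.2 ∧
      RDP.AchievableAlgorithmic p d t.1 t.2.1 B t.2.2} = RDP.region p d := by
  have h_alg_near {R Rc Δ : ℝ} (hRc : 0 ≤ Rc) (h : RDP.AchievableAlgorithmic p d R Rc B Δ) :
      RDP.AchievableNearPerfect p d R Rc Δ :=
    h.nearPerfect hp hp_comp.2 hB_comp hB_pos hB_mono hB_lim hRc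
  have h_near_perf {R Rc Δ : ℝ} (hRc : 0 ≤ Rc) (h : RDP.AchievableNearPerfect p d R Rc Δ) :
      RDP.AchievablePerfect p d R Rc Δ :=
    h.perfect hp hd hRc
  have h_near_alg {R Rc Δ : ℝ} (hRc : 0 ≤ Rc) (h : RDP.AchievableNearPerfect p d R Rc Δ) :
      RDP.AchievableAlgorithmic p d R Rc B Δ :=
    (h_near_perf hRc h).algorithmic hp hRc hB_pos
  refine ⟨fun R Rc Δ _ hRc _ => ⟨⟨h_alg_near hRc, h_near_alg hRc⟩,
    ⟨h_near_perf hRc, fun h => h.nearPerfect⟩⟩, Set.Subset.antisymm ?_ ?_⟩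
  · refine closure_minimal ?_ (RDP.isClosed_region hp hp_pos d)
    rintro ⟨R, Rc, Δ⟩ ⟨hR, hRc, -, h⟩
    exact RDP.mem_region_of_achievablePerfect hp hp_pos hR.le hRc
      (h_near_perf hRc (h_alg_near hRc h))
  · refine (RDP.region_subset_closure hp hp_pos hd).trans (closure_mono ?_)
    exact fun t ⟨hR, hRc, hΔ, h⟩ => ⟨hR, hRc, hΔ, h_near_alg hRc h⟩
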